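/- A mixed-goods instance consists of $n\ge 1$ agents, $m\ge 0$ indivisible goods and a cake $C=[0,1]$; agent $i$ has an additive utility given by non-negative values $u_i(g)$ of the indivisible goods $g$, and a non-negative integrable density $f_i$ on $[0,1]$, with $u_i(S)=\int_S f_i(x)\,dx$ for a piece of cake $S$ (a finite union of subintervals of $[0,1]$). A partition into $k$ bundles distributes all indivisible goods and divides $C$ into $k$ pieces, where pieces meeting in finitely many boundary points count as disjoint; an allocation is a partition into $n$ bundles $A_1,\dots,A_n$, and $u_i(A_j)$ is the total value to agent $i$ of the goods and the cake in $A_j$. The maximin share $\mathrm{MMS}_i$ of agent $i$ is the maximum over all partitions $(P_1,\dots,P_n)$ of $\min_j u_i(P_j)$, and an allocation is $a$-MMS if $u_i(A_i)\ge a\cdot \mathrm{MMS}_i$ for every agent $i$. Theorem. Every mixed-goods instance admits an $\alpha$-MMS allocation, where $$\alpha=\min\Big\{1,\ \frac12+\min_{i}\frac{u_i(C)}{2(n-1)\,\mathrm{MMS}_i}\Big\},$$ and a fraction whose denominator is $0$ is read as $+\infty$. Moreover, for every constant $\epsilon>0$ there is a deterministic algorithm that, on every instance in which all $u_i(g)$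 and all $u_i(C)$ are rational, computes a rational number $\alpha'$ with $\alpha\le\alpha'\le 1$ and a $(1-\epsilon)\alpha'$-MMS allocation in time polynomial in $n$, $m$ and $L$, where $L$ is the total bit length of the input numbers $u_i(g)$ and $u_i(C)$. The algorithm receives $n$, $m$ and these numbers in binary and accesses the densities only through Robertson-Webb queries of unit cost: $\mathrm{Eval}$ returns $u_i([x,y])$, and $\mathrm{Cut}$ returns the leftmost point $y\ge x$ with $u_i([x,y])=\beta$ (or reports that there is none). Its other operations on natural numbers are charged the bit lengths of their operands; the real answers to queries can be stored, compared at unit cost, used in further queries and used as end points of the allocated intervals. -/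

import Mathlib

open MeasureTheory
open scoped ENNReal

namespace MixedGoods

/-! Mixed goods: `n` agents, `m` indivisible goods and the cake `[0, 1]`. -/

/-- A problem instance: additive non-negative utilities for the indivisible goods and non-negative
integrable density functions on the cake `[0, 1]`. -/
structure Instance (n m : ℕ) where
  good : Fin n → Fin m → ℝ
  good_nonneg : ∀ i g, 0 ≤ good i g
  density : Fin n → ℝ → ℝ
  density_nonneg : ∀ i, ∀ x ∈ Set.Icc (0 : ℝ) 1, 0 ≤ density i x
  density_integrable : ∀ i, IntegrableOn (density i) (Set.Icc (0 : ℝ) 1) volume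

/-- A piece of cake: a finite union of subintervals of `[0, 1]`. -/
def IsPiece (S : Set ℝ) : Prop :=
  ∃ F : Finset (ℝ × ℝ), (∀ p ∈ F, 0 ≤ p.1 ∧ p.1 ≤ p.2 ∧ p.2 ≤ 1) ∧
    S = ⋃ p ∈ F, Set.Icc p.1 p.2

/-- A partition of the `m` goods and the cake into `k` bundles. Densities are non-atomic, so pieces
are regarded as disjoint when they share only finitely many (boundary) points. -/
structure Allocation (k m : ℕ) where
  /-- the bundle that contains a given indivisible good -/
  owner : Fin m → Fin k
  /-- the cake in a given bundle -/
  piece : Fin k → Set ℝ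
  piece_isPiece : ∀ j, IsPiece (piece j)
  piece_disjoint : ∀ i j, i ≠ j → (piece i ∩ piece j).Finite
  piece_cover : ⋃ j, piece j = Set.Icc (0 : ℝ) 1

namespace Instance

variable {n m : ℕ} (I : Instance n m)

/-- `u_i(S)` for a set `S` of cake. -/
noncomputable def cakeUtility (i : Fin n) (S : Set ℝ) : ℝ :=
  ∫ x in S, I.density i x

/-- `u_i(C)`, the utility for the whole cake. -/
noncomputable def wholeCake (i : Fin n) : ℝ :=
  I.cakeUtility i (Set.Icc 0 1)

/-- Agent `i`'s utility for bundle `j`. -/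
noncomputable def utility (i : Fin n) {k : ℕ} (P : Allocation k m) (j : Fin k) : ℝ :=
  (∑ g with P.owner g = j, I.good i g) + I.cakeUtility i (P.piece j)

/-- The `k`-maximin share of agent `i`. -/
noncomputable def mms (i : Fin n) (k : ℕ) : ℝ :=
  ⨆ P : Allocation k m, ⨅ j : Fin k, I.utility i P j

/-- An allocation is `a`-MMS if every agent gets at least `a` times her maximin share. -/
def IsApproxMMS (a : ℝ) (A : Allocation n m) : Prop :=
  ∀ i, a * I.mms i n ≤ I.utility i A i

/-- `u_i(C) / (2 (n - 1) MMS_i)`, which is `+∞` if its denominator vanishes. -/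
noncomputable def cakeTerm (i : Fin n) : ℝ≥0∞ :=
  if 2 * ((n : ℝ) - 1) * I.mms i n = 0 then ⊤
  else ENNReal.ofReal (I.wholeCake i / (2 * ((n : ℝ) - 1) * I.mms i n))

/-- `min {1, 1/2 + min_i u_i(C) / (2 (n - 1) MMS_i)}`. -/
noncomputable def alpha : ℝ :=
  (min 1 (1 / 2 + ⨅ i, I.cakeTerm i)).toReal

/-! Robertson-Webb queries. Agents are named by numbers; numbers `≥ n` name nobody. -/

/-- `Eval`: the value `u_i([x, y])`. -/
noncomputable def evalQuery (i : ℕ) (x y : ℝ) : ℝ :=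
  if h : i < n then I.cakeUtility ⟨i, h⟩ (Set.Icc x y ∩ Set.Icc 0 1) else 0

open Classical in
/-- `Cut`: the leftmost point `y` of the cake with `x ≤ y` and `u_i([x, y]) = b`. If there is none,
the answer is `2`, which is not a point of the cake. -/
noncomputable def cutQuery (i : ℕ) (x b : ℝ) : ℝ :=
  if ∃ y ∈ Set.Icc x 1, I.evalQuery i x y = b then
    sInf {y | y ∈ Set.Icc x 1 ∧ I.evalQuery i x y = b}
  else 2

end Instance

/-! The machine: structured programs over arrays of natural numbers with logarithmic cost (every
operation is charged the number of bits that it touches, addresses included), extended by an array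
of real registers. Real registers are opaque: they can only be loaded with a quotient of natural
numbers, be used in Robertson-Webb queries, be compared, and be handed out as end points of
intervals. -/

/-- Binary operations on natural numbers: truncated subtraction, division rounded down. -/
inductive BinOp where
  | add
  | sub
  | mul
  | div

def BinOp.apply : BinOp → ℕ → ℕ → ℕ
  | .add, a, b => a + b
  | .sub, a, b => a - b
  | .mul, a, b => a * b
  | .div, a, b => a / b

/-- Expressions: literals, array look-up `a[e]` (for a fixed array `a`), and operations. -/
inductive Expr where
  | lit (k : ℕ)
  | get (a : ℕ) (e : Expr)
  | op (o : BinOp) (e₁ e₂ : Expr)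

/-- `mem a j` is entry `j` of array `a`; `real j` is real register `j`; `out` is the write-only list
of intervals handed out so far, each with the agent who gets it. -/
structure State where
  mem : ℕ → ℕ → ℕ
  real : ℕ → ℝ
  out : List (ℕ × ℝ × ℝ)

namespace Expr

def val (s : State) : Expr → ℕ
  | lit k => k
  | get a e => s.mem a (e.val s)
  | op o e₁ e₂ => o.apply (e₁.val s) (e₂.val s)

/-- Logarithmic cost; `Nat.size` is the number of binary digits. -/
def cost (s : State) : Expr → ℕ
  | lit k => 1 + k.size
  | get a e => e.cost s + 1 + (e.val s).size + (s.mem a (e.val s)).size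
  | op _ e₁ e₂ => e₁.cost s + e₂.cost s + 1 + (e₁.val s).size + (e₂.val s).size

end Expr

namespace State

def setMem (s : State) (a j v : ℕ) : State :=
  { s with mem := Function.update s.mem a (Function.update (s.mem a) j v) }

noncomputable def setReal (s : State) (j : ℕ) (v : ℝ) : State :=
  { s with real := Function.update s.real j v }

noncomputable def emit (s : State) (p : ℕ × ℝ × ℝ) : State :=
  { s with out := s.out ++ [p] }

end State

/-- Programs. -/
inductive Cmd where
  | skip
  /-- `a[j] := e` -/
  | set (a : ℕ) (j e : Expr)
  | seq (c₁ c₂ : Cmd)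
  /-- the first branch is taken when the test is nonzero -/
  | ite (e : Expr) (c₁ c₂ : Cmd)
  /-- repeat the body as long as the test is nonzero -/
  | loop (e : Expr) (c : Cmd)
  /-- real register `d` becomes `p / q` -/
  | load (d p q : Expr)
  /-- real register `d` becomes the answer to the query `Eval` for agent `i` and the interval between
  the points in registers `x` and `y` -/
  | evalQ (d i x y : Expr)
  /-- real register `d` becomes the answer to the query `Cut` for agent `i` from the point in
  register `x` with the value in register `b` -/
  | cutQ (d i x b : Expr)
  /-- `a[j] := 1` if register `x` is at most register `y`, and `a[j] := 0` otherwise -/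
  | cmp (a : ℕ) (j x y : Expr)
  /-- hand the interval between the points in registers `x` and `y` to agent `i` -/
  | give (i x y : Expr)

open Classical in
/-- `Exec I c s s' t`: on instance `I`, program `c` started in state `s` halts in state `s'` after
time `t`. Queries and comparisons take unit time beyond the evaluation of their addresses. -/
inductive Exec {n m : ℕ} (I : Instance n m) : Cmd → State → State → ℕ → Prop where
  | skip (s : State) : Exec I .skip s s 1
  | set (s : State) (a : ℕ) (j e : Expr) :
      Exec I (.set a j e) s (s.setMem a (j.val s) (e.val s))
        (1 + j.cost s + e.cost s + (j.val s).size + (e.val s).size)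
  | seq {c₁ c₂ : Cmd} {s s' s'' : State} {t₁ t₂ : ℕ} :
      Exec I c₁ s s' t₁ → Exec I c₂ s' s'' t₂ → Exec I (.seq c₁ c₂) s s'' (1 + t₁ + t₂)
  | iteTrue {e : Expr} {c₁ c₂ : Cmd} {s s' : State} {t : ℕ} :
      e.val s ≠ 0 → Exec I c₁ s s' t → Exec I (.ite e c₁ c₂) s s' (1 + e.cost s + t)
  | iteFalse {e : Expr} {c₁ c₂ : Cmd} {s s' : State} {t : ℕ} :
      e.val s = 0 → Exec I c₂ s s' t → Exec I (.ite e c₁ c₂) s s' (1 + e.cost s + t)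
  | loopTrue {e : Expr} {c : Cmd} {s s' s'' : State} {t₁ t₂ : ℕ} :
      e.val s ≠ 0 → Exec I c s s' t₁ → Exec I (.loop e c) s' s'' t₂ →
        Exec I (.loop e c) s s'' (1 + e.cost s + t₁ + t₂)
  | loopFalse {e : Expr} {c : Cmd} {s : State} :
      e.val s = 0 → Exec I (.loop e c) s s (1 + e.cost s)
  | load (s : State) (d p q : Expr) :
      Exec I (.load d p q) s (s.setReal (d.val s) ((p.val s : ℝ) / (q.val s : ℝ)))
        (1 + d.cost s + p.cost s + q.cost s + (d.val s).size + (p.val s).size + (q.val s).size)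
  | evalQ (s : State) (d i x y : Expr) :
      Exec I (.evalQ d i x y) s
        (s.setReal (d.val s) (I.evalQuery (i.val s) (s.real (x.val s)) (s.real (y.val s))))
        (1 + d.cost s + i.cost s + x.cost s + y.cost s +
          (d.val s).size + (i.val s).size + (x.val s).size + (y.val s).size)
  | cutQ (s : State) (d i x b : Expr) :
      Exec I (.cutQ d i x b) s
        (s.setReal (d.val s) (I.cutQuery (i.val s) (s.real (x.val s)) (s.real (b.val s))))
        (1 + d.cost s + i.cost s + x.cost s + b.cost s +
          (d.val s).size + (i.val s).size + (x.val s).size + (b.val s).size)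
  | cmp (s : State) (a : ℕ) (j x y : Expr) :
      Exec I (.cmp a j x y) s
        (s.setMem a (j.val s) (if s.real (x.val s) ≤ s.real (y.val s) then 1 else 0))
        (1 + j.cost s + x.cost s + y.cost s +
          (j.val s).size + (x.val s).size + (y.val s).size)
  | give (s : State) (i x y : Expr) :
      Exec I (.give i x y) s
        (s.emit (i.val s, s.real (x.val s), s.real (y.val s)))
        (1 + i.cost s + x.cost s + y.cost s +
          (i.val s).size + (x.val s).size + (y.val s).size)

/-- Programs are deterministic: final state and running time are determined by the start. -/
theorem Exec.deterministic {n m : ℕ} {I : Instance n m} {c : Cmd} {s s₁ s₂ : State} {t₁ t₂ : ℕ}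
    (h₁ : Exec I c s s₁ t₁) (h₂ : Exec I c s s₂ t₂) : s₁ = s₂ ∧ t₁ = t₂ := by
  induction h₁ generalizing s₂ t₂ with
  | seq _ _ ih₁ ih₂ =>
    cases h₂ with
    | seq k₁ k₂ =>
      obtain ⟨rfl, rfl⟩ := ih₁ k₁
      obtain ⟨rfl, rfl⟩ := ih₂ k₂
      exact ⟨rfl, rfl⟩
  | iteTrue h _ ih =>
    cases h₂ with
    | iteTrue _ k => obtain ⟨rfl, rfl⟩ := ih k; exact ⟨rfl, rfl⟩
    | iteFalse h' _ => exact absurd h' h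
  | iteFalse h _ ih =>
    cases h₂ with
    | iteTrue h' _ => exact absurd h h'
    | iteFalse _ k => obtain ⟨rfl, rfl⟩ := ih k; exact ⟨rfl, rfl⟩
  | loopTrue h _ _ ih₁ ih₂ =>
    cases h₂ with
    | loopTrue _ k₁ k₂ =>
      obtain ⟨rfl, rfl⟩ := ih₁ k₁
      obtain ⟨rfl, rfl⟩ := ih₂ k₂
      exact ⟨rfl, rfl⟩
    | loopFalse h' => exact absurd h' h
  | loopFalse h =>
    cases h₂ with
    | loopTrue h' _ _ => exact absurd h h'
    | loopFalse _ => exact ⟨rfl, rfl⟩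
  | _ => cases h₂; exact ⟨rfl, rfl⟩

/-! Input and output. The written input of an instance consists of `n`, `m`, and the rational numbers
`v i g = u_i(g)` and `w i = u_i(C)`; the densities are accessible through queries only. -/

/-- Input layout: array `0` holds `n, m`; arrays `1` and `2` hold, at position `i * m + g`, numerator
and denominator of `v i g`; arrays `3` and `4` hold, at position `i`, numerator and denominator of
`w i`. Everything else is `0`. -/
def inputMem {n m : ℕ} (v : Fin n → Fin m → ℚ) (w : Fin n → ℚ) (a j : ℕ) : ℕ :=
  let entry (q : ℚ → ℕ) : ℕ :=
    if h : j / m < n ∧ 0 < m then q (v ⟨j / m, h.1⟩ ⟨j % m, Nat.mod_lt j h.2⟩) else 0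
  match a with
  | 0 => if j = 0 then n else if j = 1 then m else 0
  | 1 => entry fun q => q.num.natAbs
  | 2 => entry fun q => q.den
  | 3 => if h : j < n then (w ⟨j, h⟩).num.natAbs else 0
  | 4 => if h : j < n then (w ⟨j, h⟩).den else 0
  | _ => 0

noncomputable def startState {n m : ℕ} (v : Fin n → Fin m → ℚ) (w : Fin n → ℚ) : State where
  mem := inputMem v w
  real := fun _ => 0
  out := []

/-- The number of bits of numerator and denominator of a rational number. -/
def ratBits (q : ℚ) : ℕ := q.num.natAbs.size + q.den.size

/-- `L`, the total bit length of the input numbers. -/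
def inputBits {n m : ℕ} (v : Fin n → Fin m → ℚ) (w : Fin n → ℚ) : ℕ :=
  (∑ i, ∑ g, ratBits (v i g)) + ∑ i, ratBits (w i)

/-- Output: array `5` names the owner of each indivisible good, and agent `i` gets the union of the
intervals handed to her. -/
def OutputsAllocation {n m : ℕ} (s : State) (A : Allocation n m) : Prop :=
  (∀ g : Fin m, s.mem 5 g = (A.owner g : ℕ)) ∧
    ∀ i : Fin n, A.piece i = {z | ∃ x y : ℝ, ((i : ℕ), x, y) ∈ s.out ∧ z ∈ Set.Icc x y}

/-- Output: array `6` holds numerator and denominator of the ratio. -/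
def outputRatio (s : State) : ℚ := (s.mem 6 0 : ℚ) / (s.mem 6 1 : ℚ)

end MixedGoods

/-! The existence part and the algorithm rest on the same construction. Suppose that every agent `i`
has a target `a i ≤ MMS_i` with `(n - 1) (2 a i - MMS_i) ≤ u_i(C)`; for `a i = α * MMS_i` these
inequalities are the definition of `α` (`Instance.alpha_target`). Then all targets can be met
(`Instance.exists_allocation_of_targets`). As long as some good alone satisfies some unserved agent,
it is given to her; this removes one good per agent, and since a good spoils only one bundle of a
maximin partition, the `r` agents that are left still value what is left at `r * MMS_i` or more
(`Instance.card_mul_mms_le`). The other agents are served by bag filling: a bag is filled with one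
good at a time, and as soon as the bag, topped up with cake from the left, satisfies somebody, it
goes to the agent who needs the least cake. If cake was needed, then nobody else values the bundle
above her own target. If not, the last good made the bag jump, but before that the bag with *all*
the cake left satisfied nobody; so the bundle, plus the cake left, is worth less than `2 a i`.
Accordingly, two inequalities are invariant (`BagFilling.serve`): an unserved agent values the goods
and the cake left at `r * a i` at least, and if the cake counts twice, at `(2 r - 1) a i` at least.
The first one shows that nobody remains unserved at the end (`BagFilling.act_eq_empty`).

For the algorithm, the maximin shares are approximated. All numbers are scaled to integers. For a
unit `w` and a precision `r`, the values of the goods are rounded down to multiples of `w`; goods of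
less than `r` units are treated like cake, and bundles are filled up to `Q = r * r` units. Whether
`n` bundles can be filled (`Accepts`) depends on how the large goods can be distributed, where loads
are truncated at `Q`, and only on the number of bundles of each load; there are at most
`(n + 1) ^ (Q + 1)` such numbers, so that a table decides it in polynomial time for fixed `r`. A
positive answer means `(Q - r) w ≤ MMS_i` (`Instance.sub_mul_le_mms`), a negative one
`MMS_i ≤ (Q + r) w` (`Instance.mms_le_add_mul`). Decreasing `w` by a factor of about `1 - 1 / r`
until the answer is positive takes a number of steps linear in the number of bits, and yields a
lower bound `(1 - 4 / r) MMS_i ≤ x i ≤ MMS_i`. The targets and the ratio are computed from `x i` in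
place of `MMS_i`; as `x i ≤ MMS_i`, the ratio is at least `α`. Bag filling with cut queries then
meets the targets exactly.

The running time is accounted for by a program logic with total correctness triples (`Ensures`) that
carry a bound `X` on the memory cells and a bound `H` on the number of turns of each loop. The time
is then bounded by a polynomial in `H` and the number of bits of `X` that depends on the text of the
program only (`Cmd.timeBound`, `exists_timeBound_poly`). -/

/-! ### A program logic for the machine -/

namespace MixedGoods

instance : Add Expr := ⟨.op .add⟩
instance : Sub Expr := ⟨.op .sub⟩
instance : Mul Expr := ⟨.op .mul⟩
instance : Div Expr := ⟨.op .div⟩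
instance (k : ℕ) : OfNat Expr k := ⟨.lit k⟩

namespace Expr

@[simp] theorem val_add (s : State) (a b : Expr) : (a + b).val s = a.val s + b.val s := rfl
@[simp] theorem val_sub (s : State) (a b : Expr) : (a - b).val s = a.val s - b.val s := rfl
@[simp] theorem val_mul (s : State) (a b : Expr) : (a * b).val s = a.val s * b.val s := rfl
@[simp] theorem val_div (s : State) (a b : Expr) : (a / b).val s = a.val s / b.val s := rfl
@[simp] theorem val_get (s : State) (a : ℕ) (e : Expr) : (get a e).val s = s.mem a (e.val s) := rfl
@[simp] theorem val_lit (s : State) (k : ℕ) : (lit k).val s = k := rfl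
@[simp] theorem val_zero (s : State) : (0 : Expr).val s = 0 := rfl
@[simp] theorem val_one (s : State) : (1 : Expr).val s = 1 := rfl
@[simp] theorem val_two (s : State) : (2 : Expr).val s = 2 := rfl

/-- A bound for the bit length of the value, in multiples of the word length. -/
def width : Expr → ℕ
  | lit k => k.size
  | get _ _ => 1
  | op _ a b => a.width + b.width + 1

/-- A bound for the cost of an evaluation, in multiples of the word length. -/
def weight : Expr → ℕ
  | lit k => k.size + 1
  | get _ e => e.weight + e.width + 2
  | op _ a b => a.weight + b.weight + a.width + b.width + 1

end Expr

/-- All memory cells are at most `X`. -/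
def State.Bdd (s : State) (X : ℕ) : Prop := ∀ a j, s.mem a j ≤ X

theorem size_add_le (a b : ℕ) : (a + b).size ≤ a.size + b.size + 1 := by
  rw [Nat.size_le]
  have ha := Nat.lt_size_self a
  have hb := Nat.lt_size_self b
  have h1 : 2 ^ a.size ≤ 2 ^ (a.size + b.size) := Nat.pow_le_pow_right (by norm_num) (by omega)
  have h2 : 2 ^ b.size ≤ 2 ^ (a.size + b.size) := Nat.pow_le_pow_right (by norm_num) (by omega)
  rw [pow_succ]; omega

theorem size_mul_le (a b : ℕ) : (a * b).size ≤ a.size + b.size := by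
  rw [Nat.size_le, pow_add]
  exact Nat.mul_lt_mul'' (Nat.lt_size_self a) (Nat.lt_size_self b)

theorem Expr.size_val_le {s : State} {X : ℕ} (hs : s.Bdd X) (e : Expr) :
    (e.val s).size ≤ e.width * (X.size + 1) := by
  induction e with
  | lit k => exact Nat.le_mul_of_pos_right _ (Nat.succ_pos _)
  | get a e _ =>
    simp only [Expr.val_get, width, one_mul]
    exact (Nat.size_le_size (hs _ _)).trans (Nat.le_succ _)
  | op o a b iha ihb =>
    have key : (o.apply (a.val s) (b.val s)).size ≤ (a.val s).size + (b.val s).size + 1 := by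
      cases o with
      | add => exact size_add_le _ _
      | sub => exact (Nat.size_le_size (Nat.sub_le _ _)).trans (by omega)
      | mul => exact (size_mul_le _ _).trans (by omega)
      | div => exact (Nat.size_le_size (Nat.div_le_self _ _)).trans (by omega)
    simp only [Expr.val, width]
    nlinarith

theorem Expr.cost_le {s : State} {X : ℕ} (hs : s.Bdd X) (e : Expr) :
    e.cost s ≤ e.weight * (X.size + 1) := by
  induction e with
  | lit k => simp only [cost, weight]; nlinarith
  | get a e ih =>
    have h1 := e.size_val_le hs
    have h2 := Nat.size_le_size (hs a (e.val s))
    simp only [cost, weight]; nlinarith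
  | op o a b iha ihb =>
    have h1 := a.size_val_le hs
    have h2 := b.size_val_le hs
    simp only [cost, weight]; nlinarith

namespace State

@[simp] theorem setMem_mem_same (s : State) (a j v : ℕ) :
    (s.setMem a j v).mem a = Function.update (s.mem a) j v := by simp [setMem]
@[simp] theorem setMem_mem_ne (s : State) {a b : ℕ} (h : b ≠ a) (j v : ℕ) :
    (s.setMem a j v).mem b = s.mem b := by simp [setMem, h]
@[simp] theorem setMem_real (s : State) (a j v : ℕ) : (s.setMem a j v).real = s.real := rfl
@[simp] theorem setMem_out (s : State) (a j v : ℕ) : (s.setMem a j v).out = s.out := rfl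
@[simp] theorem setReal_mem (s : State) (j : ℕ) (v : ℝ) : (s.setReal j v).mem = s.mem := rfl
@[simp] theorem setReal_out (s : State) (j : ℕ) (v : ℝ) : (s.setReal j v).out = s.out := rfl
@[simp] theorem setReal_real (s : State) (j : ℕ) (v : ℝ) :
    (s.setReal j v).real = Function.update s.real j v := rfl
@[simp] theorem emit_mem (s : State) (p : ℕ × ℝ × ℝ) : (s.emit p).mem = s.mem := rfl
@[simp] theorem emit_real (s : State) (p : ℕ × ℝ × ℝ) : (s.emit p).real = s.real := rfl
@[simp] theorem emit_out (s : State) (p : ℕ × ℝ × ℝ) : (s.emit p).out = s.out ++ [p] := rfl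

theorem Bdd.setMem {s : State} {X : ℕ} (hs : s.Bdd X) (a j : ℕ) {v : ℕ} (hv : v ≤ X) :
    (s.setMem a j v).Bdd X := by
  intro b k
  by_cases hb : b = a
  · subst hb
    by_cases hk : k = j
    · subst hk; simpa using hv
    · simpa [hk] using hs b k
  · simpa [hb] using hs b k

end State

namespace Cmd

/-- The arrays that a program may write to. -/
def writes : Cmd → List ℕ
  | set a _ _ => [a]
  | seq c₁ c₂ => c₁.writes ++ c₂.writes
  | ite _ c₁ c₂ => c₁.writes ++ c₂.writes
  | loop _ c => c.writes
  | cmp a _ _ _ => [a]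
  | _ => []

/-- The program touches neither the real registers nor the output. -/
def silent : Cmd → Bool
  | skip => true
  | set _ _ _ => true
  | seq c₁ c₂ => c₁.silent && c₂.silent
  | ite _ c₁ c₂ => c₁.silent && c₂.silent
  | loop _ c => c.silent
  | cmp _ _ _ _ => true
  | _ => false

/-- A bound for the running time, when every loop makes at most `H` turns and `Y` is the word
length. -/
def timeBound (H Y : ℕ) : Cmd → ℕ
  | skip => 1
  | set _ j e => (1 + j.weight + e.weight + j.width + e.width) * Y
  | seq c₁ c₂ => 1 + c₁.timeBound H Y + c₂.timeBound H Y
  | ite e c₁ c₂ => 1 + e.weight * Y + c₁.timeBound H Y + c₂.timeBound H Y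
  | loop e c => (H + 1) * (1 + e.weight * Y + c.timeBound H Y)
  | load d p q => (1 + d.weight + p.weight + q.weight + d.width + p.width + q.width) * Y
  | evalQ d i x y => (1 + d.weight + i.weight + x.weight + y.weight +
      d.width + i.width + x.width + y.width) * Y
  | cutQ d i x b => (1 + d.weight + i.weight + x.weight + b.weight +
      d.width + i.width + x.width + b.width) * Y
  | cmp _ j x y => (1 + j.weight + x.weight + y.weight + j.width + x.width + y.width) * Y
  | give i x y => (1 + i.weight + x.weight + y.weight + i.width + x.width + y.width) * Y

/-- What a run of `c` from `s` to `σ` leaves unchanged for syntactic reasons. -/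
def Frame (c : Cmd) (s σ : State) : Prop :=
  (∀ a, a ∉ c.writes → σ.mem a = s.mem a) ∧ (c.silent = true → σ.real = s.real ∧ σ.out = s.out)

theorem Frame.refl (c : Cmd) (s : State) : c.Frame s s := ⟨fun _ _ => rfl, fun _ => ⟨rfl, rfl⟩⟩

theorem Frame.trans {c : Cmd} {s σ τ : State} (h₁ : c.Frame s σ) (h₂ : c.Frame σ τ) :
    c.Frame s τ :=
  ⟨fun a ha => (h₂.1 a ha).trans (h₁.1 a ha), fun hc =>
    ⟨(h₂.2 hc).1.trans (h₁.2 hc).1, (h₂.2 hc).2.trans (h₁.2 hc).2⟩⟩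

theorem Frame.mono {c c' : Cmd} {s σ : State} (h : c.Frame s σ)
    (hw : ∀ a, a ∉ c'.writes → a ∉ c.writes) (hs : c'.silent = true → c.silent = true) :
    c'.Frame s σ :=
  ⟨fun a ha => h.1 a (hw a ha), fun hc => h.2 (hs hc)⟩

end Cmd

theorem Exec.frame {n m : ℕ} {I : Instance n m} {c : Cmd} {s s' : State} {t : ℕ}
    (h : Exec I c s s' t) : c.Frame s s' := by
  induction h with
  | skip s => exact Cmd.Frame.refl _ _
  | set s a j e =>
    refine ⟨fun b hb => State.setMem_mem_ne _ (by simpa [Cmd.writes] using hb) _ _,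
      fun _ => ⟨rfl, rfl⟩⟩
  | seq _ _ ih₁ ih₂ =>
    exact (ih₁.mono (by simp +contextual [Cmd.writes]) (by simp +contextual [Cmd.silent])).trans
      (ih₂.mono (by simp +contextual [Cmd.writes]) (by simp +contextual [Cmd.silent]))
  | iteTrue _ _ ih =>
    exact ih.mono (by simp +contextual [Cmd.writes]) (by simp +contextual [Cmd.silent])
  | iteFalse _ _ ih =>
    exact ih.mono (by simp +contextual [Cmd.writes]) (by simp +contextual [Cmd.silent])
  | loopTrue _ _ _ ih₁ ih₂ =>
    exact (ih₁.mono (by simp [Cmd.writes]) (by simp [Cmd.silent])).trans ih₂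
  | loopFalse _ => exact Cmd.Frame.refl _ _
  | cmp s a j x y =>
    refine ⟨fun b hb => State.setMem_mem_ne _ (by simpa [Cmd.writes] using hb) _ _,
      fun _ => ⟨rfl, rfl⟩⟩
  | _ => exact ⟨fun _ _ => rfl, fun h => by simp [Cmd.silent] at h⟩

section Logic

variable {n m : ℕ} {I : Instance n m} {X H : ℕ}

/-- Total correctness with resource bounds: if all memory cells of `s` are at most `X`, then `c`
halts from `s` within `c.timeBound H` in a state with the same bound on the cells that
satisfies `Q`. -/
def Ensures (I : Instance n m) (X H : ℕ) (c : Cmd) (Q : State → Prop) (s : State) : Prop :=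
  s.Bdd X → ∃ s' t, Exec I c s s' t ∧ t ≤ c.timeBound H (X.size + 1) ∧ s'.Bdd X ∧ Q s'

theorem Ensures.mono {c : Cmd} {Q R : State → Prop} {s : State} (h : Ensures I X H c Q s)
    (hQR : ∀ σ, c.Frame s σ → Q σ → R σ) : Ensures I X H c R s := fun hs => by
  obtain ⟨s', t, h1, h2, h3, h4⟩ := h hs
  exact ⟨s', t, h1, h2, h3, hQR _ h1.frame h4⟩

theorem ensures_skip {Q : State → Prop} {s : State} (h : Q s) : Ensures I X H .skip Q s :=
  fun hs => ⟨s, 1, .skip s, le_rfl, hs, h⟩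

theorem ensures_set {Q : State → Prop} {s : State} {a : ℕ} {j e : Expr}
    (hX : s.Bdd X → e.val s ≤ X) (h : Q (s.setMem a (j.val s) (e.val s))) :
    Ensures I X H (.set a j e) Q s := fun hs => by
  refine ⟨_, _, .set s a j e, ?_, hs.setMem _ _ (hX hs), h⟩
  have h1 := j.cost_le hs
  have h2 := e.cost_le hs
  have h3 := j.size_val_le hs
  have h4 := e.size_val_le hs
  simp only [Cmd.timeBound, add_mul]
  omega

theorem ensures_seq {Q : State → Prop} {s : State} {c₁ c₂ : Cmd}
    (h : Ensures I X H c₁ (Ensures I X H c₂ Q) s) : Ensures I X H (.seq c₁ c₂) Q s := fun hs => by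
  obtain ⟨s₁, t₁, e₁, l₁, b₁, h₁⟩ := h hs
  obtain ⟨s₂, t₂, e₂, l₂, b₂, h₂⟩ := h₁ b₁
  exact ⟨s₂, _, .seq e₁ e₂, by simp only [Cmd.timeBound]; omega, b₂, h₂⟩

theorem ensures_ite {Q : State → Prop} {s : State} {e : Expr} {c₁ c₂ : Cmd}
    (h₁ : e.val s ≠ 0 → Ensures I X H c₁ Q s) (h₂ : e.val s = 0 → Ensures I X H c₂ Q s) :
    Ensures I X H (.ite e c₁ c₂) Q s := fun hs => by
  have hc := e.cost_le hs
  by_cases he : e.val s = 0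
  · obtain ⟨s', t, h1, h2, h3, h4⟩ := h₂ he hs
    exact ⟨s', _, .iteFalse he h1, by simp only [Cmd.timeBound]; omega, h3, h4⟩
  · obtain ⟨s', t, h1, h2, h3, h4⟩ := h₁ he hs
    exact ⟨s', _, .iteTrue he h1, by simp only [Cmd.timeBound]; omega, h3, h4⟩

theorem ensures_load {Q : State → Prop} {s : State} {d p q : Expr}
    (h : Q (s.setReal (d.val s) ((p.val s : ℝ) / (q.val s : ℝ)))) :
    Ensures I X H (.load d p q) Q s := fun hs => by
  refine ⟨_, _, .load s d p q, ?_, hs, h⟩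
  have h1 := d.cost_le hs
  have h2 := p.cost_le hs
  have h3 := q.cost_le hs
  have h4 := d.size_val_le hs
  have h5 := p.size_val_le hs
  have h6 := q.size_val_le hs
  simp only [Cmd.timeBound, add_mul]
  omega

theorem ensures_cutQ {Q : State → Prop} {s : State} {d i x b : Expr}
    (h : Q (s.setReal (d.val s) (I.cutQuery (i.val s) (s.real (x.val s)) (s.real (b.val s))))) :
    Ensures I X H (.cutQ d i x b) Q s := fun hs => by
  refine ⟨_, _, .cutQ s d i x b, ?_, hs, h⟩
  have h1 := d.cost_le hs
  have h2 := i.cost_le hs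
  have h3 := x.cost_le hs
  have h4 := b.cost_le hs
  have h5 := d.size_val_le hs
  have h6 := i.size_val_le hs
  have h7 := x.size_val_le hs
  have h8 := b.size_val_le hs
  simp only [Cmd.timeBound, add_mul]
  omega

open Classical in
theorem ensures_cmp {Q : State → Prop} {s : State} {a : ℕ} {j x y : Expr} (hX : 1 ≤ X)
    (h : Q (s.setMem a (j.val s) (if s.real (x.val s) ≤ s.real (y.val s) then 1 else 0))) :
    Ensures I X H (.cmp a j x y) Q s := fun hs => by
  refine ⟨_, _, .cmp s a j x y, ?_, hs.setMem _ _ (by split_ifs <;> omega), h⟩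
  have h1 := j.cost_le hs
  have h2 := x.cost_le hs
  have h3 := y.cost_le hs
  have h4 := j.size_val_le hs
  have h5 := x.size_val_le hs
  have h6 := y.size_val_le hs
  simp only [Cmd.timeBound, add_mul]
  omega

theorem ensures_give {Q : State → Prop} {s : State} {i x y : Expr}
    (h : Q (s.emit (i.val s, s.real (x.val s), s.real (y.val s)))) :
    Ensures I X H (.give i x y) Q s := fun hs => by
  refine ⟨_, _, .give s i x y, ?_, hs, h⟩
  have h1 := i.cost_le hs
  have h2 := x.cost_le hs
  have h3 := y.cost_le hs
  have h4 := i.size_val_le hs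
  have h5 := x.size_val_le hs
  have h6 := y.size_val_le hs
  simp only [Cmd.timeBound, add_mul]
  omega

/-- The rule for loops: `P k` holds after `k` turns, and `P N` refutes the test. -/
theorem ensures_loop {Q : State → Prop} {s : State} {e : Expr} {c : Cmd} (P : ℕ → State → Prop)
    (N : ℕ) (hN : N ≤ H) (h0 : P 0 s)
    (hexit : ∀ σ, (Cmd.loop e c).Frame s σ → P N σ → e.val σ = 0)
    (hstep : ∀ k < N, ∀ σ, (Cmd.loop e c).Frame s σ → P k σ → e.val σ ≠ 0 →
      Ensures I X H c (P (k + 1)) σ)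
    (hQ : ∀ k σ, (Cmd.loop e c).Frame s σ → P k σ → e.val σ = 0 → Q σ) :
    Ensures I X H (.loop e c) Q s := by
  have key : ∀ d k σ, k + d = N → (Cmd.loop e c).Frame s σ → P k σ → σ.Bdd X →
      ∃ s' t, Exec I (.loop e c) σ s' t ∧
        t ≤ (d + 1) * (1 + e.weight * (X.size + 1) + c.timeBound H (X.size + 1)) ∧
        s'.Bdd X ∧ Q s' := by
    intro d
    induction d with
    | zero =>
      intro k σ hk hf hP hσ
      have he : e.val σ = 0 := hexit σ hf (by rw [← hk]; exact hP)
      refine ⟨σ, _, .loopFalse he, ?_, hσ, hQ _ _ hf hP he⟩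
      have := e.cost_le hσ
      omega
    | succ d ih =>
      intro k σ hk hf hP hσ
      by_cases he : e.val σ = 0
      · refine ⟨σ, _, .loopFalse he, ?_, hσ, hQ _ _ hf hP he⟩
        have := e.cost_le hσ
        nlinarith
      · obtain ⟨s₁, t₁, e₁, l₁, b₁, p₁⟩ := hstep k (by omega) σ hf hP he hσ
        have hf₁ : (Cmd.loop e c).Frame s s₁ :=
          hf.trans (e₁.frame.mono (by simp [Cmd.writes]) (by simp [Cmd.silent]))
        obtain ⟨s₂, t₂, e₂, l₂, b₂, p₂⟩ := ih (k + 1) s₁ (by omega) hf₁ p₁ b₁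
        refine ⟨s₂, _, .loopTrue he e₁ e₂, ?_, b₂, p₂⟩
        have := e.cost_le hσ
        rw [add_mul (d + 1)]
        omega
  intro hs
  obtain ⟨s', t, h1, h2, h3, h4⟩ := key N 0 s (by omega) (Cmd.Frame.refl _ _) h0 hs
  exact ⟨s', t, h1, h2.trans (Nat.mul_le_mul_right _ (by omega)), h3, h4⟩

/-- `for v := 0, ..., N - 1 do c`, with the counter in cell `0` of array `v`. -/
def Cmd.for (v : ℕ) (N : Expr) (c : Cmd) : Cmd :=
  .seq (.set v 0 0) (.loop (N - .get v 0) (.seq c (.set v 0 (.get v 0 + 1))))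

@[simp] theorem Cmd.writes_for (v : ℕ) (N : Expr) (c : Cmd) :
    (Cmd.for v N c).writes = v :: (c.writes ++ [v]) := rfl

@[simp] theorem Cmd.silent_for (v : ℕ) (N : Expr) (c : Cmd) :
    (Cmd.for v N c).silent = c.silent := by simp [Cmd.for, Cmd.silent]

/-- The rule for counting loops: `P k` holds after `k` turns. -/
theorem ensures_for {Q : State → Prop} {s : State} {v : ℕ} {N : Expr} {c : Cmd}
    (P : ℕ → State → Prop) (K : ℕ) (hKH : K ≤ H) (hKX : K ≤ X) (hv : v ∉ c.writes)
    (hN : ∀ σ, (Cmd.for v N c).Frame s σ → N.val σ = K)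
    (hP : ∀ k σ j, P k σ → P k (σ.setMem v 0 j))
    (h0 : P 0 s)
    (hstep : ∀ k < K, ∀ σ, (Cmd.for v N c).Frame s σ → σ.mem v 0 = k → P k σ →
      Ensures I X H c (P (k + 1)) σ)
    (hQ : ∀ σ, (Cmd.for v N c).Frame s σ → P K σ → Q σ) :
    Ensures I X H (Cmd.for v N c) Q s := by
  have hset : ∀ j, (Cmd.for v N c).Frame s (s.setMem v 0 j) := fun j =>
    ⟨fun a ha => State.setMem_mem_ne _ (by rintro rfl; simp at ha) _ _, fun _ => ⟨rfl, rfl⟩⟩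
  refine ensures_seq (ensures_set (fun _ => by simp) ?_)
  simp only [Expr.val_zero]
  have hfr : ∀ σ, (Cmd.loop (N - .get v 0) (.seq c (.set v 0 (.get v 0 + 1)))).Frame
      (s.setMem v 0 0) σ → (Cmd.for v N c).Frame s σ := fun σ h =>
    (hset 0).trans (h.mono (by simp [Cmd.writes]) (by simp [Cmd.silent]))
  refine ensures_loop (fun k σ => k ≤ K ∧ σ.mem v 0 = k ∧ P k σ) K hKH
    ⟨Nat.zero_le _, by simp, hP _ _ _ h0⟩ ?_ ?_ ?_
  · rintro σ hf ⟨_, hk, _⟩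
    simp [hN σ (hfr σ hf), hk]
  · rintro k hk σ hf ⟨_, hσ, hPk⟩ _
    refine ensures_seq ((hstep k hk σ (hfr σ hf) hσ hPk).mono fun τ hτ hPτ => ?_)
    have hvτ : τ.mem v 0 = k := by rw [hτ.1 v hv, hσ]
    refine ensures_set (fun _ => by simp [hvτ]; omega) ?_
    simp only [Expr.val_zero, Expr.val_add, Expr.val_get, Expr.val_one, hvτ]
    exact ⟨hk, by simp, hP _ _ _ hPτ⟩
  · rintro k σ hf ⟨hk, hσ, hPk⟩ he
    have : K ≤ k := by simpa [hN σ (hfr σ hf), hσ, Nat.sub_eq_zero_iff_le] using he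
    obtain rfl : k = K := by omega
    exact hQ σ (hfr σ hf) hPk

end Logic

/-- The time bound is a polynomial if the bound on loop turns and the word length are. -/
theorem exists_timeBound_poly {σ : Type*} (c : Cmd) (pH pY : MvPolynomial σ ℕ) :
    ∃ p : MvPolynomial σ ℕ, ∀ x : σ → ℕ,
      c.timeBound (MvPolynomial.eval x pH) (MvPolynomial.eval x pY) = MvPolynomial.eval x p := by
  have atom : ∀ k : ℕ, ∃ p : MvPolynomial σ ℕ, ∀ x : σ → ℕ,
      k * MvPolynomial.eval x pY = MvPolynomial.eval x p := fun k =>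
    ⟨MvPolynomial.C k * pY, fun x => by simp⟩
  induction c with
  | skip => exact ⟨1, fun x => by simp [Cmd.timeBound]⟩
  | seq c₁ c₂ ih₁ ih₂ =>
    obtain ⟨p₁, h₁⟩ := ih₁
    obtain ⟨p₂, h₂⟩ := ih₂
    exact ⟨1 + p₁ + p₂, fun x => by simp [Cmd.timeBound, h₁, h₂]⟩
  | ite e c₁ c₂ ih₁ ih₂ =>
    obtain ⟨p₁, h₁⟩ := ih₁
    obtain ⟨p₂, h₂⟩ := ih₂
    exact ⟨1 + MvPolynomial.C e.weight * pY + p₁ + p₂, fun x => by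
      simp [Cmd.timeBound, h₁, h₂]⟩
  | loop e c ih =>
    obtain ⟨p, h⟩ := ih
    exact ⟨(pH + 1) * (1 + MvPolynomial.C e.weight * pY + p), fun x => by
      simp [Cmd.timeBound, h]⟩
  | _ => exact atom _

end MixedGoods

/-! ### Cutting the cake -/

namespace MixedGoods

namespace Instance

variable {n m : ℕ} (I : Instance n m)

theorem IsPiece.measurableSet {S : Set ℝ} (h : IsPiece S) : MeasurableSet S := by
  obtain ⟨F, -, rfl⟩ := h
  exact F.measurableSet_biUnion fun _ _ => measurableSet_Icc

theorem IsPiece.subset {S : Set ℝ} (h : IsPiece S) : S ⊆ Set.Icc 0 1 := by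
  obtain ⟨F, hF, rfl⟩ := h
  exact Set.iUnion₂_subset fun p hp => Set.Icc_subset_Icc (hF p hp).1 (hF p hp).2.2

theorem cakeUtility_mono (i : Fin n) {S T : Set ℝ} (hST : S ⊆ T) (hT : T ⊆ Set.Icc 0 1)
    (hTm : MeasurableSet T) : I.cakeUtility i S ≤ I.cakeUtility i T := by
  refine setIntegral_mono_set ((I.density_integrable i).mono_set hT) ?_ hST.eventuallyLE
  filter_upwards [ae_restrict_mem hTm] with x hx using I.density_nonneg i x (hT hx)

theorem cakeUtility_nonneg (i : Fin n) {S : Set ℝ} (hS : S ⊆ Set.Icc 0 1)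
    (hSm : MeasurableSet S) : 0 ≤ I.cakeUtility i S :=
  setIntegral_nonneg hSm fun x hx => I.density_nonneg i x (hS hx)

/-- The value of the cake to the left of `y`. -/
noncomputable def prefixCake (i : Fin n) (y : ℝ) : ℝ := I.cakeUtility i (Set.Icc 0 y)

theorem cakeUtility_Icc (i : Fin n) {x y : ℝ} (hx : 0 ≤ x) (hxy : x ≤ y) (hy : y ≤ 1) :
    I.cakeUtility i (Set.Icc x y) = I.prefixCake i y - I.prefixCake i x := by
  have h : IntegrableOn (I.density i) (Set.Icc 0 1) := I.density_integrable i
  have e : Set.Icc 0 y = Set.Icc 0 x ∪ Set.Ioc x y := (Set.Icc_union_Ioc_eq_Icc hx hxy).symm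
  have hd : Disjoint (Set.Icc 0 x) (Set.Ioc x y) := by
    rw [Set.disjoint_left]; rintro z ⟨_, h1⟩ ⟨h2, _⟩; linarith
  rw [prefixCake, prefixCake, cakeUtility, cakeUtility, cakeUtility, e,
    setIntegral_union hd measurableSet_Ioc
      (h.mono_set (Set.Icc_subset_Icc le_rfl (hxy.trans hy)))
      (h.mono_set (Set.Ioc_subset_Icc_self.trans (Set.Icc_subset_Icc hx hy))),
    integral_Icc_eq_integral_Ioc]
  ring

theorem prefixCake_zero (i : Fin n) : I.prefixCake i 0 = 0 := by
  simp [prefixCake, cakeUtility]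

theorem prefixCake_one (i : Fin n) : I.prefixCake i 1 = I.wholeCake i := rfl

theorem prefixCake_mono (i : Fin n) {x y : ℝ} (hxy : x ≤ y) (hy : y ≤ 1) :
    I.prefixCake i x ≤ I.prefixCake i y :=
  I.cakeUtility_mono i (Set.Icc_subset_Icc le_rfl hxy) (Set.Icc_subset_Icc le_rfl hy)
    measurableSet_Icc

theorem wholeCake_nonneg (i : Fin n) : 0 ≤ I.wholeCake i :=
  I.cakeUtility_nonneg i le_rfl measurableSet_Icc

theorem continuousOn_prefixCake (i : Fin n) : ContinuousOn (I.prefixCake i) (Set.Icc 0 1) := by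
  have h : IntegrableOn (I.density i) (Set.uIcc 0 1) := by
    rw [Set.uIcc_of_le zero_le_one]; exact I.density_integrable i
  have := intervalIntegral.continuousOn_primitive_interval (f := I.density i) (μ := volume)
    (a := 0) (b := 1) h
  rw [Set.uIcc_of_le zero_le_one] at this
  refine this.congr fun x hx => ?_
  simp only [prefixCake, cakeUtility]
  rw [integral_Icc_eq_integral_Ioc, intervalIntegral.integral_of_le hx.1]

theorem evalQuery_eq (i : Fin n) {x y : ℝ} (hx : 0 ≤ x) (hxy : x ≤ y) (hy : y ≤ 1) :
    I.evalQuery i x y = I.prefixCake i y - I.prefixCake i x := by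
  rw [evalQuery, dif_pos i.2, Set.inter_eq_left.mpr (Set.Icc_subset_Icc hx hy),
    I.cakeUtility_Icc i hx hxy hy]

/-- A cut query for a value in the range of the remaining cake is answered by the leftmost
suitable point. -/
theorem cutQuery_spec (i : Fin n) {x b : ℝ} (hx : 0 ≤ x) (hx1 : x ≤ 1) (hb : 0 ≤ b)
    (hb' : b ≤ I.prefixCake i 1 - I.prefixCake i x) :
    x ≤ I.cutQuery i x b ∧ I.cutQuery i x b ≤ 1 ∧
      I.prefixCake i (I.cutQuery i x b) - I.prefixCake i x = b ∧
      ∀ y, x ≤ y → y ≤ 1 → I.prefixCake i y - I.prefixCake i x = b → I.cutQuery i x b ≤ y := by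
  set S : Set ℝ := {y | y ∈ Set.Icc x 1 ∧ I.evalQuery i x y = b} with hS
  have hS' : S = Set.Icc x 1 ∩ (I.prefixCake i) ⁻¹' {b + I.prefixCake i x} := by
    ext y
    simp only [hS, Set.mem_ofPred_eq, Set.mem_inter_iff, Set.mem_preimage, Set.mem_singleton_iff]
    refine and_congr_right fun hy => ?_
    rw [I.evalQuery_eq i hx hy.1 hy.2, sub_eq_iff_eq_add]
  have hcont : ContinuousOn (I.prefixCake i) (Set.Icc x 1) :=
    (I.continuousOn_prefixCake i).mono (Set.Icc_subset_Icc hx le_rfl)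
  have hne : S.Nonempty := by
    obtain ⟨y, hy, hy'⟩ := intermediate_value_Icc hx1 hcont
      (show b + I.prefixCake i x ∈ Set.Icc (I.prefixCake i x) (I.prefixCake i 1) from
        ⟨by linarith, by linarith⟩)
    exact ⟨y, by rw [hS']; exact ⟨hy, hy'⟩⟩
  have hcl : IsClosed S := by
    rw [hS']; exact hcont.preimage_isClosed_of_isClosed isClosed_Icc isClosed_singleton
  have hbdd : BddBelow S := ⟨x, fun y hy => hy.1.1⟩
  have hcut : I.cutQuery i x b = sInf S := by
    rw [cutQuery, if_pos]
    obtain ⟨y, hy⟩ := hne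
    exact ⟨y, hy.1, hy.2⟩
  have hmem : sInf S ∈ S := hcl.csInf_mem hne hbdd
  rw [hcut]
  refine ⟨hmem.1.1, hmem.1.2, ?_, fun y h1 h2 h3 => csInf_le hbdd ⟨⟨h1, h2⟩, ?_⟩⟩
  · rw [← I.evalQuery_eq i hx hmem.1.1 hmem.1.2]; exact hmem.2
  · rw [I.evalQuery_eq i hx h1 h2, h3]

theorem cutQuery_eq_two (i : Fin n) {x b : ℝ} (hx : 0 ≤ x)
    (hb : I.prefixCake i 1 - I.prefixCake i x < b) : I.cutQuery i x b = 2 := by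
  rw [cutQuery, if_neg]
  rintro ⟨y, hy, h⟩
  rw [I.evalQuery_eq i hx hy.1 hy.2] at h
  have := I.prefixCake_mono i hy.2 le_rfl
  linarith

end Instance

/-- The cake that agent `i` gets from a list of intervals. -/
def pieceOf (out : List (ℕ × ℝ × ℝ)) (i : ℕ) : Set ℝ :=
  {z | ∃ x y : ℝ, (i, x, y) ∈ out ∧ z ∈ Set.Icc x y}

/-- The intervals of the list tile `[0, x]` from left to right. -/
inductive Tiles : List (ℕ × ℝ × ℝ) → ℝ → Prop
  | nil : Tiles [] 0
  | snoc {out : List (ℕ × ℝ × ℝ)} {x y : ℝ} (i : ℕ) :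
      Tiles out x → x ≤ y → Tiles (out ++ [(i, x, y)]) y

theorem pieceOf_snoc_same (out : List (ℕ × ℝ × ℝ)) (i : ℕ) (x y : ℝ) :
    pieceOf (out ++ [(i, x, y)]) i = pieceOf out i ∪ Set.Icc x y := by
  ext z
  simp only [pieceOf, List.mem_append, List.mem_singleton, Set.mem_ofPred_eq, Set.mem_union]
  constructor
  · rintro ⟨a, b, h | h, hz⟩
    · exact Or.inl ⟨a, b, h, hz⟩
    · simp only [Prod.mk.injEq, true_and] at h
      obtain ⟨rfl, rfl⟩ := h
      exact Or.inr hz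
  · rintro (⟨a, b, h, hz⟩ | hz)
    · exact ⟨a, b, Or.inl h, hz⟩
    · exact ⟨x, y, Or.inr rfl, hz⟩

theorem pieceOf_snoc_ne (out : List (ℕ × ℝ × ℝ)) {i j : ℕ} (h : j ≠ i) (x y : ℝ) :
    pieceOf (out ++ [(i, x, y)]) j = pieceOf out j := by
  ext z
  simp [pieceOf, h]

theorem pieceOf_subset_snoc (out : List (ℕ × ℝ × ℝ)) (i j : ℕ) (x y : ℝ) :
    pieceOf out j ⊆ pieceOf (out ++ [(i, x, y)]) j := by
  rintro z ⟨a, b, h, hz⟩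
  exact ⟨a, b, List.mem_append_left _ h, hz⟩

namespace Tiles

variable {out : List (ℕ × ℝ × ℝ)} {x : ℝ}

theorem nonneg (h : Tiles out x) : 0 ≤ x := by
  induction h with
  | nil => exact le_rfl
  | snoc i _ h ih => exact ih.trans h

theorem mem_bounds (h : Tiles out x) : ∀ p ∈ out, 0 ≤ p.2.1 ∧ p.2.1 ≤ p.2.2 ∧ p.2.2 ≤ x := by
  induction h with
  | nil => simp
  | snoc i h hxy ih =>
    intro p hp
    rcases List.mem_append.1 hp with hp | hp
    · exact ⟨(ih p hp).1, (ih p hp).2.1, (ih p hp).2.2.trans hxy⟩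
    · obtain rfl := List.mem_singleton.1 hp
      exact ⟨h.nonneg, hxy, le_rfl⟩

theorem pieceOf_subset (h : Tiles out x) (i : ℕ) : pieceOf out i ⊆ Set.Icc 0 x := by
  rintro z ⟨a, b, hp, hz⟩
  obtain ⟨h1, -, h3⟩ := h.mem_bounds _ hp
  exact ⟨h1.trans hz.1, hz.2.trans h3⟩

theorem isPiece (h : Tiles out x) (hx : x ≤ 1) (i : ℕ) : IsPiece (pieceOf out i) := by
  refine ⟨((out.filter fun p => p.1 = i).map Prod.snd).toFinset, fun p hp => ?_, ?_⟩
  · simp only [List.mem_toFinset, List.mem_map, List.mem_filter] at hp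
    obtain ⟨q, ⟨hq, -⟩, rfl⟩ := hp
    obtain ⟨h1, h2, h3⟩ := h.mem_bounds _ hq
    exact ⟨h1, h2, h3.trans hx⟩
  · ext z
    simp only [pieceOf, Set.mem_ofPred_eq, Set.mem_iUnion, List.mem_toFinset, List.mem_map,
      List.mem_filter, decide_eq_true_eq]
    constructor
    · rintro ⟨a, b, h1, h2⟩
      exact ⟨(a, b), ⟨_, ⟨h1, rfl⟩, rfl⟩, h2⟩
    · rintro ⟨_, ⟨⟨j, a, b⟩, ⟨h1, rfl⟩, rfl⟩, h2⟩
      exact ⟨a, b, h1, h2⟩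

theorem inter_finite (h : Tiles out x) {i j : ℕ} (hij : i ≠ j) :
    (pieceOf out i ∩ pieceOf out j).Finite := by
  induction h with
  | nil => simp [pieceOf]
  | @snoc out x y k h hxy ih =>
    refine (ih.union (Set.finite_singleton x)).subset ?_
    rintro z ⟨hi, hj⟩
    by_cases hki : i = k
    · subst hki
      rw [pieceOf_snoc_same] at hi
      rw [pieceOf_snoc_ne _ (Ne.symm hij)] at hj
      rcases hi with hi | hi
      · exact Or.inl ⟨hi, hj⟩
      · exact Or.inr (le_antisymm (h.pieceOf_subset j hj).2 hi.1)
    · rw [pieceOf_snoc_ne _ hki] at hi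
      by_cases hkj : j = k
      · subst hkj
        rw [pieceOf_snoc_same] at hj
        rcases hj with hj | hj
        · exact Or.inl ⟨hi, hj⟩
        · exact Or.inr (le_antisymm (h.pieceOf_subset i hi).2 hj.1)
      · rw [pieceOf_snoc_ne _ hkj] at hj
        exact Or.inl ⟨hi, hj⟩

theorem eq_zero (h : Tiles out x) (hout : out = []) : x = 0 := by
  cases h with
  | nil => rfl
  | snoc => simp at hout

theorem exists_mem (h : Tiles out x) {z : ℝ} (hz : z ∈ Set.Icc 0 x) (hne : out ≠ []) :
    ∃ p ∈ out, z ∈ Set.Icc p.2.1 p.2.2 := by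
  induction h with
  | nil => exact absurd rfl hne
  | @snoc out x y k h hxy ih =>
    by_cases hzx : x ≤ z
    · exact ⟨_, List.mem_append_right _ (List.mem_singleton.2 rfl), hzx, hz.2⟩
    · push Not at hzx
      have : out ≠ [] := fun ho => absurd hz.1 (not_le.2 (h.eq_zero ho ▸ hzx))
      obtain ⟨p, hp, hp'⟩ := ih ⟨hz.1, hzx.le⟩ this
      exact ⟨p, List.mem_append_left _ hp, hp'⟩

end Tiles

/-- The allocation given by an ownership of the goods and a tiling of the cake. -/
def Tiles.allocation {k m : ℕ} {out : List (ℕ × ℝ × ℝ)} (h : Tiles out 1)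
    (hout : ∀ p ∈ out, p.1 < k) (owner : Fin m → Fin k) : Allocation k m where
  owner := owner
  piece j := pieceOf out j
  piece_isPiece j := h.isPiece le_rfl j
  piece_disjoint i j hij := h.inter_finite (Fin.val_ne_of_ne hij)
  piece_cover := by
    refine Set.Subset.antisymm (Set.iUnion_subset fun j => h.pieceOf_subset j) fun z hz => ?_
    have hne : out ≠ [] := by
      intro ho
      exact one_ne_zero (h.eq_zero ho)
    obtain ⟨⟨i, x, y⟩, hp, hz⟩ := h.exists_mem hz hne
    exact Set.mem_iUnion.2 ⟨⟨i, hout _ hp⟩, x, y, hp, hz⟩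

namespace Instance

variable {n m : ℕ} (I : Instance n m)

theorem exists_tiles_of_sum_le (i : Fin n) {k : ℕ} (d : ℕ → ℝ) (hd : ∀ j, 0 ≤ d j)
    (hsum : ∑ j ∈ Finset.range k, d j ≤ I.wholeCake i) :
    ∃ out x, Tiles out x ∧ x ≤ 1 ∧ (∀ p ∈ out, p.1 < k) ∧
      I.prefixCake i x = ∑ j ∈ Finset.range k, d j ∧
      ∀ j < k, d j ≤ I.cakeUtility i (pieceOf out j) := by
  induction k with
  | zero => exact ⟨[], 0, .nil, zero_le_one, by simp, by simp [prefixCake_zero], by simp⟩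
  | succ k ih =>
    rw [Finset.sum_range_succ] at hsum
    obtain ⟨out, x, ht, hx, hout, hval, hd'⟩ := ih (by linarith [hd k])
    obtain ⟨h1, h2, h3, -⟩ := I.cutQuery_spec i (b := d k) ht.nonneg hx (hd k)
      (by rw [prefixCake_one, hval]; linarith)
    set y := I.cutQuery i x (d k)
    have ht' := Tiles.snoc k ht h1
    refine ⟨_, y, ht', h2, ?_, by rw [Finset.sum_range_succ]; linarith, fun j hj => ?_⟩
    · intro p hp
      rcases List.mem_append.1 hp with hp | hp
      · exact (hout p hp).trans (Nat.lt_succ_self k)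
      · obtain rfl := List.mem_singleton.1 hp
        exact Nat.lt_succ_self k
    · have hp := ht'.isPiece h2 j
      rcases Nat.lt_succ_iff_lt_or_eq.1 hj with hj | rfl
      · exact (hd' j hj).trans (I.cakeUtility_mono i (pieceOf_subset_snoc _ _ _ _ _)
          (IsPiece.subset hp) (IsPiece.measurableSet hp))
      · rw [← h3, ← I.cakeUtility_Icc i ht.nonneg h1 h2]
        refine I.cakeUtility_mono i ?_ (IsPiece.subset hp) (IsPiece.measurableSet hp)
        rw [pieceOf_snoc_same]
        exact Set.subset_union_right

/-- The cake can be divided so as to meet any demands that add up to at most its value. -/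
theorem exists_allocation_of_sum_le (i : Fin n) {k : ℕ} (hk : 0 < k) (owner : Fin m → Fin k)
    (d : Fin k → ℝ) (hd : ∀ j, 0 ≤ d j) (hsum : ∑ j, d j ≤ I.wholeCake i) :
    ∃ P : Allocation k m, P.owner = owner ∧ ∀ j, d j ≤ I.cakeUtility i (P.piece j) := by
  obtain ⟨out, x, ht, hx, hout, -, hd'⟩ := I.exists_tiles_of_sum_le i (k := k)
    (fun j => if h : j < k then d ⟨j, h⟩ else 0)
    (fun j => by split_ifs; exacts [hd _, le_rfl])
    (by rw [Finset.sum_range]; simpa using hsum)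
  have ht' := Tiles.snoc 0 ht hx
  refine ⟨ht'.allocation (k := k) ?_ owner, rfl, fun j => ?_⟩
  · intro p hp
    rcases List.mem_append.1 hp with hp | hp
    · exact hout p hp
    · obtain rfl := List.mem_singleton.1 hp
      exact hk
  · have h := hd' j j.2
    simp only [j.2, dif_pos] at h
    have hp := ht'.isPiece le_rfl j
    exact h.trans (I.cakeUtility_mono i (pieceOf_subset_snoc _ _ _ _ _)
      (IsPiece.subset hp) (IsPiece.measurableSet hp))

end Instance

end MixedGoods

/-! ### Maximin shares -/

namespace MixedGoods

namespace Instance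

variable {n m : ℕ} (I : Instance n m)

theorem utility_nonneg (i : Fin n) {k : ℕ} (P : Allocation k m) (j : Fin k) :
    0 ≤ I.utility i P j :=
  add_nonneg (Finset.sum_nonneg fun g _ => I.good_nonneg i g)
    (I.cakeUtility_nonneg i (IsPiece.subset (P.piece_isPiece j))
      (IsPiece.measurableSet (P.piece_isPiece j)))

theorem sum_cakeUtility (i : Fin n) {k : ℕ} (P : Allocation k m) :
    ∑ j, I.cakeUtility i (P.piece j) = I.wholeCake i := by
  have h := integral_iUnion_ae (μ := volume) (f := I.density i) (s := P.piece)
    (fun j => (IsPiece.measurableSet (P.piece_isPiece j)).nullMeasurableSet)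
    (fun a b hab => (P.piece_disjoint a b hab).measure_zero volume)
    (by rw [P.piece_cover]; exact I.density_integrable i)
  rw [P.piece_cover, tsum_fintype] at h
  exact h.symm

theorem nonempty_allocation (I : Instance n m) (hn : 0 < n) (i : Fin n) :
    Nonempty (Allocation n m) := by
  obtain ⟨P, -⟩ := I.exists_allocation_of_sum_le i hn (fun _ : Fin m => (⟨0, hn⟩ : Fin n))
    (fun _ => 0) (fun _ => le_rfl) (by simpa using I.wholeCake_nonneg i)
  exact ⟨P⟩

theorem utility_le (i : Fin n) {k : ℕ} (P : Allocation k m) (j : Fin k) :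
    I.utility i P j ≤ ∑ g, I.good i g + I.wholeCake i := by
  refine add_le_add (Finset.sum_le_sum_of_subset_of_nonneg (Finset.filter_subset _ _)
    fun g _ _ => I.good_nonneg i g) ?_
  exact I.cakeUtility_mono i (IsPiece.subset (P.piece_isPiece j)) le_rfl measurableSet_Icc

theorem iInf_utility_le (i : Fin n) {k : ℕ} (P : Allocation k m) (j : Fin k) :
    ⨅ j, I.utility i P j ≤ I.utility i P j :=
  ciInf_le (Set.finite_range _).bddBelow j

theorem le_mms (i : Fin n) (P : Allocation n m) {θ : ℝ} (h : ∀ j, θ ≤ I.utility i P j) :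
    θ ≤ I.mms i n := by
  have : Nonempty (Fin n) := ⟨i⟩
  refine (le_ciInf h).trans (le_ciSup (f := fun P : Allocation n m => ⨅ j, I.utility i P j) ?_ P)
  exact ⟨_, Set.forall_mem_range.2 fun P =>
    (I.iInf_utility_le i P i).trans (I.utility_le i P i)⟩

theorem mms_le (i : Fin n) {θ : ℝ}
    (h : ∀ P : Allocation n m, ∀ μ, (∀ j, μ ≤ I.utility i P j) → μ ≤ θ) :
    I.mms i n ≤ θ := by
  have := I.nonempty_allocation (Fin.pos i) i
  exact ciSup_le fun P => h P _ fun j => I.iInf_utility_le i P j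

theorem mms_nonneg (i : Fin n) : 0 ≤ I.mms i n := by
  obtain ⟨P⟩ := I.nonempty_allocation (Fin.pos i) i
  exact I.le_mms i P fun j => I.utility_nonneg i P j

/-- After the removal of some goods, `r` bundles of a maximin partition are untouched, as every good
belongs to one bundle only. -/
theorem card_mul_mms_le (i : Fin n) (pool : Finset (Fin m)) (r : ℕ) (hr : r + poolᶜ.card ≤ n) :
    r * I.mms i n ≤ ∑ g ∈ pool, I.good i g + I.wholeCake i := by
  rcases Nat.eq_zero_or_pos r with rfl | hr0
  · simpa using add_nonneg (Finset.sum_nonneg fun g (_ : g ∈ pool) => I.good_nonneg i g)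
      (I.wholeCake_nonneg i)
  have hr' : (0 : ℝ) < r := Nat.cast_pos.2 hr0
  rw [mul_comm, ← le_div_iff₀ hr']
  refine I.mms_le i fun P μ hμ => ?_
  rw [le_div_iff₀ hr']
  by_cases hμ0 : μ ≤ 0
  · exact (mul_nonpos_of_nonpos_of_nonneg hμ0 hr'.le).trans
      (add_nonneg (Finset.sum_nonneg fun g _ => I.good_nonneg i g) (I.wholeCake_nonneg i))
  push Not at hμ0
  set J : Finset (Fin n) := (poolᶜ.image P.owner)ᶜ with hJ
  have hJc : r ≤ J.card := by
    rw [hJ, Finset.card_compl, Fintype.card_fin]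
    have := Finset.card_image_le (s := poolᶜ) (f := P.owner)
    omega
  have h1 : μ * r ≤ ∑ j ∈ J, I.utility i P j := by
    calc μ * r ≤ μ * J.card := by gcongr
      _ = ∑ _j ∈ J, μ := by rw [Finset.sum_const, nsmul_eq_mul, mul_comm]
      _ ≤ _ := Finset.sum_le_sum fun j _ => hμ j
  refine h1.trans ?_
  simp only [utility, Finset.sum_add_distrib]
  refine add_le_add ?_ ?_
  · rw [← Finset.sum_biUnion]
    · refine Finset.sum_le_sum_of_subset_of_nonneg ?_ fun g _ _ => I.good_nonneg i g
      intro g hg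
      by_contra hgp
      simp only [hJ, Finset.mem_biUnion, Finset.mem_filter, Finset.mem_univ, true_and,
        Finset.mem_compl, Finset.mem_image, not_exists, not_and] at hg
      obtain ⟨j, hj, rfl⟩ := hg
      exact hj g hgp rfl
    · intro a _ b _ hab
      rw [Function.onFun, Finset.disjoint_left]
      intro g hg hg'
      exact hab (by rw [← (Finset.mem_filter.1 hg).2, ← (Finset.mem_filter.1 hg').2])
  · rw [← I.sum_cakeUtility i P]
    refine Finset.sum_le_sum_of_subset_of_nonneg (Finset.subset_univ _) fun j _ _ =>
      I.cakeUtility_nonneg i (IsPiece.subset (P.piece_isPiece j))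
        (IsPiece.measurableSet (P.piece_isPiece j))

theorem mms_le_total (i : Fin n) : I.mms i n ≤ ∑ g, I.good i g + I.wholeCake i :=
  I.mms_le i fun P _ hμ => (hμ i).trans (I.utility_le i P i)

/-- A positive maximin share is not much smaller than the smallest positive input number: it is
enough to divide the cake equally. -/
theorem div_le_mms_of_pos (i : Fin n) {κ : ℝ} (hκ : 0 ≤ κ)
    (hg : ∀ g, I.good i g = 0 ∨ κ ≤ I.good i g) (hc : I.wholeCake i = 0 ∨ κ ≤ I.wholeCake i)
    (hM : 0 < I.mms i n) : κ / n ≤ I.mms i n := by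
  have hn : 0 < n := Fin.pos i
  have hn' : (1 : ℝ) ≤ n := by exact_mod_cast hn
  obtain ⟨P, hP⟩ : ∃ P : Allocation n m, ∀ j, 0 < I.utility i P j := by
    by_contra hcon
    push Not at hcon
    refine absurd (I.mms_le i (θ := 0) fun P μ hμ => ?_) (not_le.2 hM)
    obtain ⟨j, hj⟩ := hcon P
    exact (hμ j).trans hj
  obtain ⟨P', ho, hP'⟩ := I.exists_allocation_of_sum_le i hn P.owner
    (fun _ => I.wholeCake i / n) (fun _ => div_nonneg (I.wholeCake_nonneg i) (by linarith))
    (by rw [Finset.sum_const, Finset.card_univ, Fintype.card_fin, nsmul_eq_mul,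
          mul_div_cancel₀ _ (by positivity)])
  refine I.le_mms i P' fun j => ?_
  have hsum : 0 ≤ ∑ g with P'.owner g = j, I.good i g :=
    Finset.sum_nonneg fun g _ => I.good_nonneg i g
  rcases hc with hc | hc
  · have hcj : I.cakeUtility i (P.piece j) ≤ 0 := hc ▸
      I.cakeUtility_mono i (IsPiece.subset (P.piece_isPiece j)) le_rfl measurableSet_Icc
    have hpos : 0 < ∑ g with P.owner g = j, I.good i g := by
      have := hP j
      rw [utility] at this
      linarith
    obtain ⟨g, hgj, hg0⟩ := Finset.exists_ne_zero_of_sum_ne_zero hpos.ne'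
    have h1 := Finset.single_le_sum (f := I.good i) (fun g _ => I.good_nonneg i g) hgj
    have h2 := hP' j
    simp only [hc, zero_div] at h2
    rw [utility, ho]
    have h3 := (hg g).resolve_left hg0
    have h4 : κ / n ≤ κ := div_le_self hκ hn'
    linarith
  · have h2 := hP' j
    rw [utility]
    have : κ / n ≤ I.wholeCake i / n := by gcongr
    linarith

theorem alpha_le_one : I.alpha ≤ 1 := by
  rw [alpha]
  exact ENNReal.toReal_le_of_le_ofReal zero_le_one (by simp)

theorem alpha_nonneg : 0 ≤ I.alpha := ENNReal.toReal_nonneg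

theorem alpha_le (i : Fin n) (h : 0 < ((n : ℝ) - 1) * I.mms i n) :
    I.alpha ≤ 1 / 2 + I.wholeCake i / (2 * ((n : ℝ) - 1) * I.mms i n) := by
  have h0 : 0 ≤ I.wholeCake i / (2 * ((n : ℝ) - 1) * I.mms i n) :=
    div_nonneg (I.wholeCake_nonneg i) (by linarith)
  rw [alpha]
  refine ENNReal.toReal_le_of_le_ofReal (by linarith) ?_
  rw [ENNReal.ofReal_add (by norm_num) h0]
  refine (min_le_right _ _).trans (add_le_add ?_ ?_)
  · rw [ENNReal.ofReal_div_of_pos two_pos]; simp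
  · refine (iInf_le _ i).trans ?_
    rw [cakeTerm, if_neg (by rw [mul_assoc]; positivity)]

end Instance

end MixedGoods

/-! ### Assigning single goods and filling bags -/

namespace MixedGoods

/-- The state of the assignment while agents are still served with single goods: `act` is the set
of agents not served yet, `pool` the set of goods not given away, `own` the owner of the others. -/
structure Singles {n m : ℕ} (I : Instance n m) (a : Fin n → ℝ) (act : Finset (Fin n))
    (pool : Finset (Fin m)) (own : Fin m → ℕ) : Prop where
  own_lt : ∀ g, own g < n
  card : act.card + poolᶜ.card ≤ n
  served : ∀ i ∉ act, ∃ g ∉ pool, own g = i ∧ a i ≤ I.good i g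

theorem Singles.serve {n m : ℕ} {I : Instance n m} {a : Fin n → ℝ} {act : Finset (Fin n)}
    {pool : Finset (Fin m)} {own : Fin m → ℕ} (h : Singles I a act pool own)
    {i : Fin n} {g : Fin m} (hi : i ∈ act) (hg : g ∈ pool) (hig : a i ≤ I.good i g) :
    Singles I a (act.erase i) (pool.erase g) (Function.update own g i) where
  own_lt g' := by
    by_cases hg' : g' = g
    · subst hg'; simp
    · simpa [hg'] using h.own_lt g'
  card := by
    have h1 := h.card
    have h2 := Finset.card_pos.2 ⟨i, hi⟩
    rw [Finset.card_erase_of_mem hi, Finset.compl_erase, Finset.card_insert_of_notMem (by simpa)]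
    omega
  served j hj := by
    by_cases hji : j = i
    · subst hji
      exact ⟨g, by simp, by simp, hig⟩
    · obtain ⟨g', h1, h2, h3⟩ := h.served j (by simpa [hji] using hj)
      have hg' : g' ≠ g := by rintro rfl; exact h1 hg
      exact ⟨g', by simp [h1], by simpa [hg'] using h2, h3⟩

namespace Instance

variable {n m : ℕ} (I : Instance n m)

/-- Agent `i`'s value for a set of indivisible goods. -/
def goods (i : Fin n) (S : Finset (Fin m)) : ℝ := ∑ g ∈ S, I.good i g

/-- Agent `i`'s value for the cake to the right of `x`. -/
noncomputable def rest (i : Fin n) (x : ℝ) : ℝ := I.prefixCake i 1 - I.prefixCake i x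

/-- The amount of cake that an agent needs in addition to the bag to get `a i`. -/
def need (a : Fin n → ℝ) (bag : Finset (Fin m)) (i : Fin n) : ℝ := max (a i - I.goods i bag) 0

theorem goods_nonneg (i : Fin n) (S : Finset (Fin m)) : 0 ≤ I.goods i S :=
  Finset.sum_nonneg fun g _ => I.good_nonneg i g

theorem goods_sdiff (i : Fin n) {S T : Finset (Fin m)} (h : S ⊆ T) :
    I.goods i (T \ S) = I.goods i T - I.goods i S := by
  rw [goods, goods, goods, ← Finset.sum_sdiff h]; ring

end Instance

/-- The state of the bag filling. Agents in `act` are not served yet; the goods of `pool` are not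
given away, and those of `bag ⊆ pool` are in the bag; the cake has been given away up to `x`,
as recorded in `out`. An active agent `i` still finds `act.card * a i` in the goods and the cake
left (`share`); counting the cake twice, she finds almost twice that much (`reserve`), which pays
for the bags that overshoot. -/
structure BagFilling {n m : ℕ} (I : Instance n m) (a : Fin n → ℝ) (act : Finset (Fin n))
    (pool bag : Finset (Fin m)) (own : Fin m → ℕ) (x : ℝ) (out : List (ℕ × ℝ × ℝ)) : Prop where
  own_lt : ∀ g, own g < n
  tiles : Tiles out x
  le_one : x ≤ 1
  out_lt : ∀ p ∈ out, p.1 < n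
  bag_subset : bag ⊆ pool
  small : ∀ i ∈ act, ∀ g ∈ pool, I.good i g < a i
  share : ∀ i ∈ act, act.card * a i ≤ I.goods i pool + I.rest i x
  reserve : ∀ i ∈ act, (2 * act.card - 1) * a i ≤ I.goods i pool + 2 * I.rest i x
  served : ∀ i ∉ act, a i ≤ I.goods i {g | g ∉ pool ∧ own g = i} +
    I.cakeUtility i (pieceOf out i)
  /-- Without its last good, the bag would satisfy nobody, not even with all the cake. -/
  last : bag = ∅ ∨ ∃ g ∈ bag, ∀ i ∈ act, I.goods i (bag.erase g) + I.rest i x < a i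

/-- No active agent is satisfied by the bag, even with all the cake left. -/
def Stuck {n m : ℕ} (I : Instance n m) (a : Fin n → ℝ) (act : Finset (Fin n))
    (bag : Finset (Fin m)) (x : ℝ) : Prop :=
  ∀ i ∈ act, I.goods i bag + I.rest i x < a i

/-- When no good is large any more, bag filling can begin: there are enough untouched bundles for
`share`, and the condition on the cake gives `reserve`. -/
theorem Singles.bagFilling {n m : ℕ} {I : Instance n m} {a : Fin n → ℝ} {act : Finset (Fin n)}
    {pool : Finset (Fin m)} {own : Fin m → ℕ} (h : Singles I a act pool own)
    (small : ∀ i ∈ act, ∀ g ∈ pool, I.good i g < a i) (ha0 : ∀ i, 0 ≤ a i)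
    (ha : ∀ i, a i ≤ I.mms i n)
    (hc : ∀ i, ((n : ℝ) - 1) * (2 * a i - I.mms i n) ≤ I.wholeCake i) :
    BagFilling I a act pool ∅ own 0 [] where
  own_lt := h.own_lt
  tiles := .nil
  le_one := zero_le_one
  out_lt := by simp
  bag_subset := Finset.empty_subset _
  small := small
  share i _ := by
    have h1 := I.card_mul_mms_le i pool act.card h.card
    have h2 : (act.card : ℝ) * a i ≤ act.card * I.mms i n := by gcongr; exact ha i
    simp only [Instance.goods, Instance.rest, I.prefixCake_zero, I.prefixCake_one, sub_zero]
    linarith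
  reserve i hi := by
    have h1 := I.card_mul_mms_le i pool act.card h.card
    have h3 : (1 : ℝ) ≤ act.card := by exact_mod_cast Finset.card_pos.2 ⟨i, hi⟩
    have h4 : (act.card : ℝ) ≤ n := by exact_mod_cast (Nat.le_add_right _ _).trans h.card
    have h5 := I.wholeCake_nonneg i
    simp only [Instance.goods, Instance.rest, I.prefixCake_zero, I.prefixCake_one, sub_zero]
    rcases le_total (2 * a i) (I.mms i n) with h2 | h2
    · have : (act.card : ℝ) * (2 * a i) ≤ act.card * I.mms i n := by gcongr
      linarith [ha0 i]
    · have : ((act.card : ℝ) - 1) * (2 * a i - I.mms i n) ≤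
          ((n : ℝ) - 1) * (2 * a i - I.mms i n) := by
        gcongr
      linarith [hc i, ha i]
  served i hi := by
    obtain ⟨g, h1, h2, h3⟩ := h.served i hi
    have h4 := Finset.single_le_sum (f := I.good i) (s := {g | g ∉ pool ∧ own g = i})
      (fun g _ => I.good_nonneg i g) (a := g) (by simp [h1, h2])
    have h5 : 0 ≤ I.cakeUtility i (pieceOf [] i) := by simp [pieceOf, Instance.cakeUtility]
    rw [Instance.goods]
    linarith
  last := Or.inl rfl

namespace BagFilling

variable {n m : ℕ} {I : Instance n m} {a : Fin n → ℝ} {act : Finset (Fin n)}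
  {pool bag : Finset (Fin m)} {own : Fin m → ℕ} {x : ℝ} {out : List (ℕ × ℝ × ℝ)}

/-- Serving one agent with the bag and as little cake as possible preserves the invariant. For
another agent the bundle is worth at most `a j`, unless no cake was used; in this case it is worth
less than `2 * a j` minus the cake left, by the choice of the last good. -/
theorem serve (h : BagFilling I a act pool bag own x out) (ha0 : ∀ i, 0 ≤ a i)
    {i : Fin n} {y : ℝ} (hi : i ∈ act) (hxy : x ≤ y) (hy : y ≤ 1)
    (hiy : a i ≤ I.goods i bag + (I.prefixCake i y - I.prefixCake i x))
    (hj : ∀ j ∈ act, I.prefixCake j y - I.prefixCake j x ≤ max (a j - I.goods j bag) 0)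
    {own' : Fin m → ℕ} (hown : ∀ g, own' g = if g ∈ bag then (i : ℕ) else own g) :
    BagFilling I a (act.erase i) (pool \ bag) ∅ own' y (out ++ [((i : ℕ), x, y)]) := by
  -- the effect on the two inequalities for another active agent `j`
  have key : ∀ j ∈ act.erase i,
      ((act.erase i).card : ℝ) * a j ≤ I.goods j (pool \ bag) + I.rest j y ∧
      (2 * ((act.erase i).card : ℝ) - 1) * a j ≤ I.goods j (pool \ bag) + 2 * I.rest j y := by
    intro j hj'
    have hja := Finset.mem_of_mem_erase hj'
    have hr : ((act.erase i).card : ℝ) = act.card - 1 := by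
      rw [Finset.card_erase_of_mem hi, Nat.cast_sub (Finset.card_pos.2 ⟨i, hi⟩), Nat.cast_one]
    have hr2 : (1 : ℝ) ≤ act.card - 1 := by
      rw [← hr]; exact_mod_cast Finset.card_pos.2 ⟨j, hj'⟩
    have h1 := h.share j hja
    have h2 := h.reserve j hja
    have h3 := hj j hja
    have h4 := I.goods_nonneg j bag
    have h5 := I.prefixCake_mono j hxy hy
    have h6 := I.prefixCake_mono j hy le_rfl
    rw [hr, I.goods_sdiff j h.bag_subset]
    simp only [Instance.rest] at h1 h2 ⊢
    rcases le_or_gt (I.goods j bag) (a j) with h7 | h7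
    · -- the bag alone does not exceed `a j`, hence neither does the bundle
      rw [max_eq_left (by linarith)] at h3
      constructor <;> linarith
    · -- the bag exceeds `a j`, hence no cake was used
      rw [max_eq_right (by linarith)] at h3
      rcases h.last with hb | ⟨g, hg, hlast⟩
      · have := ha0 j
        simp [hb, Instance.goods] at h7
        linarith
      · have h8 := hlast j hja
        have h9 := h.small j hja g (h.bag_subset hg)
        have h10 : I.goods j bag = I.good j g + I.goods j (bag.erase g) :=
          (Finset.add_sum_erase _ _ hg).symm
        have h11 : a j ≤ ((act.card : ℝ) - 1) * a j := le_mul_of_one_le_left (ha0 j) hr2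
        simp only [Instance.rest] at h8
        constructor <;> linarith
  have ht := h.tiles.snoc i hxy
  exact {
    own_lt := fun g => by
      rw [hown]
      split_ifs
      exacts [i.2, h.own_lt g]
    tiles := ht
    le_one := hy
    out_lt := fun p hp => by
      rcases List.mem_append.1 hp with hp | hp
      · exact h.out_lt p hp
      · obtain rfl := List.mem_singleton.1 hp
        exact i.2
    bag_subset := Finset.empty_subset _
    small := fun j hj' g hg =>
      h.small j (Finset.mem_of_mem_erase hj') g (Finset.sdiff_subset hg)
    share := fun j hj' => (key j hj').1
    reserve := fun j hj' => (key j hj').2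
    served := fun j hj' => by
      have hp := ht.isPiece hy j
      by_cases hji : j = i
      · subst hji
        have h1 : I.goods j bag ≤ I.goods j {g | g ∉ pool \ bag ∧ own' g = j} := by
          refine Finset.sum_le_sum_of_subset_of_nonneg (fun g hg => ?_)
            fun g _ _ => I.good_nonneg j g
          simp [hown, hg]
        have h2 : I.cakeUtility j (Set.Icc x y) ≤
            I.cakeUtility j (pieceOf (out ++ [((j : ℕ), x, y)]) j) := by
          refine I.cakeUtility_mono j ?_ (Instance.IsPiece.subset hp)
            (Instance.IsPiece.measurableSet hp)
          rw [pieceOf_snoc_same]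
          exact Set.subset_union_right
        rw [I.cakeUtility_Icc j h.tiles.nonneg hxy hy] at h2
        linarith
      · have h0 := h.served j (by simpa [hji] using hj')
        have h1 : I.goods j {g | g ∉ pool ∧ own g = j} ≤
            I.goods j {g | g ∉ pool \ bag ∧ own' g = j} := by
          refine Finset.sum_le_sum_of_subset_of_nonneg (fun g hg => ?_)
            fun g _ _ => I.good_nonneg j g
          simp only [Finset.mem_filter, Finset.mem_univ, true_and, Finset.mem_sdiff] at hg ⊢
          have hgb : g ∉ bag := fun hgb => hg.1 (h.bag_subset hgb)
          exact ⟨fun h' => hg.1 h'.1, by rw [hown, if_neg hgb, hg.2]⟩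
        have h2 := I.cakeUtility_mono j (pieceOf_subset_snoc out i j x y)
          (Instance.IsPiece.subset hp) (Instance.IsPiece.measurableSet hp)
        linarith
    last := Or.inl rfl }

theorem add (h : BagFilling I a act pool bag own x out) (hs : Stuck I a act bag x)
    {g : Fin m} (hg : g ∈ pool) (hgb : g ∉ bag) :
    BagFilling I a act pool (insert g bag) own x out :=
  { h with
    bag_subset := Finset.insert_subset hg h.bag_subset
    last := Or.inr ⟨g, Finset.mem_insert_self _ _, by rwa [Finset.erase_insert hgb]⟩ }

/-- When all goods are in the bag and it satisfies nobody, then everybody has been served: an active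
agent would find at least `a i` in the bag and the cake, by `share`. -/
theorem act_eq_empty (h : BagFilling I a act pool bag own x out) (hs : Stuck I a act bag x)
    (ha0 : ∀ i, 0 ≤ a i) (hb : pool ⊆ bag) : act = ∅ := by
  obtain rfl := h.bag_subset.antisymm hb
  refine Finset.eq_empty_of_forall_notMem fun i hi => ?_
  have h1 := h.share i hi
  have h2 := hs i hi
  have h3 : a i ≤ (act.card : ℝ) * a i :=
    le_mul_of_one_le_left (ha0 i) (by exact_mod_cast Finset.card_pos.2 ⟨i, hi⟩)
  linarith

/-- The answer `2` to all cut queries means that the bag is stuck. -/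
theorem stuck_of_cut (h : BagFilling I a act pool bag own x out)
    (hcut : ∀ i ∈ act, 1 < I.cutQuery i x (I.need a bag i)) : Stuck I a act bag x := by
  intro i hi
  by_contra hcon
  push Not at hcon
  have h0 := I.prefixCake_mono i h.le_one le_rfl
  have hneed : I.need a bag i ≤ I.rest i x :=
    max_le (by linarith) (by rw [Instance.rest]; linarith)
  have := (I.cutQuery_spec i h.tiles.nonneg h.le_one (le_max_right _ _) hneed).2.1
  exact absurd (hcut i hi) (not_lt.2 this)

/-- The case of `serve` in which the agent and the end `y` of the interval come from cut queries: the
active agent with the leftmost answer is served. -/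
theorem serve_cut (h : BagFilling I a act pool bag own x out) (ha0 : ∀ i, 0 ≤ a i)
    {i : Fin n} (hi : i ∈ act) (hi1 : I.cutQuery i x (I.need a bag i) ≤ 1)
    (hmin : ∀ j ∈ act, I.cutQuery i x (I.need a bag i) ≤ I.cutQuery j x (I.need a bag j))
    {own' : Fin m → ℕ} (hown : ∀ g, own' g = if g ∈ bag then (i : ℕ) else own g) :
    BagFilling I a (act.erase i) (pool \ bag) ∅ own' (I.cutQuery i x (I.need a bag i))
      (out ++ [((i : ℕ), x, I.cutQuery i x (I.need a bag i))]) := by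
  have hspec : ∀ j : Fin n, I.cutQuery j x (I.need a bag j) ≤ 1 →
      x ≤ I.cutQuery j x (I.need a bag j) ∧
      I.prefixCake j (I.cutQuery j x (I.need a bag j)) - I.prefixCake j x = I.need a bag j := by
    intro j hj1
    have hle : I.need a bag j ≤ I.rest j x := by
      by_contra hcon
      rw [I.cutQuery_eq_two j h.tiles.nonneg (not_le.1 hcon)] at hj1
      norm_num at hj1
    obtain ⟨h1, -, h3, -⟩ := I.cutQuery_spec j h.tiles.nonneg h.le_one (le_max_right _ _) hle
    exact ⟨h1, h3⟩
  obtain ⟨h1, h2⟩ := hspec i hi1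
  refine h.serve ha0 hi h1 hi1 ?_ (fun j hj => ?_) hown
  · rw [h2]
    linarith [le_max_left (a i - I.goods i bag) 0, show I.need a bag i = max _ _ from rfl]
  · rcases le_or_gt (I.cutQuery j x (I.need a bag j)) 1 with hj1 | hj1
    · have h3 := I.prefixCake_mono j (hmin j hj) hj1
      have h4 := (hspec j hj1).2
      change _ ≤ I.need a bag j
      linarith
    · have hlt : I.rest j x < I.need a bag j := by
        by_contra hcon
        have := (I.cutQuery_spec j h.tiles.nonneg h.le_one (le_max_right _ _)
          (not_lt.1 hcon)).2.1
        exact absurd hj1 (not_lt.2 this)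
      have h3 := I.prefixCake_mono j hi1 le_rfl
      rw [Instance.rest] at hlt
      change _ ≤ I.need a bag j
      linarith

/-- The final allocation: the remaining cake goes to agent `0`, and so do the remaining goods if
`own` says so. -/
theorem exists_allocation (h : BagFilling I a ∅ pool bag own x out) (hn : 0 < n) :
    ∃ A : Allocation n m, (∀ g, own g = A.owner g) ∧
      (∀ i : Fin n, A.piece i = pieceOf (out ++ [(0, x, 1)]) i) ∧
      ∀ i, a i ≤ I.utility i A i := by
  have ht := h.tiles.snoc 0 h.le_one
  refine ⟨ht.allocation (k := n) (fun p hp => ?_) (fun g => ⟨own g, h.own_lt g⟩), fun g => rfl,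
    fun i => rfl, fun i => ?_⟩
  · rcases List.mem_append.1 hp with hp | hp
    · exact h.out_lt p hp
    · obtain rfl := List.mem_singleton.1 hp
      exact hn
  · have hp := ht.isPiece le_rfl i
    have h1 := h.served i (Finset.notMem_empty i)
    have h2 := I.cakeUtility_mono i (pieceOf_subset_snoc out 0 i x 1)
          (Instance.IsPiece.subset hp) (Instance.IsPiece.measurableSet hp)
    refine h1.trans (add_le_add ?_ h2)
    refine Finset.sum_le_sum_of_subset_of_nonneg (fun g hg => ?_) fun g _ _ => I.good_nonneg i g
    simp only [Finset.mem_filter, Finset.mem_univ, true_and] at hg ⊢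
    exact Fin.ext hg.2

/-- Every step of the bag filling serves an agent or adds a good to the bag. -/
theorem exists_served (h : BagFilling I a act pool bag own x out) (ha0 : ∀ i, 0 ≤ a i) :
    ∃ pool bag own x out, BagFilling I a ∅ pool bag own x out := by
  induction hN : act.card + (pool \ bag).card using Nat.strong_induction_on
    generalizing act pool bag own x out with
  | _ N ih =>
  by_cases hcut : ∃ i ∈ act, I.cutQuery i x (I.need a bag i) ≤ 1
  · obtain ⟨i₀, hi₀, hi₀1⟩ := hcut
    obtain ⟨i, hi, hmin⟩ := act.exists_min_image (fun i => I.cutQuery i x (I.need a bag i))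
      ⟨i₀, hi₀⟩
    refine ih _ ?_ (h.serve_cut ha0 hi ((hmin i₀ hi₀).trans hi₀1) hmin fun g => rfl) rfl
    rw [← hN, Finset.sdiff_empty]
    exact Nat.add_lt_add_right (Finset.card_erase_lt_of_mem hi) _
  · push Not at hcut
    have hs := h.stuck_of_cut hcut
    by_cases hb : pool ⊆ bag
    · obtain rfl := h.act_eq_empty hs ha0 hb
      exact ⟨_, _, _, _, _, h⟩
    · obtain ⟨g, hg, hgb⟩ := Finset.not_subset.1 hb
      refine ih _ ?_ (h.add hs hg hgb) rfl
      rw [← hN, Finset.sdiff_insert]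
      exact Nat.add_lt_add_left
        (Finset.card_erase_lt_of_mem (Finset.mem_sdiff.2 ⟨hg, hgb⟩)) _

end BagFilling

theorem Singles.exists_small {n m : ℕ} {I : Instance n m} {a : Fin n → ℝ} {act : Finset (Fin n)}
    {pool : Finset (Fin m)} {own : Fin m → ℕ} (h : Singles I a act pool own) :
    ∃ act pool own, Singles I a act pool own ∧ ∀ i ∈ act, ∀ g ∈ pool, I.good i g < a i := by
  induction hN : act.card using Nat.strong_induction_on generalizing act pool own with
  | _ N ih =>
  by_cases hbig : ∃ i ∈ act, ∃ g ∈ pool, a i ≤ I.good i g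
  · obtain ⟨i, hi, g, hg, hig⟩ := hbig
    exact ih _ (hN ▸ Finset.card_erase_lt_of_mem hi) (h.serve hi hg hig) rfl
  · push Not at hbig
    exact ⟨_, _, _, h, hbig⟩

theorem Instance.singles_start {n m : ℕ} (I : Instance n m) (a : Fin n → ℝ) (hn : 0 < n) :
    Singles I a Finset.univ Finset.univ fun _ => 0 where
  own_lt _ := hn
  card := by simp
  served i hi := absurd (Finset.mem_univ i) hi

/-- Targets `a i` with `a i ≤ MMS_i` and `(n - 1) (2 a i - MMS_i) ≤ u_i(C)` can be met. -/
theorem Instance.exists_allocation_of_targets {n m : ℕ} (I : Instance n m) (hn : 0 < n)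
    (a : Fin n → ℝ) (ha0 : ∀ i, 0 ≤ a i) (ha : ∀ i, a i ≤ I.mms i n)
    (hc : ∀ i, ((n : ℝ) - 1) * (2 * a i - I.mms i n) ≤ I.wholeCake i) :
    ∃ A : Allocation n m, ∀ i, a i ≤ I.utility i A i := by
  obtain ⟨act, pool, own, h, hsmall⟩ := (I.singles_start a hn).exists_small
  obtain ⟨_, _, _, _, _, h'⟩ := (h.bagFilling hsmall ha0 ha hc).exists_served ha0
  obtain ⟨A, -, -, hA⟩ := h'.exists_allocation hn
  exact ⟨A, hA⟩

/-- The targets `α * MMS_i` can be met. -/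
theorem Instance.alpha_target {n m : ℕ} (I : Instance n m) (i : Fin n) :
    ((n : ℝ) - 1) * (2 * (I.alpha * I.mms i n) - I.mms i n) ≤ I.wholeCake i := by
  have hM := I.mms_nonneg i
  have hn : (1 : ℝ) ≤ n := by exact_mod_cast Fin.pos i
  rcases eq_or_lt_of_le (mul_nonneg (sub_nonneg.2 hn) hM) with h | h
  · have : ((n : ℝ) - 1) * (2 * (I.alpha * I.mms i n) - I.mms i n) =
        (2 * I.alpha - 1) * (((n : ℝ) - 1) * I.mms i n) := by ring
    rw [this, ← h, mul_zero]
    exact I.wholeCake_nonneg i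
  · have h1 := I.alpha_le i h
    have h2 : I.wholeCake i / (2 * ((n : ℝ) - 1) * I.mms i n) *
        (2 * (((n : ℝ) - 1) * I.mms i n)) = I.wholeCake i := by
      rw [mul_assoc 2]
      exact div_mul_cancel₀ _ (by positivity)
    nlinarith

theorem Instance.exists_isApproxMMS_alpha {n m : ℕ} (I : Instance n m) (hn : 0 < n) :
    ∃ A : Allocation n m, I.IsApproxMMS I.alpha A :=
  I.exists_allocation_of_targets hn _ (fun i => mul_nonneg I.alpha_nonneg (I.mms_nonneg i))
    (fun i => mul_le_of_le_one_left (I.mms_nonneg i) I.alpha_le_one) I.alpha_target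

end MixedGoods

/-! ### Approximating a maximin share -/

namespace MixedGoods

/-- Filling bundles greedily: demands that are covered by divisible value `c` and items of size at
most `δ` are met up to `δ`. -/
theorem exists_greedy_filling {ι κ : Type*} [Fintype κ] [DecidableEq κ] [Nonempty κ] (v : ι → ℝ)
    {δ : ℝ} (hδ : 0 ≤ δ) (hv : ∀ g, 0 ≤ v g) (S : Finset ι) (hS : ∀ g ∈ S, v g ≤ δ)
    {c : ℝ} (hc : 0 ≤ c) (d : κ → ℝ) (hd : ∑ j, max (d j) 0 ≤ c + ∑ g ∈ S, v g) :
    ∃ (f : ι → κ) (e : κ → ℝ), (∀ j, 0 ≤ e j) ∧ ∑ j, e j ≤ c ∧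
      ∀ j, d j - δ ≤ (∑ g ∈ S, if f g = j then v g else 0) + e j := by
  classical
  induction S using Finset.induction_on generalizing d with
  | empty =>
    refine ⟨fun _ => Classical.arbitrary κ, fun j => max (d j) 0, fun j => le_max_right _ _,
      by simpa using hd, fun j => ?_⟩
    have := le_max_left (d j) 0
    simp only [Finset.sum_empty]
    linarith
  | insert g S hg ih =>
    by_cases h : ∃ j, v g ≤ d j
    · obtain ⟨j₀, hj₀⟩ := h
      have hsum : ∑ j, max (Function.update d j₀ (d j₀ - v g) j) 0 + v g = ∑ j, max (d j) 0 := by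
        rw [← Finset.add_sum_erase _ _ (Finset.mem_univ j₀),
          ← Finset.add_sum_erase _ (fun j => max (d j) 0) (Finset.mem_univ j₀)]
        have : ∑ j ∈ Finset.univ.erase j₀, max (Function.update d j₀ (d j₀ - v g) j) 0 =
            ∑ j ∈ Finset.univ.erase j₀, max (d j) 0 :=
          Finset.sum_congr rfl fun j hj => by
            rw [Function.update_of_ne (Finset.ne_of_mem_erase hj)]
        rw [this, Function.update_self, max_eq_left (by linarith),
          max_eq_left (by linarith [hv g])]
        ring
      rw [Finset.sum_insert hg] at hd
      obtain ⟨f, e, h1, h2, h3⟩ := ih (fun g' hg' => hS g' (Finset.mem_insert_of_mem hg'))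
        (Function.update d j₀ (d j₀ - v g)) (by linarith)
      refine ⟨Function.update f g j₀, e, h1, h2, fun j => ?_⟩
      rw [Finset.sum_insert hg, Function.update_self]
      have : ∑ g' ∈ S, (if Function.update f g j₀ g' = j then v g' else 0) =
          ∑ g' ∈ S, if f g' = j then v g' else 0 :=
        Finset.sum_congr rfl fun g' hg' => by
          rw [Function.update_of_ne (by rintro rfl; exact hg hg')]
      rw [this]
      have h4 := h3 j
      by_cases hj : j = j₀
      · subst hj
        rw [Function.update_self] at h4
        rw [if_pos rfl]
        linarith
      · rw [Function.update_of_ne hj] at h4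
        rw [if_neg (Ne.symm hj)]
        linarith
    · push Not at h
      refine ⟨fun _ => Classical.arbitrary κ, fun _ => 0, fun _ => le_rfl, by simpa using hc,
        fun j => ?_⟩
      have h1 := h j
      have h2 := hS g (Finset.mem_insert_self _ _)
      have h3 : 0 ≤ ∑ g' ∈ insert g S, if Classical.arbitrary κ = j then v g' else 0 :=
        Finset.sum_nonneg fun g' _ => by split_ifs; exacts [hv g', le_rfl]
      linarith

/-- The load vectors, truncated at `Q`, that can be reached by distributing some of the first `k`
items among `n` bundles. Item `g` has size `e g`; items of size less than `r` are left aside. -/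
def Reach (n Q r : ℕ) (e : ℕ → ℕ) : ℕ → Set (Fin n → ℕ)
  | 0 => {fun _ => 0}
  | k + 1 => {ℓ' | ℓ' ∈ Reach n Q r e k ∨ r ≤ e k ∧ ∃ ℓ ∈ Reach n Q r e k, ∃ j,
      ℓ' = Function.update ℓ j (min Q (ℓ j + e k))}

/-- The load of bundle `j` if the large ones among the first `k` items are distributed by `f`. -/
def load {n : ℕ} (r : ℕ) (e : ℕ → ℕ) (f : ℕ → Fin n) (k : ℕ) (j : Fin n) : ℕ :=
  ∑ g ∈ Finset.range k, if r ≤ e g ∧ f g = j then e g else 0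

/-- A reachable vector is a lower bound for actual loads; truncation only makes it smaller. -/
theorem exists_load_of_mem_reach {n Q r : ℕ} [NeZero n] {e : ℕ → ℕ} {k : ℕ} {ℓ : Fin n → ℕ}
    (h : ℓ ∈ Reach n Q r e k) : ∃ f : ℕ → Fin n, ∀ j, ℓ j ≤ load r e f k j := by
  induction k generalizing ℓ with
  | zero =>
    obtain rfl := h
    exact ⟨fun _ => 0, fun j => Nat.zero_le _⟩
  | succ k ih =>
    rcases h with h | ⟨hr, ℓ, h, j₀, rfl⟩
    · obtain ⟨f, hf⟩ := ih h
      refine ⟨f, fun j => (hf j).trans ?_⟩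
      rw [load, load, Finset.sum_range_succ]
      exact Nat.le_add_right _ _
    · obtain ⟨f, hf⟩ := ih h
      refine ⟨Function.update f k j₀, fun j => ?_⟩
      have h1 : load r e (Function.update f k j₀) (k + 1) j =
          load r e f k j + if j₀ = j then e k else 0 := by
        rw [load, load, Finset.sum_range_succ, Function.update_self]
        simp only [hr, true_and]
        congr 1
        refine Finset.sum_congr rfl fun g hg => ?_
        rw [Function.update_of_ne (Finset.mem_range.1 hg).ne]
      rw [h1]
      by_cases hj : j = j₀
      · subst hj
        rw [Function.update_self, if_pos rfl]
        exact (min_le_right _ _).trans (Nat.add_le_add_right (hf j) _)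
      · rw [Function.update_of_ne hj]
        exact (hf j).trans (Nat.le_add_right _ _)

theorem load_mem_reach {n Q r : ℕ} {e : ℕ → ℕ} (f : ℕ → Fin n) (k : ℕ) :
    (fun j => min Q (load r e f k j)) ∈ Reach n Q r e k := by
  induction k with
  | zero => simp [load, Reach]
  | succ k ih =>
    by_cases hr : r ≤ e k
    · refine Or.inr ⟨hr, _, ih, f k, funext fun j => ?_⟩
      rw [load, Finset.sum_range_succ, ← load]
      by_cases hj : j = f k
      · subst hj
        rw [Function.update_self, if_pos ⟨hr, rfl⟩]
        omega
      · rw [Function.update_of_ne hj, if_neg (fun h => hj h.2.symm), add_zero]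
    · refine Or.inl ?_
      convert ih using 3 with j
      rw [load, Finset.sum_range_succ, ← load, if_neg (fun h => hr h.1), add_zero]

theorem reach_le {n Q r : ℕ} {e : ℕ → ℕ} {k : ℕ} {ℓ : Fin n → ℕ} (h : ℓ ∈ Reach n Q r e k)
    (j : Fin n) : ℓ j ≤ Q := by
  induction k generalizing ℓ with
  | zero => obtain rfl := h; exact Nat.zero_le _
  | succ k ih =>
    rcases h with h | ⟨hr, ℓ, h, j₀, rfl⟩
    · exact ih h
    · by_cases hj : j = j₀
      · subst hj; simp
      · rw [Function.update_of_ne hj]; exact ih h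

/-- What the bundles lack to be filled up to `Q`. -/
def deficit {n : ℕ} (Q : ℕ) (ℓ : Fin n → ℕ) : ℕ := ∑ j, (Q - ℓ j)

/-- The value of the cake and of the small ones among the first `k` goods. -/
def fluid (r w C : ℕ) (U : ℕ → ℕ) (k : ℕ) : ℕ :=
  C + ∑ g ∈ Finset.range k, if r ≤ U g / w then 0 else U g

/-- The test of the approximation scheme, for utilities `U` of `m` goods and `C` of the cake: the
goods of value at least `r * w`, with values rounded down to multiples of `w`, can be distributed
among `n` bundles so that the other goods and the cake are worth enough to fill all of them up to
`Q * w`. -/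
def Accepts (n m Q r w C : ℕ) (U : ℕ → ℕ) : Prop :=
  ∃ ℓ ∈ Reach n Q r (fun g => U g / w) m, deficit Q ℓ * w ≤ fluid r w C U m

section Approximation

variable {n m : ℕ} {I : Instance n m} {i : Fin n} {κ : ℝ} {U : ℕ → ℕ} {C r w : ℕ}

/-- If the test succeeds, the bundles can be filled up to `Q * w`, except that greedy filling with
small goods loses at most `r * w` in each. -/
theorem Instance.sub_mul_le_mms {Q : ℕ} (hκ : 0 < κ)
    (hU : ∀ g : Fin m, (U g : ℝ) = κ * I.good i g)
    (hC : (C : ℝ) = κ * I.wholeCake i) (hw : 0 < w) (h : Accepts n m Q r w C U) :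
    ((Q : ℝ) - r) * w ≤ κ * I.mms i n := by
  have : NeZero n := ⟨(Fin.pos i).ne'⟩
  obtain ⟨ℓ, hℓ, hdef⟩ := h
  obtain ⟨f, hf⟩ := exists_load_of_mem_reach hℓ
  have hw' : (0 : ℝ) < w := Nat.cast_pos.2 hw
  obtain ⟨f', e, he, hesum, hfill⟩ := exists_greedy_filling (κ := Fin n)
    (fun g : Fin m => (U g : ℝ)) (δ := r * w) (by positivity) (fun g => Nat.cast_nonneg _)
    {g | ¬ r ≤ U g / w} (fun g hg => by
      simp only [Finset.mem_filter, Finset.mem_univ, true_and, not_le] at hg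
      exact_mod_cast ((Nat.div_lt_iff_lt_mul hw).1 hg).le)
    (c := C) (Nat.cast_nonneg _) (fun j => ((Q - ℓ j : ℕ) : ℝ) * w) (by
      have h1 : ∀ j, max (((Q - ℓ j : ℕ) : ℝ) * w) 0 = ((Q - ℓ j : ℕ) : ℝ) * w := fun j =>
        max_eq_left (by positivity)
      simp only [h1]
      rw [← Finset.sum_mul, Finset.sum_filter]
      have h2 : (((deficit Q ℓ * w : ℕ)) : ℝ) ≤ (fluid r w C U m : ℕ) := Nat.cast_le.2 hdef
      rw [fluid, Finset.sum_range, deficit] at h2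
      push_cast at h2
      refine h2.trans_eq ?_
      congr 1
      refine Finset.sum_congr rfl fun g _ => ?_
      by_cases hg : r ≤ U g / w <;> simp [hg])
  obtain ⟨P, hPo, hPc⟩ := I.exists_allocation_of_sum_le i (Fin.pos i)
    (fun g : Fin m => if r ≤ U g / w then f g else f' g) (fun j => e j / κ)
    (fun j => div_nonneg (he j) hκ.le) (by
      rw [← Finset.sum_div, div_le_iff₀ hκ, mul_comm, ← hC]; exact hesum)
  rw [mul_comm κ, ← div_le_iff₀ hκ]
  refine I.le_mms i P fun j => ?_
  rw [div_le_iff₀ hκ, Instance.utility, add_mul]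
  have h1 : e j ≤ I.cakeUtility i (P.piece j) * κ := (div_le_iff₀ hκ).1 (hPc j)
  have h2 : (∑ g with P.owner g = j, I.good i g) * κ =
      (∑ g : Fin m, if r ≤ U g / w ∧ f g = j then (U g : ℝ) else 0) +
      ∑ g ∈ ({g | ¬ r ≤ U g / w} : Finset (Fin m)), if f' g = j then (U g : ℝ) else 0 := by
    rw [Finset.sum_mul, Finset.sum_filter, Finset.sum_filter, ← Finset.sum_add_distrib, hPo]
    refine Finset.sum_congr rfl fun g _ => ?_
    by_cases hg : r ≤ U g / w <;> simp [hg, hU, mul_comm]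
  have h3 : (ℓ j : ℝ) * w ≤ ∑ g : Fin m, if r ≤ U g / w ∧ f g = j then (U g : ℝ) else 0 := by
    have h4 : (ℓ j : ℝ) ≤ (load r (fun g => U g / w) f m j : ℕ) := Nat.cast_le.2 (hf j)
    refine (mul_le_mul_of_nonneg_right h4 hw'.le).trans ?_
    rw [load, Finset.sum_range]
    push_cast
    rw [Finset.sum_mul]
    refine Finset.sum_le_sum fun g _ => ?_
    split_ifs
    · exact_mod_cast Nat.div_mul_le_self _ _
    · simp
  have h5 := hfill j
  have h6 : (Q : ℝ) ≤ ((Q - ℓ j : ℕ) : ℝ) + ℓ j := by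
    exact_mod_cast (show Q ≤ Q - ℓ j + ℓ j by omega)
  have h7 : ((Q : ℝ) - ℓ j) * w ≤ ((Q - ℓ j : ℕ) : ℝ) * w := by gcongr; linarith
  linarith

/-- If all bundles of a partition were worth more than `(r * r + r) * w`, the test would succeed:
rounding preserves the fraction `r / (r + 1)` of the value of a large good, and
`r * r + r = (r + 1) * r`. -/
theorem Instance.mms_le_add_mul (hκ : 0 < κ) (hU : ∀ g : Fin m, (U g : ℝ) = κ * I.good i g)
    (hC : (C : ℝ) = κ * I.wholeCake i) (hw : 0 < w) (hr : 0 < r)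
    (h : ¬ Accepts n m (r * r) r w C U) : κ * I.mms i n ≤ ((r * r : ℕ) + (r : ℝ)) * w := by
  have : NeZero n := ⟨(Fin.pos i).ne'⟩
  have hw' : (0 : ℝ) < w := Nat.cast_pos.2 hw
  have hr' : (0 : ℝ) < r := Nat.cast_pos.2 hr
  rw [mul_comm κ, ← le_div_iff₀ hκ]
  refine I.mms_le i fun P μ hμ => ?_
  rw [le_div_iff₀ hκ]
  by_contra! hcon
  set f : ℕ → Fin n := fun g => if hg : g < m then P.owner ⟨g, hg⟩ else 0 with hfdef
  have hf : ∀ g : Fin m, f g = P.owner g := fun g => by simp [hfdef]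
  refine h ⟨_, load_mem_reach f m, ?_⟩
  set e : ℕ → ℕ := fun g => U g / w with he
  -- what bundle `j` lacks is at most what `P` gives to it in small goods and cake
  have key : ∀ j, ((r * r - min (r * r) (load r e f m j) : ℕ) : ℝ) * w ≤
      (∑ g : Fin m, if ¬ r ≤ U g / w ∧ f g = j then (U g : ℝ) else 0) +
        κ * I.cakeUtility i (P.piece j) := by
    intro j
    have hsmall : 0 ≤ ∑ g : Fin m, if ¬ r ≤ U g / w ∧ f g = j then (U g : ℝ) else 0 :=
      Finset.sum_nonneg fun g _ => by split_ifs; exacts [Nat.cast_nonneg _, le_rfl]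
    have hcake : 0 ≤ κ * I.cakeUtility i (P.piece j) := mul_nonneg hκ.le
      (I.cakeUtility_nonneg i (Instance.IsPiece.subset (P.piece_isPiece j))
        (Instance.IsPiece.measurableSet (P.piece_isPiece j)))
    rcases le_total (r * r) (load r e f m j) with hl | hl
    · rw [min_eq_left hl, Nat.sub_self]
      simp only [Nat.cast_zero, zero_mul]
      linarith
    · rw [min_eq_right hl, Nat.cast_sub hl]
      have hl' : (load r e f m j : ℝ) ≤ (r * r : ℕ) := Nat.cast_le.2 hl
      have h1 : (r : ℝ) * ∑ g : Fin m, (if r ≤ U g / w ∧ f g = j then (U g : ℝ) else 0) ≤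
          (r + 1) * (load r e f m j : ℝ) * w := by
        rw [load, Finset.sum_range]
        push_cast
        rw [Finset.mul_sum, Finset.mul_sum, Finset.sum_mul]
        refine Finset.sum_le_sum fun g _ => ?_
        rw [he]
        split_ifs with hg
        · have h2 : U g < w * (U g / w + 1) := Nat.lt_mul_div_succ _ hw
          have h3 := hg.1
          have h4 : r * U g ≤ (r + 1) * (U g / w) * w := by nlinarith
          exact_mod_cast h4
        · simp
      have h5 := (mul_le_mul_of_nonneg_right (hμ j) hκ.le)
      rw [Instance.utility, add_mul] at h5
      have h6 : (∑ g with P.owner g = j, I.good i g) * κ =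
          (∑ g : Fin m, if r ≤ U g / w ∧ f g = j then (U g : ℝ) else 0) +
          ∑ g : Fin m, if ¬ r ≤ U g / w ∧ f g = j then (U g : ℝ) else 0 := by
        rw [Finset.sum_mul, Finset.sum_filter, ← Finset.sum_add_distrib]
        refine Finset.sum_congr rfl fun g _ => ?_
        rw [hf]
        by_cases hg : r ≤ U g / w <;> simp [hg, hU, mul_comm]
      have h7 : (r : ℝ) * (((r * r : ℕ) : ℝ) - load r e f m j) * w ≤
          r * ((∑ g : Fin m, if ¬ r ≤ U g / w ∧ f g = j then (U g : ℝ) else 0) +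
            κ * I.cakeUtility i (P.piece j)) := by
        have h8 := mul_le_mul_of_nonneg_left (hcon.le.trans h5) hr'.le
        rw [h6] at h8
        have h9 : (load r e f m j : ℝ) * w ≤ ((r * r : ℕ) : ℝ) * w := by gcongr
        push_cast at h8 h9 ⊢
        linarith
      rw [mul_assoc] at h7
      exact le_of_mul_le_mul_left h7 hr'
  have hsum := Finset.sum_le_sum fun j (_ : j ∈ Finset.univ) => key j
  rw [Finset.sum_add_distrib, ← Finset.mul_sum, I.sum_cakeUtility, ← hC, ← Finset.sum_mul,
    Finset.sum_comm] at hsum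
  have hs : ∀ g : Fin m, ∑ j, (if ¬ r ≤ U g / w ∧ f g = j then (U g : ℝ) else 0) =
      if r ≤ U g / w then 0 else (U g : ℝ) := by
    intro g
    by_cases hg : r ≤ U g / w <;> simp [hg]
  simp only [hs] at hsum
  rw [← Nat.cast_le (α := ℝ), fluid, Finset.sum_range, deficit]
  push_cast at hsum ⊢
  linarith

end Approximation

/-! ### Encoding load vectors by numbers -/

section Code

variable {n : ℕ}

/-- The code of a load vector, in base `n + 1`: digit `l` is the number of bundles with load `l`. -/
def code (ℓ : Fin n → ℕ) : ℕ := ∑ j, (n + 1) ^ ℓ j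

theorem code_digit (ℓ : Fin n → ℕ) (l : ℕ) :
    code ℓ / (n + 1) ^ l % (n + 1) = Finset.card {j | ℓ j = l} := by
  have hlow : ∑ j with ℓ j < l, (n + 1) ^ ℓ j < (n + 1) ^ l := by
    rcases l with _ | l
    · simp
    · calc ∑ j with ℓ j < l + 1, (n + 1) ^ ℓ j
          ≤ ∑ j with ℓ j < l + 1, (n + 1) ^ l := Finset.sum_le_sum fun j hj =>
            Nat.pow_le_pow_right (Nat.succ_pos _)
              (Nat.lt_succ_iff.1 (Finset.mem_filter.1 hj).2)
        _ = Finset.card {j | ℓ j < l + 1} * (n + 1) ^ l := by rw [Finset.sum_const, smul_eq_mul]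
        _ ≤ n * (n + 1) ^ l := Nat.mul_le_mul_right _
            ((Finset.card_le_univ _).trans_eq (Fintype.card_fin n))
        _ < (n + 1) ^ (l + 1) := by rw [pow_succ]; nlinarith [Nat.pow_pos (n := l) (Nat.succ_pos n)]
  obtain ⟨q, hq⟩ : (n + 1) ^ (l + 1) ∣ ∑ j with l < ℓ j, (n + 1) ^ ℓ j :=
    Finset.dvd_sum fun j hj => pow_dvd_pow _ (Finset.mem_filter.1 hj).2
  have hmid : ∑ j with ℓ j = l, (n + 1) ^ ℓ j = Finset.card {j | ℓ j = l} * (n + 1) ^ l := by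
    rw [Finset.sum_congr rfl fun j hj => by rw [(Finset.mem_filter.1 hj).2], Finset.sum_const,
      smul_eq_mul]
  have hsplit : code ℓ = ∑ j with ℓ j < l, (n + 1) ^ ℓ j +
      (∑ j with ℓ j = l, (n + 1) ^ ℓ j + ∑ j with l < ℓ j, (n + 1) ^ ℓ j) := by
    rw [code, Finset.sum_filter, Finset.sum_filter, Finset.sum_filter, ← Finset.sum_add_distrib,
      ← Finset.sum_add_distrib]
    refine Finset.sum_congr rfl fun j _ => ?_
    rcases lt_trichotomy (ℓ j) l with h | h | h
    · simp [h, h.ne, h.not_gt]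
    · simp [h]
    · simp [h, h.ne', h.not_gt]
  have hcard : Finset.card {j | ℓ j = l} < n + 1 :=
    Nat.lt_succ_of_le ((Finset.card_le_univ _).trans_eq (Fintype.card_fin n))
  have : code ℓ = ∑ j with ℓ j < l, (n + 1) ^ ℓ j +
      (n + 1) ^ l * (Finset.card {j | ℓ j = l} + (n + 1) * q) := by
    rw [hsplit, hmid, hq]; ring
  rw [this, Nat.add_mul_div_left _ _ (by positivity), Nat.div_eq_of_lt hlow, zero_add,
    Nat.add_mul_mod_self_left, Nat.mod_eq_of_lt hcard]

theorem code_lt {Q : ℕ} {ℓ : Fin n → ℕ} (h : ∀ j, ℓ j ≤ Q) : code ℓ < (n + 1) ^ (Q + 1) := by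
  calc code ℓ ≤ ∑ _j : Fin n, (n + 1) ^ Q :=
        Finset.sum_le_sum fun j _ => Nat.pow_le_pow_right (Nat.succ_pos _) (h j)
    _ = n * (n + 1) ^ Q := by simp
    _ < (n + 1) ^ (Q + 1) := by rw [pow_succ]; nlinarith [Nat.pow_pos (n := Q) (Nat.succ_pos n)]

/-- The deficit is determined by the code. -/
theorem deficit_eq_of_code_eq {Q : ℕ} {ℓ ℓ' : Fin n → ℕ} (h : ∀ j, ℓ j ≤ Q) (h' : ∀ j, ℓ' j ≤ Q)
    (hc : code ℓ = code ℓ') : deficit Q ℓ = deficit Q ℓ' := by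
  have key : ∀ ℓ : Fin n → ℕ, (∀ j, ℓ j ≤ Q) → deficit Q ℓ =
      ∑ l ∈ Finset.range (Q + 1), code ℓ / (n + 1) ^ l % (n + 1) * (Q - l) := by
    intro ℓ h
    rw [deficit, ← Finset.sum_fiberwise_of_maps_to' (t := Finset.range (Q + 1)) (g := ℓ)
      (fun j _ => Finset.mem_range.2 (Nat.lt_succ_of_le (h j))) (fun l => Q - l)]
    refine Finset.sum_congr rfl fun l _ => ?_
    rw [code_digit, Finset.sum_const, smul_eq_mul]
  rw [key ℓ h, key ℓ' h', hc]

theorem code_update (ℓ : Fin n → ℕ) (j : Fin n) (l : ℕ) :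
    code (Function.update ℓ j l) = code ℓ - (n + 1) ^ ℓ j + (n + 1) ^ l := by
  have h1 : code ℓ = (n + 1) ^ ℓ j + ∑ j' ∈ Finset.univ.erase j, (n + 1) ^ ℓ j' :=
    (Finset.add_sum_erase _ (fun j => (n + 1) ^ ℓ j) (Finset.mem_univ j)).symm
  have h2 : code (Function.update ℓ j l) =
      (n + 1) ^ l + ∑ j' ∈ Finset.univ.erase j, (n + 1) ^ ℓ j' := by
    rw [code, ← Finset.add_sum_erase _ _ (Finset.mem_univ j), Function.update_self]
    congr 1
    exact Finset.sum_congr rfl fun j' hj' => by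
      rw [Function.update_of_ne (Finset.ne_of_mem_erase hj')]
  omega

theorem pow_le_code (ℓ : Fin n → ℕ) (j : Fin n) : (n + 1) ^ ℓ j ≤ code ℓ :=
  Finset.single_le_sum (f := fun j => (n + 1) ^ ℓ j) (fun _ _ => Nat.zero_le _)
    (Finset.mem_univ j)

theorem deficit_update {Q : ℕ} (ℓ : Fin n → ℕ) (j : Fin n) {l : ℕ} (h : ℓ j ≤ l) (hl : l ≤ Q) :
    deficit Q (Function.update ℓ j l) + (l - ℓ j) = deficit Q ℓ := by
  have h1 : deficit Q ℓ = (Q - ℓ j) + ∑ j' ∈ Finset.univ.erase j, (Q - ℓ j') :=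
    (Finset.add_sum_erase _ (fun j => Q - ℓ j) (Finset.mem_univ j)).symm
  have h2 : deficit Q (Function.update ℓ j l) =
      (Q - l) + ∑ j' ∈ Finset.univ.erase j, (Q - ℓ j') := by
    rw [deficit, ← Finset.add_sum_erase _ _ (Finset.mem_univ j), Function.update_self]
    congr 1
    exact Finset.sum_congr rfl fun j' hj' => by
      rw [Function.update_of_ne (Finset.ne_of_mem_erase hj')]
  omega

theorem deficit_le (Q : ℕ) (ℓ : Fin n → ℕ) : deficit Q ℓ ≤ n * Q := by
  calc deficit Q ℓ ≤ ∑ _j : Fin n, Q := Finset.sum_le_sum fun j _ => Nat.sub_le _ _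
    _ = n * Q := by simp

end Code

end MixedGoods

/-! ### The program that decides the test of the approximation scheme -/

/-! Memory layout: arrays `0` to `4` hold the input, array `5` the owners and array `6` the ratio, as
prescribed. Array `12` holds powers of `n + 1`, array `17` the table of load vectors, array `23` the
targets. Array `30` is `1` at the agents that have been served; array `31` is `0` at goods in the
pool, `1` at goods given away, `2` at goods in the bag. All other arrays are used as scalar
variables, variable `10` for the common scale of all utilities. Real register `0` is the left end
of the remaining cake, register `1` is scratch, register `i + 2` belongs to agent `i`, and register
`n + 2` is the right end of the cake. -/

namespace MixedGoods

/-- The scalar variable stored in cell `0` of array `a`. -/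
abbrev Expr.var (a : ℕ) : Expr := .get a 0

/-- The number of agents. -/
abbrev Expr.agents : Expr := .get 0 0

/-- The number of goods. -/
abbrev Expr.items : Expr := .get 0 1

/-- The utility of agent `i` for good `g`, scaled by variable `10`. -/
def Expr.good (i g : Expr) : Expr :=
  .get 1 (i * .items + g) * (.var 10 / .get 2 (i * .items + g))

/-- The utility of agent `i` for the cake, scaled by variable `10`. -/
def Expr.cake (i : Expr) : Expr := .get 3 i * (.var 10 / .get 4 i)

/-- The arrays with the input and the scale describe integral utilities `U i g` for the goods and
`C i` for the cake. -/
structure Env (n m D : ℕ) (U : ℕ → ℕ → ℕ) (C : ℕ → ℕ) (s : State) : Prop where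
  agents : s.mem 0 0 = n
  items : s.mem 0 1 = m
  scale : s.mem 10 0 = D
  good : ∀ i < n, ∀ g < m, s.mem 1 (i * m + g) * (D / s.mem 2 (i * m + g)) = U i g
  cake : ∀ i < n, s.mem 3 i * (D / s.mem 4 i) = C i

/-- The table of powers of `n + 1` in array `12`, and the number of codes in variable `13`. -/
structure Powers (n Q : ℕ) (s : State) : Prop where
  pow : ∀ l ≤ Q, s.mem 12 l = (n + 1) ^ l
  codes : s.mem 13 0 = (n + 1) ^ (Q + 1)

section

variable {n m D : ℕ} {U : ℕ → ℕ → ℕ} {C : ℕ → ℕ} {s σ : State}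

theorem Env.congr (h : Env n m D U C s)
    (hσ : ∀ a ∈ [0, 1, 2, 3, 4, 10], σ.mem a = s.mem a) : Env n m D U C σ := by
  simp only [List.mem_cons, List.not_mem_nil, or_false, forall_eq_or_imp, forall_eq] at hσ
  obtain ⟨h0, h1, h2, h3, h4, h10⟩ := hσ
  obtain ⟨e1, e2, e3, e4, e5⟩ := h
  constructor
  · rw [h0]; exact e1
  · rw [h0]; exact e2
  · rw [h10]; exact e3
  · rw [h1, h2]; exact e4
  · rw [h3, h4]; exact e5

theorem Env.val_good (h : Env n m D U C s) {i g : Expr} (hi : i.val s < n) (hg : g.val s < m) :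
    (Expr.good i g).val s = U (i.val s) (g.val s) := by
  simp only [Expr.good, Expr.val_mul, Expr.val_get, Expr.val_add, Expr.val_div, Expr.val_zero,
    Expr.val_one, h.items, h.scale]
  exact h.good _ hi _ hg

theorem Env.val_cake (h : Env n m D U C s) {i : Expr} (hi : i.val s < n) :
    (Expr.cake i).val s = C (i.val s) := by
  simp only [Expr.cake, Expr.val_mul, Expr.val_get, Expr.val_div, Expr.val_zero, h.scale]
  exact h.cake _ hi

theorem Powers.congr {Q : ℕ} (h : Powers n Q s) (h12 : σ.mem 12 = s.mem 12)
    (h13 : σ.mem 13 = s.mem 13) : Powers n Q σ :=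
  ⟨by rw [h12]; exact h.pow, by rw [h13]; exact h.codes⟩

end

/-- The nonzero entries of the table are at the codes of the load vectors in `R`; they exceed the
deficits of these vectors by one. -/
structure IsTable {n : ℕ} (Q : ℕ) (T : ℕ → ℕ) (R : Set (Fin n → ℕ)) : Prop where
  sound : ∀ z < (n + 1) ^ (Q + 1), T z ≠ 0 → ∃ ℓ ∈ R, code ℓ = z ∧ T z = deficit Q ℓ + 1
  complete : ∀ ℓ ∈ R, T (code ℓ) ≠ 0

/-- For the load `l` in variable `22`: if the load vector with the code in variable `24` has a
bundle of load `l`, enter the vector that arises when an item of the size in variable `20` is added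
to this bundle. Since entries are deficits plus one, the new entry is the old one minus the increase
of the load; the double subtraction truncates the new load at `Q`. -/
def moveCmd (Q : ℕ) : Cmd :=
  .ite (.var 24 / .get 12 (.var 22) - .var 24 / .get 12 (.var 22 + 1) * (.agents + 1))
    (.set 17
      (.var 24 - .get 12 (.var 22) + .get 12 (.lit Q - (.lit Q - (.var 22 + .var 20))))
      (.get 17 (.var 24) - ((.lit Q - (.lit Q - (.var 22 + .var 20))) - .var 22)))
    .skip

/-- Update the table in array `17` for an additional item of the size in variable `20`. The codes
are treated in descending order, so that no item is used twice. -/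
def itemCmd (Q : ℕ) : Cmd :=
  .for 21 (.var 13) (.seq (.set 24 0 (.var 13 - 1 - .var 21))
    (.ite (.get 17 (.var 24)) (.for 22 (.lit Q) (moveCmd Q)) .skip))

/-- The load vectors that arise when an item of size `e` may be added to a bundle. -/
def withItem {n : ℕ} (Q e : ℕ) (R : Set (Fin n → ℕ)) : Set (Fin n → ℕ) :=
  {ℓ' | ℓ' ∈ R ∨ ∃ ℓ ∈ R, ∃ j, ℓ' = Function.update ℓ j (min Q (ℓ j + e))}

section

variable {n m : ℕ} {I : Instance n m} {X H Q : ℕ}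

/-- The table during the treatment of code `y`, when the loads less than `l` have been treated;
`T₀` is the table before. -/
structure MoveInv (Q e y : ℕ) (R : Set (Fin n → ℕ)) (T₀ T : ℕ → ℕ) (l : ℕ) : Prop where
  sound : ∀ z < (n + 1) ^ (Q + 1), T z ≠ 0 →
    ∃ ℓ ∈ withItem Q e R, code ℓ = z ∧ T z = deficit Q ℓ + 1
  old : ∀ z ≤ y, T z = T₀ z
  mono : ∀ z, T₀ z ≠ 0 → T z ≠ 0
  new : ∀ ℓ ∈ R, code ℓ = y → ∀ j, ℓ j < l →
    T (code (Function.update ℓ j (min Q (ℓ j + e)))) ≠ 0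

theorem MoveInv.step {e y : ℕ} {R : Set (Fin n → ℕ)} {T₀ T : ℕ → ℕ} {l : ℕ}
    (h : MoveInv Q e y R T₀ T l) (he : 0 < e) (hl : l < Q) {ℓ : Fin n → ℕ} (hℓ : ℓ ∈ R)
    (hy : code ℓ = y) (hT : T₀ y = deficit Q ℓ + 1) {j : Fin n} (hj : ℓ j = l) :
    MoveInv Q e y R T₀ (Function.update T (y - (n + 1) ^ l + (n + 1) ^ min Q (l + e))
      (T y - (min Q (l + e) - l))) (l + 1) := by
  have hn : 1 < n + 1 := Nat.succ_lt_succ (Fin.pos j)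
  have hlt : l < min Q (l + e) := by omega
  have hpow : (n + 1) ^ l < (n + 1) ^ min Q (l + e) := Nat.pow_lt_pow_right hn hlt
  have hle : (n + 1) ^ l ≤ y := by rw [← hj, ← hy]; exact pow_le_code ℓ j
  have hcode : ∀ ℓ' : Fin n → ℕ, code ℓ' = y → ∀ j', ℓ' j' = l →
      code (Function.update ℓ' j' (min Q (ℓ' j' + e))) =
        y - (n + 1) ^ l + (n + 1) ^ min Q (l + e) := by
    intro ℓ' h1 j' h2
    rw [code_update, h1, h2]
  have hval : T y - (min Q (l + e) - l) =
      deficit Q (Function.update ℓ j (min Q (ℓ j + e))) + 1 := by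
    have := deficit_update (Q := Q) ℓ j (l := min Q (ℓ j + e)) (by omega) (min_le_left _ _)
    rw [h.old y le_rfl, hT]
    rw [hj] at this ⊢
    omega
  refine ⟨fun z hz hz0 => ?_, fun z hz => ?_, fun z hz => ?_, fun ℓ' hℓ' h1 j' hj' => ?_⟩
  · by_cases hzz : z = y - (n + 1) ^ l + (n + 1) ^ min Q (l + e)
    · subst hzz
      rw [Function.update_self]
      exact ⟨_, Or.inr ⟨ℓ, hℓ, j, rfl⟩, hcode ℓ hy j hj, hval⟩
    · rw [Function.update_of_ne hzz] at hz0 ⊢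
      exact h.sound z hz hz0
  · rw [Function.update_of_ne (by omega)]
    exact h.old z hz
  · by_cases hzz : z = y - (n + 1) ^ l + (n + 1) ^ min Q (l + e)
    · subst hzz
      rw [Function.update_self, hval]
      exact Nat.succ_ne_zero _
    · rw [Function.update_of_ne hzz]
      exact h.mono z hz
  · by_cases hzz : code (Function.update ℓ' j' (min Q (ℓ' j' + e))) =
        y - (n + 1) ^ l + (n + 1) ^ min Q (l + e)
    · rw [hzz, Function.update_self, hval]
      exact Nat.succ_ne_zero _
    · rw [Function.update_of_ne hzz]
      rcases Nat.lt_succ_iff_lt_or_eq.1 hj' with h2 | h2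
      · exact h.new ℓ' hℓ' h1 j' h2
      · exact absurd (hcode ℓ' h1 j' h2) hzz

theorem sub_sub_eq_min (Q k : ℕ) : Q - (Q - k) = min Q k := by omega

theorem ensures_moveCmd {e y l : ℕ} {R : Set (Fin n → ℕ)} {T₀ : ℕ → ℕ} {s : State}
    (hQX : n * Q + 1 ≤ X) (he : 0 < e) (hl : l < Q)
    (hT₀ : ∃ ℓ ∈ R, code ℓ = y ∧ T₀ y = deficit Q ℓ + 1) (hn : s.mem 0 0 = n) (hpow : Powers n Q s)
    (h20 : s.mem 20 0 = e) (h22 : s.mem 22 0 = l) (h24 : s.mem 24 0 = y)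
    (h : MoveInv Q e y R T₀ (s.mem 17) l) :
    Ensures I X H (moveCmd Q) (fun σ => MoveInv Q e y R T₀ (σ.mem 17) (l + 1)) s := by
  obtain ⟨ℓ, hℓ, hcode, hdef⟩ := hT₀
  have hdig : y / (n + 1) ^ l - y / (n + 1) ^ (l + 1) * (n + 1) =
      Finset.card {j | ℓ j = l} := by
    rw [← code_digit, hcode, pow_succ, ← Nat.div_div_eq_div_mul, Nat.mod_def, mul_comm (n + 1)]
  refine ensures_ite (fun htest => ?_) (fun htest => ensures_skip ?_)
  · simp only [Expr.val_sub, Expr.val_div, Expr.val_get, Expr.val_mul, Expr.val_add,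
      Expr.val_zero, Expr.val_one, h22, h24, hn, hpow.pow l hl.le, hpow.pow (l + 1) hl, hdig]
      at htest
    obtain ⟨j, hj⟩ := Finset.card_ne_zero.1 htest
    have hj' : ℓ j = l := (Finset.mem_filter.1 hj).2
    refine ensures_set (fun _ => ?_) ?_
    · simp only [Expr.val_sub, Expr.val_get, Expr.val_zero, h24]
      refine (Nat.sub_le _ _).trans ?_
      rw [h.old y le_rfl, hdef]
      exact (Nat.succ_le_succ (deficit_le Q ℓ)).trans hQX
    · simp only [Expr.val_sub, Expr.val_get, Expr.val_add, Expr.val_zero, Expr.val_lit, h20, h22,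
        h24, sub_sub_eq_min, hpow.pow l hl.le, hpow.pow _ (min_le_left Q (l + e)),
        State.setMem_mem_same]
      exact h.step he hl hℓ hcode hdef hj'
  · simp only [Expr.val_sub, Expr.val_div, Expr.val_get, Expr.val_mul, Expr.val_add,
      Expr.val_zero, Expr.val_one, h22, h24, hn, hpow.pow l hl.le, hpow.pow (l + 1) hl, hdig]
      at htest
    refine ⟨h.sound, h.old, h.mono, fun ℓ' hℓ' h1 j' hj' => ?_⟩
    rcases Nat.lt_succ_iff_lt_or_eq.1 hj' with h2 | h2
    · exact h.new ℓ' hℓ' h1 j' h2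
    · have h3 : Finset.card {j | ℓ' j = l} = 0 := by
        rw [← code_digit, h1, ← hcode, code_digit, htest]
      have : j' ∈ ({j | ℓ' j = l} : Finset (Fin n)) := by simp [h2]
      rw [Finset.card_eq_zero.1 h3] at this
      exact absurd this (Finset.notMem_empty _)

/-- The table when the last `t` codes have been treated; `T₀` is the table before. -/
structure ItemInv (Q e : ℕ) (R : Set (Fin n → ℕ)) (T₀ T : ℕ → ℕ) (t : ℕ) : Prop where
  sound : ∀ z < (n + 1) ^ (Q + 1), T z ≠ 0 →
    ∃ ℓ ∈ withItem Q e R, code ℓ = z ∧ T z = deficit Q ℓ + 1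
  old : ∀ z < (n + 1) ^ (Q + 1) - t, T z = T₀ z
  mono : ∀ z, T₀ z ≠ 0 → T z ≠ 0
  new : ∀ ℓ ∈ R, (n + 1) ^ (Q + 1) - t ≤ code ℓ → ∀ j,
    T (code (Function.update ℓ j (min Q (ℓ j + e)))) ≠ 0

theorem ensures_itemCmd {e : ℕ} {R : Set (Fin n → ℕ)} {s : State}
    (hR : ∀ ℓ ∈ R, ∀ j, ℓ j ≤ Q) (hX : (n + 1) ^ (Q + 1) + n * Q + Q + 1 ≤ X)
    (hH : (n + 1) ^ (Q + 1) + Q ≤ H) (he : 0 < e) (hn : s.mem 0 0 = n) (hpow : Powers n Q s)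
    (h20 : s.mem 20 0 = e) (h : IsTable Q (s.mem 17) R) :
    Ensures I X H (itemCmd Q) (fun σ => IsTable Q (σ.mem 17) (withItem Q e R)) s := by
  refine ensures_for (fun t σ => ItemInv Q e R (s.mem 17) (σ.mem 17) t) ((n + 1) ^ (Q + 1))
    (by omega) (by omega) (by simp [Cmd.writes, moveCmd]) ?_ ?_ ?_ ?_ ?_
  · intro σ hσ
    rw [Expr.val_get, Expr.val_zero, hσ.1 13 (by simp [Cmd.writes, moveCmd]), hpow.codes]
  · intro k σ j hσ
    simpa using hσ
  · refine ⟨fun z hz hz0 => ?_, fun z _ => rfl, fun z hz => hz, fun ℓ hℓ hc j => ?_⟩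
    · obtain ⟨ℓ, hℓ, h1⟩ := h.sound z hz hz0
      exact ⟨ℓ, Or.inl hℓ, h1⟩
    · exact absurd (code_lt (hR ℓ hℓ)) (not_lt.2 hc)
  · intro t ht σ hσ h21 hinv
    have f0 := hσ.1 0 (by simp [Cmd.writes, moveCmd])
    have f12 := hσ.1 12 (by simp [Cmd.writes, moveCmd])
    have f13 := hσ.1 13 (by simp [Cmd.writes, moveCmd])
    have f20 := hσ.1 20 (by simp [Cmd.writes, moveCmd])
    have hpowσ := hpow.congr f12 f13
    set y := (n + 1) ^ (Q + 1) - 1 - t with hy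
    refine ensures_seq (ensures_set (fun _ => ?_) ?_)
    · simp only [Expr.val_sub, Expr.val_get, Expr.val_zero, Expr.val_one, hpowσ.codes]
      omega
    simp only [Expr.val_sub, Expr.val_get, Expr.val_zero, Expr.val_one, hpowσ.codes, h21, ← hy]
    have hTy : σ.mem 17 y = s.mem 17 y := hinv.old y (by omega)
    refine ensures_ite (fun htest => ?_) (fun htest => ensures_skip ?_)
    · have hT₀y : s.mem 17 y ≠ 0 := by rw [← hTy]; simpa using htest
      refine ensures_for (fun l τ => MoveInv Q e y R (σ.mem 17) (τ.mem 17) l) Q (by omega)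
        (by omega) (by simp [Cmd.writes, moveCmd]) (fun τ _ => rfl) (fun l τ j hτ => by simpa)
        ?_ ?_ ?_
      · exact ⟨by simpa using hinv.sound, by simp, by simp,
          fun _ _ _ _ h0 => absurd h0 (Nat.not_lt_zero _)⟩
      · intro l hl τ hτ h22 hmv
        have g0 := hτ.1 0 (by simp [Cmd.writes, moveCmd])
        have g12 := hτ.1 12 (by simp [Cmd.writes, moveCmd])
        have g13 := hτ.1 13 (by simp [Cmd.writes, moveCmd])
        have g20 := hτ.1 20 (by simp [Cmd.writes, moveCmd])
        have g24 := hτ.1 24 (by simp [Cmd.writes, moveCmd])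
        rw [State.setMem_mem_ne _ (by decide)] at g0 g12 g13 g20
        refine ensures_moveCmd (by omega) he hl ?_ (by rw [g0, f0, hn]) (hpowσ.congr g12 g13)
          (by rw [g20, f20, h20]) h22 (by rw [g24]; simp) hmv
        rw [hTy]
        exact h.sound y (by omega) hT₀y
      · intro τ hτ hmv
        refine ⟨hmv.sound, fun z hz => ?_, fun z hz => hmv.mono z (hinv.mono z hz),
          fun ℓ hℓ hc j => ?_⟩
        · rw [hmv.old z (by omega), hinv.old z (by omega)]
        · rcases eq_or_ne (code ℓ) y with hcy | hcy
          · rcases lt_or_eq_of_le (hR ℓ hℓ j) with hj | hj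
            · exact hmv.new ℓ hℓ hcy j hj
            · have : Function.update ℓ j (min Q (ℓ j + e)) = ℓ := by
                rw [min_eq_left (by omega), ← hj, Function.update_eq_self]
              rw [this]
              exact hmv.mono _ (hinv.mono _ (h.complete ℓ hℓ))
          · exact hmv.mono _ (hinv.new ℓ hℓ (by omega) j)
    · have hT₀y : s.mem 17 y = 0 := by rw [← hTy]; simpa using htest
      refine ⟨by simpa using hinv.sound, fun z hz => ?_, by simpa using hinv.mono,
        fun ℓ hℓ hc j => ?_⟩
      · simpa using hinv.old z (by omega)
      · have hcy : code ℓ ≠ y := fun hcy => h.complete ℓ hℓ (hcy ▸ hT₀y)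
        simpa using hinv.new ℓ hℓ (by omega) j
  · intro σ _ hinv
    refine ⟨hinv.sound, ?_⟩
    rintro ℓ (hℓ | ⟨ℓ, hℓ, j, rfl⟩)
    · exact hinv.mono _ (h.complete ℓ hℓ)
    · exact hinv.new ℓ hℓ (by omega) j

/-- Decide the test for agent (variable `14`) and unit (variable `15`); the answer goes to variable
`16`. -/
def decideCmd (Q r : ℕ) : Cmd :=
  .seq (.for 21 (.var 13) (.set 17 (.var 21) 0))
  (.seq (.set 17 .agents (.agents * .lit Q + 1))
  (.seq (.set 18 0 (.cake (.var 14)))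
  (.seq (.for 19 .items (.seq (.set 20 0 (.good (.var 14) (.var 19) / .var 15))
    (.ite (.var 20 + 1 - .lit r) (itemCmd Q)
      (.set 18 0 (.var 18 + .good (.var 14) (.var 19))))))
  (.seq (.set 16 0 0)
  (.for 21 (.var 13) (.ite (.get 17 (.var 21))
    (.ite (1 - ((.get 17 (.var 21) - 1) * .var 15 - .var 18)) (.set 16 0 1) .skip) .skip))))))

theorem decideCmd_writes (Q r : ℕ) :
    (decideCmd Q r).writes = [21, 17, 21, 17, 18, 19, 20, 21, 24, 22, 17, 22, 21, 18, 19, 16,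
      21, 16, 21] := rfl

theorem reach_succ_of_le {r : ℕ} {e : ℕ → ℕ} {k : ℕ} (h : r ≤ e k) :
    Reach n Q r e (k + 1) = withItem Q (e k) (Reach n Q r e k) := by
  ext ℓ
  simp [Reach, withItem, h]

theorem reach_succ_of_lt {r : ℕ} {e : ℕ → ℕ} {k : ℕ} (h : e k < r) :
    Reach n Q r e (k + 1) = Reach n Q r e k := by
  ext ℓ
  simp [Reach, h.not_ge]

/-- With the final table in array `17`, the last loop of the program decides the test. -/
theorem ensures_check {F w : ℕ} {s : State} {N : ℕ}
    (hNX : N + 1 ≤ X) (hNH : N ≤ H) (h13 : s.mem 13 0 = N)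
    (h15 : s.mem 15 0 = w) (h18 : s.mem 18 0 = F) :
    Ensures I X H (.seq (.set 16 0 0) (.for 21 (.var 13) (.ite (.get 17 (.var 21))
      (.ite (1 - ((.get 17 (.var 21) - 1) * .var 15 - .var 18)) (.set 16 0 1) .skip) .skip)))
      (fun σ => σ.mem 16 0 ≤ 1 ∧
        (σ.mem 16 0 ≠ 0 ↔ ∃ z < N, s.mem 17 z ≠ 0 ∧ (s.mem 17 z - 1) * w ≤ F)) s := by
  refine ensures_seq (ensures_set (fun _ => by simp) ?_)
  refine ensures_for (fun t σ => σ.mem 16 0 ≤ 1 ∧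
        (σ.mem 16 0 ≠ 0 ↔ ∃ z < t, s.mem 17 z ≠ 0 ∧ (s.mem 17 z - 1) * w ≤ F)) N hNH
    (by omega) (by simp [Cmd.writes]) (fun σ hσ => ?_) (fun t σ j h => by simpa) ?_
    (fun t ht σ hσ h21 hinv => ?_) (fun σ _ h => h)
  · have f13 := hσ.1 13 (by simp [Cmd.writes])
    simp [f13, h13]
  · simp
  · have f15 := hσ.1 15 (by simp [Cmd.writes])
    have f17 := hσ.1 17 (by simp [Cmd.writes])
    have f18 := hσ.1 18 (by simp [Cmd.writes])
    rw [State.setMem_mem_ne _ (by decide)] at f15 f17 f18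
    obtain ⟨h1, h2⟩ := hinv
    have hext : (∃ z < t + 1, s.mem 17 z ≠ 0 ∧ (s.mem 17 z - 1) * w ≤ F) ↔
        (∃ z < t, s.mem 17 z ≠ 0 ∧ (s.mem 17 z - 1) * w ≤ F) ∨
          (s.mem 17 t ≠ 0 ∧ (s.mem 17 t - 1) * w ≤ F) := by
      constructor
      · rintro ⟨z, hz, h⟩
        rcases Nat.lt_succ_iff_lt_or_eq.1 hz with hz | rfl
        · exact Or.inl ⟨z, hz, h⟩
        · exact Or.inr h
      · rintro (⟨z, hz, h⟩ | h)
        · exact ⟨z, by omega, h⟩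
        · exact ⟨t, by omega, h⟩
    rw [hext, ← h2]
    refine ensures_ite (fun ht0 => ensures_ite (fun htest => ensures_set (fun _ => ?_) ?_)
      (fun htest => ensures_skip ?_)) (fun ht0 => ensures_skip ?_)
    · simp only [Expr.val_one]; omega
    · simp only [Expr.val_get, Expr.val_zero, h21, f17] at ht0
      simp only [Expr.val_sub, Expr.val_one, Expr.val_mul, Expr.val_get, Expr.val_zero, h21,
        f15, f17, f18, h15, h18] at htest
      have : (s.mem 17 t - 1) * w ≤ F := by omega
      simp [ht0, this]
    · simp only [Expr.val_sub, Expr.val_one, Expr.val_mul, Expr.val_get, Expr.val_zero, h21,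
        f15, f17, f18, h15, h18] at htest
      have : ¬ (s.mem 17 t - 1) * w ≤ F := by omega
      simp [this, h1]
    · simp only [Expr.val_get, Expr.val_zero, h21, f17] at ht0
      simp [ht0, h1]

theorem isTable_zero (Q : ℕ) (T : ℕ → ℕ) (hT : ∀ z < (n + 1) ^ (Q + 1), T z = 0) :
    IsTable Q (Function.update T n (n * Q + 1)) {fun _ : Fin n => 0} := by
  have hc : code (fun _ : Fin n => 0) = n := by simp [code]
  have hd : deficit Q (fun _ : Fin n => 0) = n * Q := by simp [deficit]
  refine ⟨fun z hz hz0 => ⟨_, rfl, ?_⟩, ?_⟩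
  · have hzn : z = n := by
      by_contra hne
      rw [Function.update_of_ne hne] at hz0
      exact hz0 (hT z hz)
    rw [hc, hd, hzn]
    simp
  · rintro _ rfl
    simp [hc]

theorem ensures_decideCmd {r i w D : ℕ} {U : ℕ → ℕ → ℕ} {C : ℕ → ℕ} {s : State}
    (hX : (n + 1) ^ (Q + 1) + n * Q + Q + m + 1 ≤ X)
    (hXU : C i + ∑ g ∈ Finset.range m, U i g ≤ X)
    (hH : (n + 1) ^ (Q + 1) + Q + m ≤ H) (hr : 0 < r) (hi : i < n)
    (henv : Env n m D U C s) (hpow : Powers n Q s)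
    (h14 : s.mem 14 0 = i) (h15 : s.mem 15 0 = w) :
    Ensures I X H (decideCmd Q r) (fun σ => σ.mem 16 0 ≤ 1 ∧
      (σ.mem 16 0 ≠ 0 ↔ Accepts n m Q r w (C i) (U i))) s := by
  have hUX : ∀ g < m, U i g ≤ X := fun g hg =>
    (Finset.single_le_sum (f := U i) (fun _ _ => Nat.zero_le _) (Finset.mem_range.2 hg)).trans
      ((Nat.le_add_left _ _).trans hXU)
  have hfl : ∀ k ≤ m, fluid r w (C i) (U i) k ≤ X := fun k hk => by
    refine le_trans (Nat.add_le_add_left ?_ _) hXU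
    calc ∑ g ∈ Finset.range k, (if r ≤ U i g / w then 0 else U i g)
        ≤ ∑ g ∈ Finset.range k, U i g := Finset.sum_le_sum fun g _ => by split_ifs <;> omega
      _ ≤ _ := Finset.sum_le_sum_of_subset (Finset.range_mono hk)
  -- clear the table
  refine ensures_seq (ensures_for (fun t σ => ∀ z < t, σ.mem 17 z = 0) ((n + 1) ^ (Q + 1))
    (by omega) (by omega) (by simp [Cmd.writes]) (fun σ hσ => ?_) (fun t σ j h => by simpa)
    (fun z hz => absurd hz (Nat.not_lt_zero z)) (fun t ht σ hσ h21 hinv => ?_)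
    (fun s₁ hs₁ hT => ?_))
  · rw [Expr.val_get, Expr.val_zero, hσ.1 13 (by simp [Cmd.writes]), hpow.codes]
  · refine ensures_set (fun _ => by simp) fun z hz => ?_
    simp only [Expr.val_get, Expr.val_zero, h21, State.setMem_mem_same]
    by_cases hzt : z = t
    · simp [hzt]
    · rw [Function.update_of_ne hzt]
      exact hinv z (by omega)
  have f : ∀ a, a ≠ 17 → a ≠ 21 → s₁.mem a = s.mem a := fun a h1 h2 =>
    hs₁.1 a (by simp [Cmd.writes, h1, h2])
  have henv₁ : Env n m D U C s₁ := henv.congr (by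
    intro a ha; exact f a (by rintro rfl; simp at ha) (by rintro rfl; simp at ha))
  have hpow₁ : Powers n Q s₁ := hpow.congr (f 12 (by decide) (by decide))
    (f 13 (by decide) (by decide))
  have f14 : s₁.mem 14 0 = i := by rw [f 14 (by decide) (by decide), h14]
  have f15 : s₁.mem 15 0 = w := by rw [f 15 (by decide) (by decide), h15]
  clear f
  refine ensures_seq (ensures_set (fun _ => by simp [henv₁.agents]; omega) ?_)
  simp only [Expr.val_add, Expr.val_mul, Expr.val_get, Expr.val_zero, Expr.val_one, Expr.val_lit,
    henv₁.agents]
  refine ensures_seq (ensures_set (fun _ => ?_) ?_)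
  · rw [Env.val_cake (n := n) (m := m) (D := D) (U := U) (C := C)
      (henv₁.congr (by simp)) (by simpa [f14] using hi)]
    simp only [Expr.val_get, Expr.val_zero, State.setMem_mem_ne _ (show 14 ≠ 17 by decide), f14]
    exact (Nat.le_add_right _ _).trans hXU
  rw [Env.val_cake (n := n) (m := m) (D := D) (U := U) (C := C)
      (henv₁.congr (by simp)) (by simpa [f14] using hi)]
  simp only [Expr.val_get, Expr.val_zero, State.setMem_mem_ne _ (show 14 ≠ 17 by decide), f14]
  set s₂ := (s₁.setMem 17 n (n * Q + 1)).setMem 18 0 (C i) with hs₂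
  have henv₂ : Env n m D U C s₂ := henv₁.congr (by simp [hs₂])
  have hpow₂ : Powers n Q s₂ := hpow₁.congr (by simp [hs₂]) (by simp [hs₂])
  have g14 : s₂.mem 14 0 = i := by simp [hs₂, f14]
  have g15 : s₂.mem 15 0 = w := by simp [hs₂, f15]
  -- treat the goods one by one
  refine ensures_seq (ensures_for (fun k σ => IsTable Q (σ.mem 17)
      (Reach n Q r (fun g => U i g / w) k) ∧ σ.mem 18 0 = fluid r w (C i) (U i) k) m
    (by omega) (by omega) (by simp [Cmd.writes, itemCmd, moveCmd]) (fun σ hσ => ?_)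
    (fun t σ j h => by simpa) ⟨?_, ?_⟩ ?_ ?_)
  · rw [Expr.val_get, Expr.val_one, hσ.1 0 (by simp [Cmd.writes, itemCmd, moveCmd]), henv₂.items]
  · rw [hs₂, State.setMem_mem_ne _ (by decide), State.setMem_mem_same]
    exact isTable_zero Q _ hT
  · simp [hs₂, fluid]
  · rintro k hk σ hσ h19 ⟨htab, hflu⟩
    have f : ∀ a, a ∉ [17, 18, 19, 20, 21, 22, 24] → σ.mem a = s₂.mem a := fun a ha =>
      hσ.1 a (by simp at ha; simp [Cmd.writes, itemCmd, moveCmd, ha])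
    have henvσ : Env n m D U C σ := henv₂.congr (by
      intro a ha
      exact f a (by simp only [List.mem_cons, List.not_mem_nil, or_false] at ha ⊢; omega))
    have hpowσ : Powers n Q σ := hpow₂.congr (f 12 (by decide)) (f 13 (by decide))
    have k14 : σ.mem 14 0 = i := by rw [f 14 (by decide), g14]
    have k15 : σ.mem 15 0 = w := by rw [f 15 (by decide), g15]
    have hgood : ∀ v, (Expr.good (.var 14) (.var 19)).val (σ.setMem 20 0 v) = U i k := fun v => by
      rw [Env.val_good (n := n) (m := m) (D := D) (U := U) (C := C) (henvσ.congr (by simp))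
        (by simpa [k14] using hi) (by simpa [h19] using hk)]
      simp [k14, h19]
    have hgood' : (Expr.good (.var 14) (.var 19)).val σ = U i k := by
      rw [henvσ.val_good (by simpa [k14] using hi) (by simpa [h19] using hk)]
      simp [k14, h19]
    refine ensures_seq (ensures_set (fun _ => ?_) ?_)
    · rw [Expr.val_div, hgood']
      exact (Nat.div_le_self _ _).trans (hUX k hk)
    rw [Expr.val_div, hgood']
    simp only [Expr.val_get, Expr.val_zero, k15]
    refine ensures_ite (fun htest => ?_) (fun htest => ensures_set (fun _ => ?_) ?_)
    · have hbig : r ≤ U i k / w := by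
        simp at htest; omega
      refine (ensures_itemCmd (n := n) (e := U i k / w) (R := Reach n Q r (fun g => U i g / w) k)
        (fun ℓ hℓ => reach_le hℓ) (by omega) (by omega) (by omega) (by simp [henvσ.agents])
        (hpowσ.congr (by simp) (by simp)) (by simp) (by simpa using htab)).mono
        fun τ hτ hτt => ⟨?_, ?_⟩
      · rwa [reach_succ_of_le (e := fun g => U i g / w) hbig]
      · rw [hτ.1 18 (by simp [Cmd.writes, itemCmd, moveCmd]), State.setMem_mem_ne _ (by decide),
          hflu, fluid, fluid, Finset.sum_range_succ, if_pos hbig, add_zero]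
    · have hsmall : U i k / w < r := by
        simp at htest; omega
      rw [Expr.val_add, hgood]
      simp only [Expr.val_get, Expr.val_zero, State.setMem_mem_ne _ (show 18 ≠ 20 by decide), hflu]
      have := hfl (k + 1) hk
      rw [fluid, Finset.sum_range_succ, if_neg (not_le.2 hsmall)] at this
      rw [fluid]; omega
    · have hsmall : U i k / w < r := by
        simp at htest; omega
      rw [Expr.val_add, hgood]
      refine ⟨by simpa [reach_succ_of_lt (n := n) (Q := Q) (e := fun g => U i g / w) hsmall]
        using htab, ?_⟩
      simp only [Expr.val_get, Expr.val_zero, State.setMem_mem_ne _ (show 18 ≠ 20 by decide), hflu,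
        State.setMem_mem_same, Function.update_self]
      rw [fluid, fluid, Finset.sum_range_succ, if_neg (not_le.2 hsmall)]; omega
  · rintro σ hσ ⟨htab, hflu⟩
    have f : ∀ a, a ∉ [17, 18, 19, 20, 21, 22, 24] → σ.mem a = s₂.mem a := fun a ha =>
      hσ.1 a (by simp at ha; simp [Cmd.writes, itemCmd, moveCmd, ha])
    refine (ensures_check (N := (n + 1) ^ (Q + 1)) (by omega) (by omega)
      (by rw [f 13 (by decide), hpow₂.codes]) (by rw [f 15 (by decide), g15]) hflu).mono
      fun τ _ hτ => ⟨hτ.1, hτ.2.trans ⟨?_, ?_⟩⟩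
    · rintro ⟨z, hz, hz0, hle⟩
      obtain ⟨ℓ, hℓ, -, h2⟩ := htab.sound z hz hz0
      exact ⟨ℓ, hℓ, by rwa [h2, Nat.add_sub_cancel] at hle⟩
    · rintro ⟨ℓ, hℓ, hle⟩
      have hlt := code_lt fun j => reach_le hℓ j
      refine ⟨code ℓ, hlt, htab.complete ℓ hℓ, ?_⟩
      obtain ⟨ℓ', hℓ', h1, h2⟩ := htab.sound _ hlt (htab.complete ℓ hℓ)
      rwa [h2, Nat.add_sub_cancel, deficit_eq_of_code_eq (fun j => reach_le hℓ' j)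
        (fun j => reach_le hℓ j) h1]

end

end MixedGoods

/-! ### The program that computes the targets and the ratio -/

namespace MixedGoods

/-- Find the unit for agent (variable `14`): start with the total utility as the unit (variable
`15`) and decrease it by a factor of about `1 - 1 / r` until the test succeeds. -/
def searchCmd (Q r : ℕ) : Cmd :=
  .seq (.set 15 0 (.cake (.var 14)))
  (.seq (.for 19 .items (.set 15 0 (.var 15 + .good (.var 14) (.var 19))))
  (.seq (.set 16 0 0)
  (.loop (.var 15 * (1 - .var 16))
    (.seq (decideCmd Q r)
      (.ite (.var 16) .skip (.set 15 0 (.var 15 - (.var 15 / .lit r + 1))))))))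

/-- Bernoulli's inequality `2 ≤ (1 + 1 / x) ^ (x + 1)` without fractions. -/
theorem two_mul_pow_le (x : ℕ) : 2 * x ^ (x + 1) ≤ (x + 1) ^ (x + 1) := by
  have key : ∀ k, x ^ k * (x + k) ≤ x * (x + 1) ^ k := by
    intro k
    induction k with
    | zero => simp
    | succ k ih =>
      calc x ^ (k + 1) * (x + (k + 1)) ≤ x ^ k * (x + k) * (x + 1) := by
            rw [pow_succ, mul_assoc, mul_assoc]
            exact Nat.mul_le_mul_left _ (by nlinarith)
        _ ≤ x * (x + 1) ^ k * (x + 1) := Nat.mul_le_mul_right _ ih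
        _ = x * (x + 1) ^ (k + 1) := by ring
  rcases Nat.eq_zero_or_pos x with rfl | hx
  · simp
  · refine Nat.le_of_mul_le_mul_left ((Nat.le_trans ?_ (key (x + 1)))) hx
    calc x * (2 * x ^ (x + 1)) = x ^ (x + 1) * (2 * x) := by ring
      _ ≤ _ := Nat.mul_le_mul_left _ (by omega)

/-- After `r * size T` reductions by a factor of at most `1 - 1 / r`, a number `T` is below `1`. -/
theorem pow_mul_lt (r T : ℕ) (hr : 0 < r) :
    (r - 1) ^ (r * T.size) * T < r ^ (r * T.size) := by
  obtain ⟨x, rfl⟩ : ∃ x, r = x + 1 := ⟨r - 1, by omega⟩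
  have h1 := Nat.pow_le_pow_left (two_mul_pow_le x) T.size
  rw [mul_pow] at h1
  rw [Nat.add_sub_cancel, pow_mul, pow_mul]
  have h2 := Nat.lt_size_self T
  rcases Nat.eq_zero_or_pos ((x ^ (x + 1)) ^ T.size) with h | h
  · rw [h, zero_mul]; positivity
  · nlinarith

section

variable {n m : ℕ} {I : Instance n m} {X H r : ℕ}

/-- The unit found by the search approximates the maximin share from both sides. Rounding
down the units does no harm, since a positive maximin share is large after scaling (`hM`). -/
theorem ensures_searchCmd {i : Fin n} {D : ℕ} {U : ℕ → ℕ → ℕ} {C : ℕ → ℕ} {s : State}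
    (hX : (n + 1) ^ (r * r + 1) + n * (r * r) + r * r + m + 1 ≤ X)
    (hXU : C i + ∑ g ∈ Finset.range m, U i g ≤ X)
    (hH : (n + 1) ^ (r * r + 1) + r * r + m ≤ H)
    (hHT : r * (C i + ∑ g ∈ Finset.range m, U i g).size ≤ H) (hr : 2 ≤ r) (hD : 0 < D)
    (hU : ∀ g : Fin m, (U i g : ℝ) = D * I.good i g) (hC : (C i : ℝ) = D * I.wholeCake i)
    (hM : 0 < I.mms i n → ((r * r : ℕ) + (r : ℝ)) * r ≤ D * I.mms i n)
    (henv : Env n m D U C s) (hpow : Powers n (r * r) s) (h14 : s.mem 14 0 = i) :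
    Ensures I X H (searchCmd (r * r) r) (fun σ =>
      (((r * r : ℕ) : ℝ) - r) * σ.mem 15 0 ≤ D * I.mms i n ∧
      (1 - 2 / (r : ℝ)) * (D * I.mms i n) ≤ ((r * r : ℕ) + (r : ℝ)) * σ.mem 15 0 ∧
      σ.mem 15 0 ≤ C i + ∑ g ∈ Finset.range m, U i g) s := by
  have hD' : (0 : ℝ) < D := Nat.cast_pos.2 hD
  have hr' : (2 : ℝ) ≤ r := by exact_mod_cast hr
  have hMM := mul_nonneg hD'.le (I.mms_nonneg i)
  set T := C i + ∑ g ∈ Finset.range m, U i g with hT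
  refine ensures_seq (ensures_set (fun _ => ?_) ?_)
  · rw [henv.val_cake (by simp [h14])]
    simp only [Expr.val_get, Expr.val_zero, h14]
    exact (Nat.le_add_right _ _).trans hXU
  rw [henv.val_cake (by simp [h14])]
  simp only [Expr.val_get, Expr.val_zero, h14]
  refine ensures_seq (ensures_for (fun k σ => σ.mem 15 0 = C i + ∑ g ∈ Finset.range k, U i g) m
    (by omega) (by omega) (by simp [Cmd.writes]) (fun σ hσ => ?_) (fun t σ j h => by simpa)
    (by simp) (fun k hk σ hσ h19 hinv => ?_) (fun s₁ hs₁ h15 => ?_))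
  · rw [Expr.val_get, Expr.val_one, hσ.1 0 (by simp [Cmd.writes]),
      State.setMem_mem_ne _ (by decide), henv.items]
  · have f : ∀ a, a ≠ 15 → a ≠ 19 → σ.mem a = s.mem a := fun a h1 h2 => by
      rw [hσ.1 a (by simp [Cmd.writes, h1, h2]), State.setMem_mem_ne _ h1]
    have henvσ : Env n m D U C σ := henv.congr (by
      intro a ha; exact f a (by rintro rfl; simp at ha) (by rintro rfl; simp at ha))
    have k14 : σ.mem 14 0 = i := by rw [f 14 (by decide) (by decide), h14]
    have hval : (Expr.var 15 + Expr.good (.var 14) (.var 19)).val σ =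
        C i + ∑ g ∈ Finset.range (k + 1), U i g := by
      rw [Expr.val_add, henvσ.val_good (by simp [k14]) (by simpa [h19] using hk)]
      simp only [Expr.val_get, Expr.val_zero, k14, h19, hinv]
      rw [Finset.sum_range_succ, add_assoc]
    refine ensures_set (fun _ => ?_) ?_
    · rw [hval]
      exact (Nat.add_le_add_left (Finset.sum_le_sum_of_subset (Finset.range_mono hk)) _).trans hXU
    · rw [hval]
      simp
  have f : ∀ a, a ≠ 15 → a ≠ 19 → s₁.mem a = s.mem a := fun a h1 h2 => by
    rw [hs₁.1 a (by simp [Cmd.writes, h1, h2]), State.setMem_mem_ne _ h1]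
  have henv₁ : Env n m D U C s₁ := henv.congr (by
    intro a ha; exact f a (by rintro rfl; simp at ha) (by rintro rfl; simp at ha))
  have hpow₁ : Powers n (r * r) s₁ := hpow.congr (f 12 (by decide) (by decide))
    (f 13 (by decide) (by decide))
  have k14 : s₁.mem 14 0 = i := by rw [f 14 (by decide) (by decide), h14]
  clear f
  rw [← hT] at h15
  refine ensures_seq (ensures_set (fun _ => by simp) ?_)
  simp only [Expr.val_zero]
  set s₂ := s₁.setMem 16 0 0 with hs₂
  refine ensures_loop (fun k σ => σ.mem 16 0 ≤ 1 ∧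
      (σ.mem 16 0 ≠ 0 → Accepts n m (r * r) r (σ.mem 15 0) (C i) (U i)) ∧
      (1 - 2 / (r : ℝ)) * (D * I.mms i n) ≤ ((r * r : ℕ) + (r : ℝ)) * σ.mem 15 0 ∧
      σ.mem 15 0 ≤ T ∧
      (σ.mem 16 0 = 0 → r ^ k * σ.mem 15 0 ≤ (r - 1) ^ k * T)) (r * T.size) hHT
    ⟨by simp [hs₂], by simp [hs₂], ?_, by simp [hs₂, h15], by simp [hs₂, h15]⟩ ?_ ?_ ?_
  · have h1 : s₂.mem 15 0 = T := by simp [hs₂, h15]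
    have h2 : (D : ℝ) * I.mms i n ≤ T := by
      rw [hT, Finset.sum_range]
      push_cast
      rw [hC, Finset.sum_congr rfl fun g _ => hU g, ← Finset.mul_sum, ← mul_add]
      gcongr
      rw [add_comm]
      exact I.mms_le_total i
    have h3 : (0 : ℝ) ≤ 2 / r := by positivity
    have h4 : (0 : ℝ) ≤ T := Nat.cast_nonneg _
    have h5 : (0 : ℝ) ≤ (r * r : ℕ) := Nat.cast_nonneg _
    rw [h1]
    nlinarith
  · rintro σ hσ ⟨h1, -, -, -, h5⟩
    by_cases hflag : σ.mem 16 0 = 0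
    · have h6 := (h5 hflag).trans_lt (pow_mul_lt r T (by omega))
      have h7 : σ.mem 15 0 = 0 := by
        by_contra hne
        exact absurd (Nat.le_mul_of_pos_right _ (Nat.pos_of_ne_zero hne)) (not_le.2 h6)
      simp [h7]
    · have : σ.mem 16 0 = 1 := by omega
      simp [this]
  · rintro k hk σ hσ ⟨h1, h2, h3, h4, h5⟩ htest
    have hw : 0 < σ.mem 15 0 := Nat.pos_of_ne_zero fun h => by simp [h] at htest
    have hflag : σ.mem 16 0 = 0 := by
      by_contra hne
      have : σ.mem 16 0 = 1 := by omega
      simp [this] at htest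
    have f : ∀ a, a ∉ [15, 16, 17, 18, 19, 20, 21, 22, 24] → σ.mem a = s₁.mem a := fun a ha => by
      rw [hσ.1 a (by simp at ha; simp [Cmd.writes, decideCmd_writes, ha]),
        State.setMem_mem_ne _ (by rintro rfl; simp at ha)]
    have henvσ : Env n m D U C σ := henv₁.congr (by
      intro a ha
      exact f a (by simp only [List.mem_cons, List.not_mem_nil, or_false] at ha ⊢; omega))
    have hpowσ : Powers n (r * r) σ := hpow₁.congr (f 12 (by decide)) (f 13 (by decide))
    refine ensures_seq ((ensures_decideCmd hX hXU hH (by omega) i.2 henvσ hpowσ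
      (by rw [f 14 (by decide), k14]) rfl).mono ?_)
    rintro τ hτ ⟨t1, t2⟩
    have t15 : τ.mem 15 0 = σ.mem 15 0 := by rw [hτ.1 15 (by simp [decideCmd_writes])]
    refine ensures_ite (fun hacc => ensures_skip ?_) (fun hacc => ensures_set (fun _ => ?_) ?_)
    · simp only [Expr.val_get, Expr.val_zero] at hacc
      rw [t15]
      exact ⟨t1, fun _ => t2.1 hacc, h3, h4, fun h => absurd h hacc⟩
    · simp only [Expr.val_sub, Expr.val_get, Expr.val_zero, t15]
      exact (Nat.sub_le _ _).trans (h4.trans hXU)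
    · simp only [Expr.val_get, Expr.val_zero] at hacc
      simp only [Expr.val_sub, Expr.val_add, Expr.val_div, Expr.val_get, Expr.val_zero,
        Expr.val_one, Expr.val_lit, t15, State.setMem_mem_same, Function.update_self,
        State.setMem_mem_ne _ (show 16 ≠ 15 by decide), hacc]
      set w := σ.mem 15 0
      have hrej : ¬ Accepts n m (r * r) r w (C i) (U i) := fun h => t2.2 h hacc
      have hle := Instance.mms_le_add_mul hD' hU hC hw (by omega) hrej
      have hdiv := Nat.div_add_mod w r
      have hmod := Nat.mod_lt w (show 0 < r by omega)
      refine ⟨by omega, by simp, ?_, (Nat.sub_le _ _).trans h4, fun _ => ?_⟩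
      · rcases eq_or_lt_of_le (I.mms_nonneg i) with hz | hpos
        · rw [← hz, mul_zero, mul_zero]
          positivity
        · have h6 := (hM hpos).trans hle
          have hQ : (0 : ℝ) < (r * r : ℕ) + (r : ℝ) := by positivity
          -- `w ≥ r`, so that the reduction by `w / r + 1` is at most `2 * w / r`
          have h7 : (r : ℝ) ≤ w := le_of_mul_le_mul_left h6 hQ
          have h8 : (w : ℝ) - ((w / r : ℕ) + 1) ≤ ((w - (w / r + 1) : ℕ) : ℝ) := by
            have : (w : ℝ) ≤ ((w - (w / r + 1) : ℕ) : ℝ) + ((w / r + 1 : ℕ) : ℝ) := by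
              exact_mod_cast (show w ≤ w - (w / r + 1) + (w / r + 1) by omega)
            push_cast at this ⊢
            linarith
          have h9 : ((w / r : ℕ) : ℝ) ≤ w / r := Nat.cast_div_le
          have h10 : (1 : ℝ) ≤ w / r := by rw [le_div_iff₀ (by linarith)]; linarith
          have h11 : (1 - 2 / (r : ℝ)) * w ≤ ((w - (w / r + 1) : ℕ) : ℝ) := by
            have : (1 - 2 / (r : ℝ)) * w = w - 2 * (w / r) := by ring
            linarith
          have h12 : (0 : ℝ) ≤ 1 - 2 / r := by
            rw [sub_nonneg, div_le_one (by linarith)]; exact hr'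
          calc (1 - 2 / (r : ℝ)) * (D * I.mms i n)
              ≤ (1 - 2 / (r : ℝ)) * (((r * r : ℕ) + (r : ℝ)) * w) := by gcongr
            _ = ((r * r : ℕ) + (r : ℝ)) * ((1 - 2 / (r : ℝ)) * w) := by ring
            _ ≤ _ := by gcongr
      · have h6 : r * (w - (w / r + 1)) ≤ (r - 1) * w := by
          rw [Nat.mul_sub, Nat.sub_mul, one_mul]
          have : w ≤ r * (w / r + 1) := by rw [mul_add]; omega
          omega
        calc r ^ (k + 1) * (w - (w / r + 1)) = r ^ k * (r * (w - (w / r + 1))) := by ring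
          _ ≤ r ^ k * ((r - 1) * w) := by gcongr
          _ = (r - 1) * (r ^ k * w) := by ring
          _ ≤ (r - 1) * ((r - 1) ^ k * T) := Nat.mul_le_mul_left _ (h5 hflag)
          _ = (r - 1) ^ (k + 1) * T := by ring
  · rintro k σ hσ ⟨h1, h2, h3, h4, -⟩ htest
    refine ⟨?_, h3, h4⟩
    by_cases hw : σ.mem 15 0 = 0
    · rw [hw]; simpa using hMM
    · have hflag : σ.mem 16 0 ≠ 0 := by
        intro h0
        simp [h0, hw] at htest
      exact Instance.sub_mul_le_mms hD' hU hC (Nat.pos_of_ne_zero hw) (h2 hflag)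

/-- Compute the target of agent (variable `14`) from her unit (variable `15`), and adapt the ratio
in array `6`. Variable `25` is the approximate maximin share. -/
def targetCmd (Q r : ℕ) : Cmd :=
  .seq (.set 25 0 (.lit (Q - r) * .var 15))
  (.ite ((.agents - 1) * .var 25 - .cake (.var 14))
    (.seq (.set 23 (.var 14)
      (((.agents - 1) * .var 25 + .cake (.var 14)) / (2 * (.agents - 1))))
    (.ite (.get 6 0 * (2 * ((.agents - 1) * .var 25)) -
        ((.agents - 1) * .var 25 + .cake (.var 14)) * .get 6 1)
      (.seq (.set 6 0 ((.agents - 1) * .var 25 + .cake (.var 14)))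
        (.set 6 1 (2 * ((.agents - 1) * .var 25)))) .skip))
    (.set 23 (.var 14) (.var 25)))

/-- Compute all targets and the ratio. -/
def targetsCmd (Q r : ℕ) : Cmd :=
  .seq (.set 6 0 1) (.seq (.set 6 1 1)
    (.for 14 .agents (.seq (searchCmd Q r) (targetCmd Q r))))

/-- `a` is a suitable target of agent `i`, in utilities scaled by `D`, when the ratio is `β`. -/
structure IsTarget (I : Instance n m) (D r : ℕ) (i : Fin n) (a : ℕ) (β : ℝ) : Prop where
  le_mms : (a : ℝ) ≤ D * I.mms i n
  le_cake : ((n : ℝ) - 1) * (2 * a - D * I.mms i n) ≤ D * I.wholeCake i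
  ratio_le : (1 - 5 / (r : ℝ)) * (β * (D * I.mms i n)) ≤ a

theorem IsTarget.mono {D : ℕ} {i : Fin n} {a : ℕ} {β β' : ℝ} (h : IsTarget I D r i a β)
    (hr : 5 ≤ r) (hβ : β' ≤ β) : IsTarget I D r i a β' := by
  refine ⟨h.le_mms, h.le_cake, le_trans ?_ h.ratio_le⟩
  have h1 : (5 : ℝ) ≤ r := by exact_mod_cast hr
  have h2 : (0 : ℝ) ≤ 1 - 5 / r := by rw [sub_nonneg, div_le_one (by linarith)]; exact h1
  have h3 := I.mms_nonneg i
  gcongr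

/-- The approximate maximin share found by the search is almost as large as the exact one. -/
theorem mul_le_of_search {M : ℝ} {w : ℕ} (hr : 5 ≤ r) (hM : 0 ≤ M)
    (h : (1 - 2 / (r : ℝ)) * M ≤ ((r * r : ℕ) + (r : ℝ)) * w) :
    (1 - 4 / (r : ℝ)) * M ≤ (((r * r - r) * w : ℕ) : ℝ) := by
  have hr' : (5 : ℝ) ≤ r := by exact_mod_cast hr
  have h0 : (0 : ℝ) < r := by linarith
  rw [Nat.cast_mul, Nat.cast_sub (Nat.le_mul_of_pos_left _ (by omega))]
  push_cast at h ⊢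
  have h1 : ((r : ℝ) - 2) * M ≤ (r * (r * (r + 1))) * w := by
    have := mul_le_mul_of_nonneg_left h h0.le
    rw [← mul_assoc, mul_sub, mul_div_cancel₀ _ h0.ne', mul_one] at this
    linarith
  have h2 : ((r : ℝ) - 4) * (r + 1) * M ≤ (r * (r * (r - 1)) * w) * (r + 1) := by
    have h3 : ((r : ℝ) - 4) * (r + 1) * M ≤ (r - 1) * ((r - 2) * M) := by nlinarith
    have h4 := mul_le_mul_of_nonneg_left h1 (show (0 : ℝ) ≤ r - 1 by linarith)
    linarith
  have h5 : ((r : ℝ) - 4) * M ≤ r * (r * (r - 1)) * w := by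
    refine le_of_mul_le_mul_right ?_ (show (0 : ℝ) < r + 1 by linarith)
    linarith
  refine le_of_mul_le_mul_left ?_ h0
  have h6 : (r : ℝ) * ((1 - 4 / r) * M) = (r - 4) * M := by field_simp
  rw [h6]
  linarith

theorem isTarget_large {i : Fin n} {D L c : ℕ} {β : ℝ} (hr : 5 ≤ r)
    (hC : (c : ℝ) = D * I.wholeCake i) (hL : (L : ℝ) ≤ D * I.mms i n)
    (hL' : (1 - 4 / (r : ℝ)) * (D * I.mms i n) ≤ L) (hβ : β ≤ 1) (hc : (n - 1) * L ≤ c) :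
    IsTarget I D r i L β := by
  have hMM := mul_nonneg (Nat.cast_nonneg (α := ℝ) D) (I.mms_nonneg i)
  refine IsTarget.mono (β := 1) ⟨hL, ?_, ?_⟩ hr hβ
  · have h1 : ((n : ℝ) - 1) * L ≤ c := by
      have : (((n - 1) * L : ℕ) : ℝ) ≤ c := Nat.cast_le.2 hc
      rwa [Nat.cast_mul, Nat.cast_pred (Fin.pos i)] at this
    have h2 : (0 : ℝ) ≤ n - 1 := by
      rw [sub_nonneg]; exact_mod_cast Fin.pos i
    rw [← hC]
    nlinarith
  · have : (1 - 5 / (r : ℝ)) * (1 * (D * I.mms i n)) ≤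
        (1 - 4 / (r : ℝ)) * (D * I.mms i n) := by
      rw [one_mul]; gcongr; norm_num
    linarith

theorem isTarget_small {i : Fin n} {D L c : ℕ} (hr : 5 ≤ r) (hD : 0 < D)
    (hC : (c : ℝ) = D * I.wholeCake i) (hL : (L : ℝ) ≤ D * I.mms i n)
    (hL' : (1 - 4 / (r : ℝ)) * (D * I.mms i n) ≤ L) (hLr : 0 < L → 2 * r ≤ L)
    (hc : c < (n - 1) * L) :
    IsTarget I D r i (((n - 1) * L + c) / (2 * (n - 1)))
      ((((n - 1) * L + c : ℕ) : ℝ) / ((2 * ((n - 1) * L) : ℕ) : ℝ)) ∧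
    I.alpha ≤ (((n - 1) * L + c : ℕ) : ℝ) / ((2 * ((n - 1) * L) : ℕ) : ℝ) := by
  have hMM := mul_nonneg (Nat.cast_nonneg (α := ℝ) D) (I.mms_nonneg i)
  have hD' : (0 : ℝ) < D := Nat.cast_pos.2 hD
  have hr' : (5 : ℝ) ≤ r := by exact_mod_cast hr
  have hN : 0 < n - 1 := Nat.pos_of_ne_zero fun h => by simp [h] at hc
  have hL0 : 0 < L := Nat.pos_of_ne_zero fun h => by simp [h] at hc
  have hNn : (n : ℝ) - 1 = (n - 1 : ℕ) := (Nat.cast_pred (Fin.pos i)).symm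
  set N := n - 1
  have hN' : (0 : ℝ) < N := Nat.cast_pos.2 hN
  have hL0' : (0 : ℝ) < L := Nat.cast_pos.2 hL0
  have hc' : (c : ℝ) < N * L := by exact_mod_cast hc
  have hLr' : 2 * (r : ℝ) ≤ L := by exact_mod_cast hLr hL0
  have hc0 : (0 : ℝ) ≤ c := Nat.cast_nonneg _
  have ha : ((((N * L + c) / (2 * N) : ℕ)) : ℝ) ≤ (N * L + c) / (2 * N) := by
    have := Nat.cast_div_le (α := ℝ) (m := N * L + c) (n := 2 * N)
    push_cast at this
    exact this
  have ha' : ((N : ℝ) * L + c) / (2 * N) - 1 ≤ (((N * L + c) / (2 * N) : ℕ) : ℝ) := by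
    have h1 := Nat.lt_mul_div_succ (N * L + c) (show 0 < 2 * N by omega)
    have h2 : ((N * L + c : ℕ) : ℝ) < ((2 * N * ((N * L + c) / (2 * N) + 1) : ℕ) : ℝ) :=
      Nat.cast_lt.2 h1
    rw [Nat.cast_mul, Nat.cast_add ((N * L + c) / (2 * N))] at h2
    rw [sub_le_iff_le_add, div_le_iff₀ (by positivity)]
    push_cast at h2 ⊢
    linarith
  have hb : ((N : ℝ) * L + c) / (2 * N) * (2 * N) = N * L + c :=
    div_mul_cancel₀ _ (by positivity)
  set b : ℝ := (N * L + c) / (2 * N) with hbdef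
  set a := (N * L + c) / (2 * N)
  have hβ : (((N * L + c : ℕ) : ℝ) / ((2 * (N * L) : ℕ) : ℝ)) * L = b := by
    rw [hbdef]; push_cast; field_simp
  set β : ℝ := ((N * L + c : ℕ) : ℝ) / ((2 * (N * L) : ℕ) : ℝ) with hβdef
  have hβ0 : 0 ≤ β := by positivity
  have hbL : b ≤ L := by
    rw [hbdef, div_le_iff₀ (by positivity)]; linarith
  have hbL2 : (L : ℝ) / 2 ≤ b := by
    rw [hbdef, div_le_div_iff₀ (by norm_num) (by positivity)]; linarith
  refine ⟨⟨by linarith, ?_, ?_⟩, ?_⟩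
  · rw [← hC, hNn]
    have h1 : (N : ℝ) * (2 * a) ≤ N * L + c := by
      have := mul_le_mul_of_nonneg_right ha (show (0 : ℝ) ≤ 2 * N by positivity)
      linarith
    have h2 : (N : ℝ) * L ≤ N * (D * I.mms i n) := by gcongr
    linarith
  · have h1 : (1 - 1 / (r : ℝ)) * b ≤ a := by
      have : 1 ≤ b / r := by rw [le_div_iff₀ (by linarith)]; linarith
      have h2 : (1 - 1 / (r : ℝ)) * b = b - b / r := by ring
      linarith
    have h3 : (0 : ℝ) ≤ 1 - 1 / r := by
      rw [sub_nonneg, div_le_one (by linarith)]; linarith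
    calc (1 - 5 / (r : ℝ)) * (β * (D * I.mms i n))
        ≤ ((1 - 1 / (r : ℝ)) * (1 - 4 / r)) * (β * (D * I.mms i n)) := by
          refine mul_le_mul_of_nonneg_right ?_ (mul_nonneg hβ0 hMM)
          have : (1 - 1 / (r : ℝ)) * (1 - 4 / r) = 1 - 5 / r + 4 / (r * r) := by
            field_simp; ring
          rw [this]
          have : (0 : ℝ) ≤ 4 / (r * r) := by positivity
          linarith
      _ = (1 - 1 / (r : ℝ)) * (β * ((1 - 4 / r) * (D * I.mms i n))) := by ring
      _ ≤ (1 - 1 / (r : ℝ)) * (β * L) := by gcongr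
      _ = (1 - 1 / (r : ℝ)) * b := by rw [hβ]
      _ ≤ a := h1
  · have hM : 0 < I.mms i n := by
      by_contra hcon
      have : (D : ℝ) * I.mms i n ≤ 0 := mul_nonpos_of_nonneg_of_nonpos hD'.le (not_lt.1 hcon)
      linarith
    have h1 := I.alpha_le i (by rw [hNn]; positivity)
    refine h1.trans ?_
    rw [hNn, hβdef]
    have h2 : I.wholeCake i / (2 * N * I.mms i n) = c / (2 * (N * (D * I.mms i n))) := by
      rw [hC]; field_simp
    have h3 : (((N * L + c : ℕ) : ℝ) / ((2 * (N * L) : ℕ) : ℝ)) =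
        1 / 2 + c / (2 * (N * L)) := by
      push_cast; field_simp
    rw [h2, h3]
    gcongr

theorem ensures_targetCmd {i : Fin n} {D w : ℕ} {U : ℕ → ℕ → ℕ} {C : ℕ → ℕ} {s : State}
    (hr : 5 ≤ r) (hD : 0 < D) (hX : 2 * n * (r * r * w) + C i ≤ X)
    (hC : (C i : ℝ) = D * I.wholeCake i)
    (henv : Env n m D U C s) (h14 : s.mem 14 0 = i) (h15 : s.mem 15 0 = w)
    (hw : (((r * r : ℕ) : ℝ) - r) * w ≤ D * I.mms i n)
    (hw' : (1 - 2 / (r : ℝ)) * (D * I.mms i n) ≤ ((r * r : ℕ) + (r : ℝ)) * w)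
    (h61 : 0 < s.mem 6 1) (hα : I.alpha ≤ (s.mem 6 0 : ℝ) / s.mem 6 1)
    (h1 : (s.mem 6 0 : ℝ) / s.mem 6 1 ≤ 1) :
    Ensures I X H (targetCmd (r * r) r) (fun σ => 0 < σ.mem 6 1 ∧
      I.alpha ≤ (σ.mem 6 0 : ℝ) / σ.mem 6 1 ∧
      (σ.mem 6 0 : ℝ) / σ.mem 6 1 ≤ (s.mem 6 0 : ℝ) / s.mem 6 1 ∧
      IsTarget I D r i (σ.mem 23 i) ((σ.mem 6 0 : ℝ) / σ.mem 6 1) ∧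
      ∀ j, j ≠ i → σ.mem 23 j = s.mem 23 j) s := by
  have hn := Fin.pos i
  set L := (r * r - r) * w with hLdef
  have hLX : 2 * (n * L) + C i ≤ X := by
    have : n * L ≤ n * (r * r * w) :=
      Nat.mul_le_mul_left _ (Nat.mul_le_mul_right _ (Nat.sub_le _ _))
    have : 2 * n * (r * r * w) = 2 * (n * (r * r * w)) := by ring
    omega
  have hNL : (n - 1) * L ≤ n * L := Nat.mul_le_mul_right _ (Nat.sub_le _ _)
  have hLL : L ≤ n * L := Nat.le_mul_of_pos_left _ hn
  have hL : (L : ℝ) ≤ D * I.mms i n := by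
    rw [hLdef, Nat.cast_mul, Nat.cast_sub (Nat.le_mul_of_pos_left _ (by omega))]
    exact hw
  have hL' := mul_le_of_search hr (mul_nonneg (Nat.cast_nonneg (α := ℝ) D) (I.mms_nonneg i)) hw'
  rw [← hLdef] at hL'
  have hLr : 0 < L → 2 * r ≤ L := fun h => by
    have hwp : 0 < w := Nat.pos_of_ne_zero fun h0 => by simp [hLdef, h0] at h
    calc 2 * r ≤ r * r - r := by
          have : 3 * r ≤ r * r := Nat.mul_le_mul_right _ (by omega)
          omega
      _ ≤ L := Nat.le_mul_of_pos_right _ hwp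
  refine ensures_seq (ensures_set (fun _ => ?_) ?_)
  · simp only [Expr.val_mul, Expr.val_lit, Expr.val_get, Expr.val_zero, h15, ← hLdef]
    omega
  simp only [Expr.val_mul, Expr.val_lit, Expr.val_get, Expr.val_zero, h15, ← hLdef]
  set s₁ := s.setMem 25 0 L with hs₁
  have henv₁ : Env n m D U C s₁ := henv.congr (by simp [hs₁])
  have k14 : s₁.mem 14 0 = i := by simp [hs₁, h14]
  have k6 : s₁.mem 6 = s.mem 6 := by simp [hs₁]
  have k25 : s₁.mem 25 0 = L := by simp [hs₁]
  have k23 : s₁.mem 23 = s.mem 23 := by simp [hs₁]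
  have kc : (Expr.cake (.var 14)).val s₁ = C i := by
    rw [henv₁.val_cake (by simp [k14])]
    simp [k14]
  clear_value s₁
  refine ensures_ite (fun htest => ?_) (fun htest => ?_)
  · simp only [Expr.val_sub, Expr.val_mul, Expr.val_get, Expr.val_zero, Expr.val_one, kc,
      henv₁.agents, k25] at htest
    obtain ⟨ht, hα'⟩ := isTarget_small hr hD hC hL hL' hLr (show C i < (n - 1) * L by omega)
    have hval : ((.agents - 1) * .var 25 + .cake (.var 14) : Expr).val s₁ =
        (n - 1) * L + C i := by
      simp only [Expr.val_add, Expr.val_sub, Expr.val_mul, Expr.val_get, Expr.val_zero,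
        Expr.val_one, kc, henv₁.agents, k25]
    refine ensures_seq (ensures_set (fun _ => ?_) ?_)
    · rw [Expr.val_div, hval]
      exact (Nat.div_le_self _ _).trans (by omega)
    rw [Expr.val_div, hval]
    simp only [Expr.val_sub, Expr.val_mul, Expr.val_get, Expr.val_zero, Expr.val_one,
      Expr.val_two, henv₁.agents, k14]
    set a := ((n - 1) * L + C i) / (2 * (n - 1)) with ha
    set s₂ := s₁.setMem 23 i a with hs₂
    have henv₂ : Env n m D U C s₂ := henv₁.congr (by simp [hs₂])
    have l14 : s₂.mem 14 0 = i := by simp [hs₂, k14]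
    have l6 : s₂.mem 6 = s.mem 6 := by simp [hs₂, k6]
    have l25 : s₂.mem 25 0 = L := by simp [hs₂, k25]
    have l23 : s₂.mem 23 i = a := by simp [hs₂]
    have l23' : ∀ j, j ≠ i → s₂.mem 23 j = s.mem 23 j := fun j hj => by
      simp [hs₂, Fin.val_ne_of_ne hj, k23]
    have lc : (Expr.cake (.var 14)).val s₂ = C i := by
      rw [henv₂.val_cake (by simp [l14])]
      simp [l14]
    clear_value s₂
    have hden : 0 < 2 * ((n - 1) * L) := by omega
    refine ensures_ite (fun htest₂ => ?_) (fun htest₂ => ensures_skip ?_)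
    · simp only [Expr.val_sub, Expr.val_add, Expr.val_mul, Expr.val_get, Expr.val_zero,
        Expr.val_one, Expr.val_two, lc, henv₂.agents, l25, l6] at htest₂
      refine ensures_seq (ensures_set (fun _ => ?_) ?_)
      · simp only [Expr.val_sub, Expr.val_add, Expr.val_mul, Expr.val_get, Expr.val_zero,
          Expr.val_one, lc, henv₂.agents, l25]
        omega
      simp only [Expr.val_sub, Expr.val_add, Expr.val_mul, Expr.val_get, Expr.val_zero,
          Expr.val_one, lc, henv₂.agents, l25]
      refine ensures_set (fun _ => ?_) ?_
      · simp only [Expr.val_sub, Expr.val_mul, Expr.val_get, Expr.val_zero, Expr.val_one,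
          Expr.val_two, henv₂.agents, l25, State.setMem_mem_ne _ (show 0 ≠ 6 by decide),
          State.setMem_mem_ne _ (show 25 ≠ 6 by decide)]
        omega
      simp only [Expr.val_sub, Expr.val_mul, Expr.val_get, Expr.val_zero, Expr.val_one,
          Expr.val_two, henv₂.agents, l25, State.setMem_mem_ne _ (show 0 ≠ 6 by decide),
          State.setMem_mem_ne _ (show 25 ≠ 6 by decide), State.setMem_mem_same,
          State.setMem_mem_ne _ (show 23 ≠ 6 by decide), Function.update_self,
          Function.update_of_ne (show (0 : ℕ) ≠ 1 by decide), l23]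
      refine ⟨hden, hα', ?_, ht, l23'⟩
      rw [div_le_div_iff₀ (by exact_mod_cast hden) (by exact_mod_cast h61)]
      exact_mod_cast (show ((n - 1) * L + C i) * s.mem 6 1 ≤
        s.mem 6 0 * (2 * ((n - 1) * L)) by omega)
    · simp only [Expr.val_sub, Expr.val_add, Expr.val_mul, Expr.val_get, Expr.val_zero,
        Expr.val_one, Expr.val_two, lc, henv₂.agents, l25, l6] at htest₂
      rw [l6, l23]
      refine ⟨h61, hα, le_rfl, ht.mono hr ?_, l23'⟩
      rw [div_le_div_iff₀ (by exact_mod_cast h61) (by exact_mod_cast hden)]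
      exact_mod_cast (show s.mem 6 0 * (2 * ((n - 1) * L)) ≤
        ((n - 1) * L + C i) * s.mem 6 1 by omega)
  · simp only [Expr.val_sub, Expr.val_mul, Expr.val_get, Expr.val_zero, Expr.val_one, kc,
      henv₁.agents, k25] at htest
    refine ensures_set (fun _ => ?_) ?_
    · simp only [Expr.val_get, Expr.val_zero, k25]
      omega
    simp only [Expr.val_get, Expr.val_zero, k14, k25, State.setMem_mem_same, Function.update_self,
      State.setMem_mem_ne _ (show 6 ≠ 23 by decide), k6]
    refine ⟨h61, hα, le_rfl, isTarget_large hr hC hL hL' h1 (by omega), fun j hj => ?_⟩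
    rw [Function.update_of_ne (Fin.val_ne_of_ne hj), k23]

theorem ensures_targetsCmd {D T : ℕ} {U : ℕ → ℕ → ℕ} {C : ℕ → ℕ} {s : State} (hr : 5 ≤ r)
    (hX : (n + 1) ^ (r * r + 1) + n * (r * r) + r * r + n + m + 1 ≤ X)
    (hXT : 2 * n * (r * r * T) + T ≤ X)
    (hT : ∀ i < n, C i + ∑ g ∈ Finset.range m, U i g ≤ T)
    (hH : (n + 1) ^ (r * r + 1) + r * r + n + m ≤ H) (hHT : r * T.size ≤ H) (hD : 0 < D)
    (hU : ∀ (i : Fin n) (g : Fin m), (U i g : ℝ) = D * I.good i g)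
    (hC : ∀ i : Fin n, (C i : ℝ) = D * I.wholeCake i)
    (hM : ∀ i, 0 < I.mms i n → ((r * r : ℕ) + (r : ℝ)) * r ≤ D * I.mms i n)
    (henv : Env n m D U C s) (hpow : Powers n (r * r) s) :
    Ensures I X H (targetsCmd (r * r) r) (fun σ => 0 < σ.mem 6 1 ∧
      I.alpha ≤ (σ.mem 6 0 : ℝ) / σ.mem 6 1 ∧ (σ.mem 6 0 : ℝ) / σ.mem 6 1 ≤ 1 ∧
      ∀ i : Fin n, IsTarget I D r i (σ.mem 23 i) ((σ.mem 6 0 : ℝ) / σ.mem 6 1)) s := by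
  refine ensures_seq (ensures_set (fun _ => by simp; omega) (ensures_seq (ensures_set
    (fun _ => by simp; omega) ?_)))
  simp only [Expr.val_zero, Expr.val_one]
  set s₁ := (s.setMem 6 0 1).setMem 6 1 1 with hs₁
  have henv₁ : Env n m D U C s₁ := henv.congr (by simp [hs₁])
  have hpow₁ : Powers n (r * r) s₁ := hpow.congr (by simp [hs₁]) (by simp [hs₁])
  have k60 : s₁.mem 6 0 = 1 := by simp [hs₁]
  have k61 : s₁.mem 6 1 = 1 := by simp [hs₁]
  clear_value s₁
  refine ensures_for (fun k σ => 0 < σ.mem 6 1 ∧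
      I.alpha ≤ (σ.mem 6 0 : ℝ) / σ.mem 6 1 ∧ (σ.mem 6 0 : ℝ) / σ.mem 6 1 ≤ 1 ∧
      ∀ i : Fin n, (i : ℕ) < k → IsTarget I D r i (σ.mem 23 i) ((σ.mem 6 0 : ℝ) / σ.mem 6 1)) n
    (by omega) (by omega) (by simp [Cmd.writes, searchCmd, decideCmd_writes, targetCmd])
    (fun σ hσ => ?_) (fun k σ j h => by simpa) ?_ ?_ ?_
  · rw [Expr.val_get, Expr.val_zero,
      hσ.1 0 (by simp [Cmd.writes, searchCmd, decideCmd_writes, targetCmd]), henv₁.agents]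
  · rw [k60, k61]
    refine ⟨one_pos, ?_, ?_, fun i hi => absurd hi (Nat.not_lt_zero _)⟩
    · simpa using I.alpha_le_one
    · simp
  · rintro k hk σ hσ h14 ⟨h1, h2, h3, h4⟩
    have f : ∀ a, a ∈ [0, 1, 2, 3, 4, 10, 12, 13] → σ.mem a = s₁.mem a := fun a ha =>
      hσ.1 a (by
        simp only [List.mem_cons, List.not_mem_nil, or_false] at ha
        simp [Cmd.writes, searchCmd, decideCmd_writes, targetCmd]
        omega)
    have henvσ : Env n m D U C σ := henv₁.congr (by
      intro a ha
      exact f a (by simp only [List.mem_cons, List.not_mem_nil, or_false] at ha ⊢; omega))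
    have hpowσ : Powers n (r * r) σ := hpow₁.congr (f 12 (by decide)) (f 13 (by decide))
    have hTk := hT k hk
    have hTX : T ≤ X := by omega
    have hsize : r * (C k + ∑ g ∈ Finset.range m, U k g).size ≤ H :=
      (Nat.mul_le_mul_left _ (Nat.size_le_size hTk)).trans hHT
    refine ensures_seq ((ensures_searchCmd (i := ⟨k, hk⟩) (D := D) (U := U) (C := C) (by omega)
      (hTk.trans hTX) (by omega) hsize (by omega) hD (hU _) (hC _) (hM _) henvσ hpowσ h14).mono ?_)
    rintro τ hτ ⟨t1, t2, t3⟩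
    have g : ∀ a, a ∉ [15, 16, 17, 18, 19, 20, 21, 22, 24] → τ.mem a = σ.mem a := fun a ha =>
      hτ.1 a (by simp at ha; simp [Cmd.writes, searchCmd, decideCmd_writes, ha])
    have henvτ : Env n m D U C τ := henvσ.congr (by
      intro a ha
      exact g a (by simp only [List.mem_cons, List.not_mem_nil, or_false] at ha ⊢; omega))
    have g6 := g 6 (by decide)
    refine (ensures_targetCmd (i := ⟨k, hk⟩) (w := τ.mem 15 0) hr hD ?_ (hC _) henvτ
      (by rw [g 14 (by decide), h14]) rfl t1 t2 (by rw [g6]; exact h1) (by rw [g6]; exact h2)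
      (by rw [g6]; exact h3)).mono ?_
    · refine le_trans (Nat.add_le_add (Nat.mul_le_mul_left _ (Nat.mul_le_mul_left _
        (t3.trans hTk))) ((Nat.le_add_right _ _).trans hTk)) hXT
    · rintro υ hυ ⟨u1, u2, u3, u4, u5⟩
      rw [g6] at u3
      refine ⟨u1, u2, u3.trans h3, fun i hi => ?_⟩
      rcases Nat.lt_succ_iff_lt_or_eq.1 hi with hi | hi
      · rw [u5 i (fun h => by simp [h] at hi), g 23 (by decide)]
        exact (h4 i hi).mono hr u3
      · obtain rfl : i = ⟨k, hk⟩ := Fin.ext hi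
        exact u4
  · rintro σ _ ⟨h1, h2, h3, h4⟩
    exact ⟨h1, h2, h3, fun i => h4 i i.2⟩

end

end MixedGoods

/-! ### The program that allocates goods and cake -/

namespace MixedGoods

/-- The agents not served yet, given array `30`. -/
def actOf {n : ℕ} (f : ℕ → ℕ) : Finset (Fin n) := {i | f i = 0}

/-- The goods not given away, given array `31`. -/
def poolOf {m : ℕ} (f : ℕ → ℕ) : Finset (Fin m) := {g | f g ≠ 1}

/-- The goods in the bag, given array `31`. -/
def bagOf {m : ℕ} (f : ℕ → ℕ) : Finset (Fin m) := {g | f g - 1 ≠ 0}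

theorem mem_actOf {n : ℕ} {f : ℕ → ℕ} {i : Fin n} : i ∈ actOf f ↔ f i = 0 := by simp [actOf]

theorem mem_poolOf {m : ℕ} {f : ℕ → ℕ} {g : Fin m} : g ∈ poolOf f ↔ f g ≠ 1 := by simp [poolOf]

theorem mem_bagOf {m : ℕ} {f : ℕ → ℕ} {g : Fin m} : g ∈ bagOf f ↔ f g - 1 ≠ 0 := by
  simp only [bagOf, Finset.mem_filter, Finset.mem_univ, true_and]

theorem actOf_update {n : ℕ} (f : ℕ → ℕ) (i : Fin n) :
    actOf (Function.update f i 1) = (actOf f).erase i := by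
  ext j
  rw [Finset.mem_erase, mem_actOf, mem_actOf]
  by_cases h : j = i
  · simp [h]
  · simp [h, Fin.val_ne_of_ne h]

theorem poolOf_update {m : ℕ} (f : ℕ → ℕ) (g : Fin m) :
    poolOf (Function.update f g 1) = (poolOf f).erase g := by
  ext j
  rw [Finset.mem_erase, mem_poolOf, mem_poolOf]
  by_cases h : j = g
  · simp [h]
  · simp [h, Fin.val_ne_of_ne h]

/-- Give every good that is large for an unserved agent to such an agent. One pass suffices: the sets
of unserved agents and of remaining goods only shrink. -/
def singlesCmd : Cmd :=
  .for 19 .items (.for 14 .agents (.ite (.get 30 (.var 14)) .skip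
    (.ite (.get 31 (.var 19)) .skip
      (.ite (.good (.var 14) (.var 19) + 1 - .get 23 (.var 14))
        (.seq (.set 5 (.var 19) (.var 14)) (.seq (.set 30 (.var 14) 1) (.set 31 (.var 19) 1)))
        .skip))))

/-- For every unserved agent `i`, put the end of the smallest interval that satisfies her together
with the bag into register `2 + i`. Variable `33` becomes the agent with the leftmost such point,
or `n` if there is none. Register `0` is the left end of the remaining cake. -/
def findCmd : Cmd :=
  .seq (.load (.agents + 2) 1 1) (.seq (.set 33 0 .agents)
  (.for 14 .agents (.ite (.get 30 (.var 14)) .skip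
    (.seq (.set 32 0 0)
    (.seq (.for 19 .items (.ite (.get 31 (.var 19) - 1)
      (.set 32 0 (.var 32 + .good (.var 14) (.var 19))) .skip))
    (.seq (.load 1 (.get 23 (.var 14) - .var 32) (.var 10))
    (.seq (.cutQ (.var 14 + 2) (.var 14) 0 1)
    (.seq (.cmp 34 0 (.var 14 + 2) (.var 33 + 2))
    (.ite (.var 34) (.set 33 0 (.var 14)) .skip)))))))))

/-- Serve the agent in variable `33` with the bag and cake. Real registers cannot be copied, but a cut
query with value `0` has its starting point as answer; this moves register `0`. -/
def serveCmd : Cmd :=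
  .ite (.agents - .var 33)
    (.seq (.give (.var 33) 0 (.var 33 + 2))
    (.seq (.load 1 0 1)
    (.seq (.cutQ 0 (.var 33) (.var 33 + 2) 1)
    (.seq (.set 30 (.var 33) 1)
    (.for 19 .items (.ite (.get 31 (.var 19) - 1)
      (.seq (.set 5 (.var 19) (.var 33)) (.set 31 (.var 19) 1)) .skip))))))
    .skip

/-- Serve agents as long as somebody can be satisfied with the bag and cake; `n` rounds suffice. -/
def roundsCmd : Cmd := .for 35 .agents (.seq findCmd serveCmd)

/-- Allocate everything, given the targets in array `23`. -/
def allocateCmd : Cmd :=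
  .seq singlesCmd (.seq (.load 0 0 1) (.seq roundsCmd
  (.seq (.for 36 .items (.seq (.ite (.get 31 (.var 36)) .skip (.set 31 (.var 36) 2)) roundsCmd))
  (.seq (.load 1 1 1) (.give 0 0 1)))))

section

variable {n m : ℕ} {I : Instance n m} {X H D : ℕ} {U : ℕ → ℕ → ℕ} {C A : ℕ → ℕ}

/-- Machine states in which agents are still served with single goods. -/
structure SinglesInv (I : Instance n m) (a : Fin n → ℝ) (s : State) : Prop where
  singles : Singles I a (actOf (s.mem 30)) (poolOf (s.mem 31)) fun g => s.mem 5 g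
  bag : ∀ g, s.mem 31 g ≤ 1

theorem SinglesInv.congr {a : Fin n → ℝ} {s σ : State} (h : SinglesInv I a s)
    (h5 : σ.mem 5 = s.mem 5) (h30 : σ.mem 30 = s.mem 30) (h31 : σ.mem 31 = s.mem 31) :
    SinglesInv I a σ :=
  ⟨by rw [h5, h30, h31]; exact h.singles, by rw [h31]; exact h.bag⟩

/-- After the first phase, all goods left are small for all agents left. -/
theorem ensures_singlesCmd {s : State} (hnX : n + m + 1 ≤ X) (hH : n + m ≤ H) (hD : 0 < D)
    (hU : ∀ (i : Fin n) (g : Fin m), (U i g : ℝ) = D * I.good i g)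
    (henv : Env n m D U C s) (hA : ∀ i : Fin n, s.mem 23 i = A i)
    (h : SinglesInv I (fun i => (A i : ℝ) / D) s) :
    Ensures I X H singlesCmd (fun σ => SinglesInv I (fun i => (A i : ℝ) / D) σ ∧
      ∀ i ∈ actOf (σ.mem 30), ∀ g ∈ poolOf (σ.mem 31), I.good i g < (A i : ℝ) / D) s := by
  have hD' : (0 : ℝ) < D := Nat.cast_pos.2 hD
  have hlt : ∀ (i : Fin n) (g : Fin m), I.good i g < (A i : ℝ) / D ↔ U i g < A i := by
    intro i g
    rw [lt_div_iff₀ hD', mul_comm, ← hU, Nat.cast_lt]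
  refine ensures_for (fun k σ => SinglesInv I (fun i => (A i : ℝ) / D) σ ∧
      ∀ i ∈ actOf (σ.mem 30), ∀ g ∈ poolOf (σ.mem 31), (g : ℕ) < k →
        I.good i g < (A i : ℝ) / D) m (by omega) (by omega) (by simp [Cmd.writes])
    (fun σ hσ => ?_) (fun k σ j hk => ⟨hk.1.congr (by simp) (by simp) (by simp), ?_⟩)
    ⟨h, fun i _ g _ hg => absurd hg (Nat.not_lt_zero _)⟩ ?_
    (fun σ _ hσ => ⟨hσ.1, fun i hi g hg => hσ.2 i hi g hg g.2⟩)
  · rw [Expr.val_get, Expr.val_one, hσ.1 0 (by simp [Cmd.writes]), henv.items]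
  · simpa using hk.2
  rintro k hk σ hσ h19 ⟨hinv, hsmall⟩
  refine ensures_for (fun t τ => SinglesInv I (fun i => (A i : ℝ) / D) τ ∧
      ∀ i ∈ actOf (τ.mem 30), ∀ g ∈ poolOf (τ.mem 31),
        (g : ℕ) < k ∨ (g : ℕ) = k ∧ (i : ℕ) < t → I.good i g < (A i : ℝ) / D) n
    (by omega) (by omega) (by simp [Cmd.writes])
    (fun τ hτ => ?_) (fun k τ j hk => ⟨hk.1.congr (by simp) (by simp) (by simp), ?_⟩)
    ⟨hinv, fun i hi g hg hg' => ?_⟩ ?_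
    (fun τ _ hτ => ⟨hτ.1, fun i hi g hg hg' => hτ.2 i hi g hg ?_⟩)
  · rw [Expr.val_get, Expr.val_zero, hτ.1 0 (by simp [Cmd.writes]),
      hσ.1 0 (by simp [Cmd.writes]), henv.agents]
  · simpa using hk.2
  · rcases hg' with hg' | ⟨-, h0⟩
    · exact hsmall i hi g hg hg'
    · exact absurd h0 (Nat.not_lt_zero _)
  · rintro t ht τ hτ h14 ⟨hinv, hsmall⟩
    have f : ∀ a, a ∉ [5, 14, 19, 30, 31] → τ.mem a = s.mem a := fun a ha => by
      rw [hτ.1 a (by simp at ha; simp [Cmd.writes, ha]),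
        hσ.1 a (by simp at ha; simp [Cmd.writes, ha])]
    have k19 : τ.mem 19 0 = k := by rw [hτ.1 19 (by simp [Cmd.writes]), h19]
    have henvτ : Env n m D U C τ := henv.congr (by
      intro a ha
      exact f a (by simp only [List.mem_cons, List.not_mem_nil, or_false] at ha ⊢; omega))
    have hAτ : τ.mem 23 t = A t := by rw [f 23 (by decide)]; exact hA ⟨t, ht⟩
    have hgood : (Expr.good (.var 14) (.var 19)).val τ = U t k := by
      rw [henvτ.val_good (by simpa [h14] using ht) (by simpa [k19] using hk)]
      simp [h14, k19]
    have split : ∀ {i : Fin n} {g : Fin m}, (g : ℕ) < k ∨ (g : ℕ) = k ∧ (i : ℕ) < t + 1 →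
        ((g : ℕ) < k ∨ (g : ℕ) = k ∧ (i : ℕ) < t) ∨ (g = ⟨k, hk⟩ ∧ i = ⟨t, ht⟩) := by
      rintro i g (h | ⟨h1, h2⟩)
      · exact Or.inl (Or.inl h)
      · rcases Nat.lt_succ_iff_lt_or_eq.1 h2 with h2 | h2
        · exact Or.inl (Or.inr ⟨h1, h2⟩)
        · exact Or.inr ⟨Fin.ext h1, Fin.ext h2⟩
    refine ensures_ite (fun h30 => ensures_skip ⟨hinv, fun i hi g hg hig => ?_⟩) (fun h30 =>
      ensures_ite (fun h31 => ensures_skip ⟨hinv, fun i hi g hg hig => ?_⟩) (fun h31 =>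
      ensures_ite (fun htest => ?_) (fun htest =>
        ensures_skip ⟨hinv, fun i hi g hg hig => ?_⟩)))
    · rcases split hig with hig | ⟨rfl, rfl⟩
      · exact hsmall i hi g hg hig
      · exact absurd (mem_actOf.1 hi) (by simpa [h14] using h30)
    · rcases split hig with hig | ⟨rfl, rfl⟩
      · exact hsmall i hi g hg hig
      · have h1 := mem_poolOf.1 hg
        have h2 := hinv.bag k
        simp only [Expr.val_get, Expr.val_zero, k19] at h31
        simp only [ne_eq] at h1
        omega
    · simp only [Expr.val_get, Expr.val_zero, h14] at h30
      simp only [Expr.val_get, Expr.val_zero, k19] at h31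
      simp only [Expr.val_sub, Expr.val_add, Expr.val_one, Expr.val_get, Expr.val_zero, hgood, h14,
        hAτ] at htest
      refine ensures_seq (ensures_set (fun _ => ?_) (ensures_seq (ensures_set (fun _ => ?_)
        (ensures_set (fun _ => ?_) ?_))))
      · simp only [Expr.val_get, Expr.val_zero, h14]; omega
      · simp only [Expr.val_one]; omega
      · simp only [Expr.val_one]; omega
      have hserve := hinv.singles.serve (i := ⟨t, ht⟩) (g := ⟨k, hk⟩) (mem_actOf.2 h30)
        (mem_poolOf.2 (by rw [h31]; decide)) (by
          rw [← not_lt, hlt]; simp only [not_lt]; omega)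
      simp only [Expr.val_one, Expr.val_get, Expr.val_zero, h14, k19, State.setMem_mem_same,
        State.setMem_mem_ne _ (show 14 ≠ 5 by decide),
        State.setMem_mem_ne _ (show 19 ≠ 5 by decide),
        State.setMem_mem_ne _ (show 19 ≠ 30 by decide),
        State.setMem_mem_ne _ (show 30 ≠ 5 by decide),
        State.setMem_mem_ne _ (show 31 ≠ 5 by decide),
        State.setMem_mem_ne _ (show 31 ≠ 30 by decide),
        State.setMem_mem_ne _ (show 30 ≠ 31 by decide)]
      have e1 := actOf_update (τ.mem 30) (⟨t, ht⟩ : Fin n)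
      have e2 := poolOf_update (τ.mem 31) (⟨k, hk⟩ : Fin m)
      simp only at e1 e2
      refine ⟨⟨?_, fun g => ?_⟩, fun i hi g hg hig => ?_⟩
      · simp only [State.setMem_mem_same, State.setMem_mem_ne _ (show 30 ≠ 5 by decide),
          State.setMem_mem_ne _ (show 31 ≠ 5 by decide),
          State.setMem_mem_ne _ (show 31 ≠ 30 by decide),
          State.setMem_mem_ne _ (show 30 ≠ 31 by decide),
          State.setMem_mem_ne _ (show 5 ≠ 31 by decide),
          State.setMem_mem_ne _ (show 5 ≠ 30 by decide)]
        rw [e1, e2]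
        convert hserve using 1
        funext g
        by_cases hg : g = ⟨k, hk⟩
        · subst hg; simp
        · rw [Function.update_of_ne (fun h => hg (Fin.ext h)), Function.update_of_ne hg]
      · simp only [State.setMem_mem_same, State.setMem_mem_ne _ (show 31 ≠ 5 by decide),
          State.setMem_mem_ne _ (show 31 ≠ 30 by decide)]
        by_cases hg : g = k
        · simp [hg]
        · rw [Function.update_of_ne hg]; exact hinv.bag g
      · rw [e1] at hi
        rw [e2] at hg
        rcases split hig with hig | ⟨rfl, rfl⟩
        · exact hsmall i (Finset.mem_of_mem_erase hi) g (Finset.mem_of_mem_erase hg) hig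
        · exact absurd rfl (Finset.ne_of_mem_erase hi)
    · rcases split hig with hig | ⟨rfl, rfl⟩
      · exact hsmall i hi g hg hig
      · simp only [Expr.val_sub, Expr.val_add, Expr.val_one, Expr.val_get, Expr.val_zero, hgood,
          h14, hAτ] at htest
        rw [hlt]
        simp only
        omega
  · rcases Nat.lt_succ_iff_lt_or_eq.1 hg' with hg' | hg'
    · exact Or.inl hg'
    · exact Or.inr ⟨hg', i.2⟩

/-- What `findCmd` has found out about the agents `i < t`, where `cut i` is the point up to which
agent `i` needs cake: the value `b` of variable `33` is the agent with the leftmost such point, or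
`n` if all of them lie beyond the cake. -/
def Found {n : ℕ} (act : Finset (Fin n)) (cut : Fin n → ℝ) (real : ℕ → ℝ) (b t : ℕ) : Prop :=
  (b = n ∧ ∀ i ∈ act, (i : ℕ) < t → 1 < cut i) ∨
    ∃ i ∈ act, (i : ℕ) < t ∧ b = i ∧ real (i + 2) = cut i ∧ cut i ≤ 1 ∧
      ∀ j ∈ act, (j : ℕ) < t → cut i ≤ cut j

theorem ensures_findCmd {s : State} (hnX : n + m + 1 ≤ X) (hH : n + m ≤ H) (hD : 0 < D)
    (hUX : ∀ i < n, ∑ g ∈ Finset.range m, U i g ≤ X)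
    (hU : ∀ (i : Fin n) (g : Fin m), (U i g : ℝ) = D * I.good i g)
    (henv : Env n m D U C s) (hA : ∀ i : Fin n, s.mem 23 i = A i) :
    Ensures I X H findCmd (fun σ => σ.real 0 = s.real 0 ∧ σ.out = s.out ∧
      Found (actOf (s.mem 30)) (fun i => I.cutQuery i (s.real 0)
        (I.need (fun i => (A i : ℝ) / D) (bagOf (s.mem 31)) i)) σ.real (σ.mem 33 0) n) s := by
  have hD' : (0 : ℝ) < D := Nat.cast_pos.2 hD
  set cut : Fin n → ℝ := fun i => I.cutQuery i (s.real 0)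
        (I.need (fun i => (A i : ℝ) / D) (bagOf (s.mem 31)) i) with hcut
  have hneed : ∀ i : Fin n, ((A i - ∑ g ∈ Finset.range m,
      (if s.mem 31 g - 1 ≠ 0 then U i g else 0) : ℕ) : ℝ) / D =
      I.need (fun i => (A i : ℝ) / D) (bagOf (s.mem 31)) i := by
    intro i
    have h1 : ((∑ g ∈ Finset.range m, (if s.mem 31 g - 1 ≠ 0 then U i g else 0) : ℕ) : ℝ) =
        D * I.goods i (bagOf (s.mem 31)) := by
      rw [Finset.sum_range, Instance.goods, bagOf, Finset.mul_sum, Finset.sum_filter]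
      push_cast
      exact Finset.sum_congr rfl fun g _ => by split_ifs <;> simp [hU]
    rw [Instance.need]
    have h2 : I.goods i (bagOf (s.mem 31)) = D * I.goods i (bagOf (s.mem 31)) / D := by
      field_simp
    rw [h2, ← h1, ← sub_div]
    rcases le_total (∑ g ∈ Finset.range m, (if s.mem 31 g - 1 ≠ 0 then U i g else 0)) (A i)
      with h | h
    · rw [Nat.cast_sub h, max_eq_left]
      exact div_nonneg (sub_nonneg.2 (Nat.cast_le.2 h)) hD'.le
    · rw [Nat.sub_eq_zero_of_le h, max_eq_right]
      · simp
      · exact div_nonpos_of_nonpos_of_nonneg (sub_nonpos.2 (Nat.cast_le.2 h)) hD'.le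
  refine ensures_seq (ensures_load (ensures_seq (ensures_set (fun _ => ?_) ?_)))
  · simp [henv.agents]; omega
  simp only [Expr.val_add, Expr.val_get, Expr.val_zero, Expr.val_one, Expr.val_two, henv.agents,
    State.setReal_mem, Nat.cast_one, div_one]
  set s₁ := (s.setReal (n + 2) 1).setMem 33 0 n with hs₁
  have r0 : s₁.real 0 = s.real 0 := by simp [hs₁]
  have rn : s₁.real (n + 2) = 1 := by simp [hs₁]
  have b0 : s₁.mem 33 0 = n := by simp [hs₁]
  have o0 : s₁.out = s.out := rfl
  have f₁ : ∀ a, a ≠ 33 → s₁.mem a = s.mem a := fun a ha => by simp [hs₁, ha]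
  clear_value s₁
  refine ensures_for (fun t σ => (σ.real 0 = s.real 0 ∧ σ.out = s.out ∧ σ.real (n + 2) = 1) ∧
      Found (actOf (s.mem 30)) cut σ.real (σ.mem 33 0) t) n
    (by omega) (by omega) (by simp [Cmd.writes])
    (fun σ hσ => ?_) (fun k σ j hk => by simpa using hk)
    ⟨⟨r0, o0, rn⟩, Or.inl ⟨b0, fun i _ h => absurd h (Nat.not_lt_zero _)⟩⟩ ?_
    (fun σ _ hσ => ⟨hσ.1.1, hσ.1.2.1, hσ.2⟩)
  · rw [Expr.val_get, Expr.val_zero, hσ.1 0 (by simp [Cmd.writes]), f₁ 0 (by decide), henv.agents]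
  rintro t ht σ hσ h14 ⟨⟨hr0, hout, hrn⟩, hfound⟩
  have f : ∀ a, a ∉ [14, 19, 32, 33, 34] → σ.mem a = s.mem a := fun a ha => by
    rw [hσ.1 a (by simp at ha; simp [Cmd.writes, ha]), f₁ a (by rintro rfl; simp at ha)]
  have henvσ : Env n m D U C σ := henv.congr (by
    intro a ha
    exact f a (by simp only [List.mem_cons, List.not_mem_nil, or_false] at ha ⊢; omega))
  refine ensures_ite (fun htest => ensures_skip ⟨⟨hr0, hout, hrn⟩, ?_⟩) (fun htest => ?_)
  · simp only [Expr.val_get, Expr.val_zero, h14, f 30 (by decide)] at htest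
    have hne : ∀ i : Fin n, i ∈ actOf (s.mem 30) → (i : ℕ) < t + 1 → (i : ℕ) < t := by
      intro i hi hit
      rcases Nat.lt_succ_iff_lt_or_eq.1 hit with h | h
      · exact h
      · exact absurd (h ▸ mem_actOf.1 hi) htest
    rcases hfound with ⟨h1, h2⟩ | ⟨i, h1, h2, h3, h4, h5, h6⟩
    · exact Or.inl ⟨h1, fun i hi hit => h2 i hi (hne i hi hit)⟩
    · exact Or.inr ⟨i, h1, by omega, h3, h4, h5, fun j hj hjt => h6 j hj (hne j hj hjt)⟩
  simp only [Expr.val_get, Expr.val_zero, h14, f 30 (by decide)] at htest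
  refine ensures_seq (ensures_set (fun _ => by simp) ?_)
  simp only [Expr.val_zero]
  -- the value of the bag
  have hpart : ∀ k ≤ m, ∑ g ∈ Finset.range k, (if s.mem 31 g - 1 ≠ 0 then U t g else 0) ≤ X :=
    fun k hk => by
      refine le_trans ?_ (hUX t ht)
      refine (Finset.sum_le_sum_of_subset (Finset.range_mono hk)).trans ?_
      exact Finset.sum_le_sum fun g _ => by split_ifs <;> omega
  refine ensures_seq (ensures_for (fun k τ => τ.mem 32 0 =
      ∑ g ∈ Finset.range k, (if s.mem 31 g - 1 ≠ 0 then U t g else 0)) m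
    (by omega) (by omega) (by simp [Cmd.writes]) (fun τ hτ => ?_)
    (fun k τ j hk => by rw [State.setMem_mem_ne _ (by decide)]; exact hk)
    (by simp) ?_ ?_)
  · rw [Expr.val_get, Expr.val_one, hτ.1 0 (by simp [Cmd.writes]),
      State.setMem_mem_ne _ (by decide), henvσ.items]
  · intro k hk τ hτ h19 hinv
    have g : ∀ a, a ∉ [19, 32] → τ.mem a = σ.mem a := fun a ha => by
      rw [hτ.1 a (by simp at ha; simp [Cmd.writes, ha]),
        State.setMem_mem_ne _ (by rintro rfl; simp at ha)]
    have henvτ : Env n m D U C τ := henvσ.congr (by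
      intro a ha
      exact g a (by simp only [List.mem_cons, List.not_mem_nil, or_false] at ha ⊢; omega))
    have k14 : τ.mem 14 0 = t := by rw [g 14 (by decide), h14]
    have k31 : τ.mem 31 = s.mem 31 := by rw [g 31 (by decide), f 31 (by decide)]
    have hgood : (Expr.good (.var 14) (.var 19)).val τ = U t k := by
      rw [henvτ.val_good (by simpa [k14] using ht) (by simpa [h19] using hk)]
      simp [k14, h19]
    have hsucc := Finset.sum_range_succ (fun g => if s.mem 31 g - 1 ≠ 0 then U t g else 0) k
    refine ensures_ite (fun hb => ?_) (fun hb => ensures_skip ?_)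
    · simp only [Expr.val_sub, Expr.val_get, Expr.val_zero, Expr.val_one, h19, k31] at hb
      rw [if_pos hb] at hsucc
      refine ensures_set (fun _ => ?_) ?_
      · rw [Expr.val_add, hgood, Expr.val_get, Expr.val_zero, hinv, ← hsucc]
        exact hpart _ hk
      · rw [Expr.val_add, hgood, Expr.val_get, Expr.val_zero, hinv, ← hsucc]
        simp
    · simp only [Expr.val_sub, Expr.val_get, Expr.val_zero, Expr.val_one, h19, k31] at hb
      rw [hsucc, if_neg (not_not.2 hb), add_zero, hinv]
  intro τ hτ h32
  have g : ∀ a, a ∉ [19, 32] → τ.mem a = σ.mem a := fun a ha => by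
    rw [hτ.1 a (by simp at ha; simp [Cmd.writes, ha]),
      State.setMem_mem_ne _ (by rintro rfl; simp at ha)]
  have k14 : τ.mem 14 0 = t := by rw [g 14 (by decide), h14]
  have k33 : τ.mem 33 0 = σ.mem 33 0 := by rw [g 33 (by decide)]
  have k10 : τ.mem 10 0 = D := by rw [g 10 (by decide), henvσ.scale]
  have k23 : τ.mem 23 t = A t := by
    rw [g 23 (by decide), f 23 (by decide)]; exact hA ⟨t, ht⟩
  obtain ⟨hreal, hout'⟩ := hτ.2 rfl
  simp only [State.setMem_real, State.setMem_out] at hreal hout'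
  refine ensures_seq (ensures_load (ensures_seq (ensures_cutQ ?_)))
  have hload := hneed ⟨t, ht⟩
  simp only [← h32] at hload
  simp only [Expr.val_add, Expr.val_sub, Expr.val_get, Expr.val_zero, Expr.val_one, Expr.val_two,
    State.setReal_mem, State.setReal_real, k14, k23, k10, hload, Function.update_self,
    Function.update_of_ne (show (0 : ℕ) ≠ 1 by decide), hreal, hr0]
  have hcutt : I.cutQuery t (s.real 0) (I.need (fun i => (A i : ℝ) / D) (bagOf (s.mem 31)) ⟨t, ht⟩)
    = cut ⟨t, ht⟩ := rfl
  rw [hcutt]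
  set ν := ((τ.setReal 1 (I.need (fun i => (A i : ℝ) / D) (bagOf (s.mem 31)) ⟨t, ht⟩)).setReal
    (t + 2) (cut ⟨t, ht⟩)) with hν
  have n14 : ν.mem 14 0 = t := k14
  have n33 : ν.mem 33 0 = σ.mem 33 0 := k33
  have nout : ν.out = s.out := by rw [← hout, ← hout']; rfl
  have nt : ν.real (t + 2) = cut ⟨t, ht⟩ := by simp [hν]
  have nreal : ∀ j, j ≠ 1 → j ≠ t + 2 → ν.real j = σ.real j := fun j h1 h2 => by
    simp [hν, h1, h2, hreal]
  have n0 : ν.real 0 = s.real 0 := by rw [nreal 0 (by decide) (by omega), hr0]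
  have nn : ν.real (n + 2) = 1 := by rw [nreal _ (by omega) (by omega), hrn]
  clear_value ν
  refine ensures_seq (ensures_cmp (by omega) ?_)
  simp only [Expr.val_add, Expr.val_get, Expr.val_zero, Expr.val_two, n14, n33]
  set ξ := ν.setMem 34 0 (if ν.real (t + 2) ≤ ν.real (σ.mem 33 0 + 2) then 1 else 0) with hξ
  have x33 : ξ.mem 33 0 = σ.mem 33 0 := by simp [hξ, n33]
  have x14 : ξ.mem 14 0 = t := by simp [hξ, n14]
  have hact : (⟨t, ht⟩ : Fin n) ∈ actOf (s.mem 30) := mem_actOf.2 htest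
  have hlt : ∀ i : Fin n, (i : ℕ) < t + 1 → (i : ℕ) < t ∨ i = ⟨t, ht⟩ := fun i hi => by
    rcases Nat.lt_succ_iff_lt_or_eq.1 hi with h | h
    · exact Or.inl h
    · exact Or.inr (Fin.ext h)
  refine ensures_ite (fun hle => ensures_set (fun _ => ?_) ?_) (fun hle => ensures_skip ?_)
  · simp only [Expr.val_get, Expr.val_zero, x14]; omega
  · have hle' : ν.real (t + 2) ≤ ν.real (σ.mem 33 0 + 2) := by
      by_contra hcon
      simp [hξ, hcon] at hle
    refine ⟨⟨n0, nout, nn⟩, Or.inr ⟨⟨t, ht⟩, hact, Nat.lt_succ_self t, by simp [x14], nt, ?_⟩⟩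
    rw [nt] at hle'
    rcases hfound with ⟨h1, h2⟩ | ⟨i, h1, h2, h3, h4, h5, h6⟩
    · rw [h1, nn] at hle'
      refine ⟨hle', fun j hj hjt => ?_⟩
      rcases hlt j hjt with h | rfl
      · exact hle'.trans (h2 j hj h).le
      · exact le_rfl
    · rw [h3, nreal _ (by omega) (by omega), h4] at hle'
      refine ⟨hle'.trans h5, fun j hj hjt => ?_⟩
      rcases hlt j hjt with h | rfl
      · exact hle'.trans (h6 j hj h)
      · exact le_rfl
  · have hle' : ν.real (σ.mem 33 0 + 2) < ν.real (t + 2) := by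
      by_contra hcon
      simp [hξ, not_lt.1 hcon] at hle
    refine ⟨⟨n0, nout, nn⟩, ?_⟩
    rw [x33]
    rw [nt] at hle'
    rcases hfound with ⟨h1, h2⟩ | ⟨i, h1, h2, h3, h4, h5, h6⟩
    · rw [h1, nn] at hle'
      refine Or.inl ⟨h1, fun j hj hjt => ?_⟩
      rcases hlt j hjt with h | rfl
      · exact h2 j hj h
      · exact hle'
    · have h7 : ν.real (i + 2) = σ.real (i + 2) := nreal _ (by omega) (by omega)
      rw [h3, h7, h4] at hle'
      refine Or.inr ⟨i, h1, by omega, h3, h7.trans h4, h5, fun j hj hjt => ?_⟩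
      rcases hlt j hjt with h | rfl
      · exact h6 j hj h
      · exact hle'.le

end

end MixedGoods

/-! ### Correctness of the program for bag filling -/

namespace MixedGoods

/-- Machine states in the middle of the bag filling. -/
def Filling {n m : ℕ} (I : Instance n m) (a : Fin n → ℝ) (s : State) : Prop :=
  BagFilling I a (actOf (s.mem 30)) (poolOf (s.mem 31)) (bagOf (s.mem 31)) (fun g => s.mem 5 g)
    (s.real 0) s.out

/-- Machine states in which the current bag and cake satisfy nobody. -/
def StuckAt {n m : ℕ} (I : Instance n m) (a : Fin n → ℝ) (s : State) : Prop :=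
  Stuck I a (actOf (s.mem 30)) (bagOf (s.mem 31) : Finset (Fin m)) (s.real 0)

/-- The goods `g < k` have been put into the bag, or given away. -/
def Covered (m k : ℕ) (s : State) : Prop :=
  ∀ g : Fin m, g ∈ poolOf (s.mem 31) → (g : ℕ) < k → g ∈ bagOf (s.mem 31)

section

variable {n m : ℕ} {I : Instance n m} {X H D : ℕ} {U : ℕ → ℕ → ℕ} {C A : ℕ → ℕ} {a : Fin n → ℝ}
  {s σ : State}

theorem Filling.congr (h : Filling I a s) (h5 : σ.mem 5 = s.mem 5) (h30 : σ.mem 30 = s.mem 30)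
    (h31 : σ.mem 31 = s.mem 31) (hr : σ.real 0 = s.real 0) (ho : σ.out = s.out) :
    Filling I a σ := by
  rw [Filling, h5, h30, h31, hr, ho]; exact h

theorem StuckAt.congr (h : StuckAt I a s) (h30 : σ.mem 30 = s.mem 30)
    (h31 : σ.mem 31 = s.mem 31) (hr : σ.real 0 = s.real 0) : StuckAt I a σ := by
  rw [StuckAt, h30, h31, hr]; exact h

theorem Covered.congr {k : ℕ} (h : Covered m k s) (h31 : σ.mem 31 = s.mem 31) :
    Covered m k σ := by
  rw [Covered, h31]; exact h

theorem cutQuery_zero (i : Fin n) {x : ℝ} (hx : 0 ≤ x) (hx1 : x ≤ 1) : I.cutQuery i x 0 = x := by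
  obtain ⟨h1, -, -, h2⟩ := I.cutQuery_spec i hx hx1 le_rfl
    (sub_nonneg.2 (I.prefixCake_mono i hx1 le_rfl))
  exact le_antisymm (h2 x le_rfl hx1 (sub_self _)) h1

theorem Stuck.one_lt_cut {act : Finset (Fin n)} {bag : Finset (Fin m)} {x : ℝ}
    (h : Stuck I a act bag x) (hx : 0 ≤ x) {i : Fin n} (hi : i ∈ act) :
    1 < I.cutQuery i x (I.need a bag i) := by
  have h1 := h i hi
  have h2 : a i - I.goods i bag ≤ I.need a bag i := le_max_left _ _
  rw [I.cutQuery_eq_two i hx]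
  · norm_num
  · rw [Instance.rest] at h1
    linarith

/-- After `findCmd`, the program `serveCmd` serves somebody unless the bag is stuck. -/
theorem ensures_serveCmd (hnX : n + m + 1 ≤ X) (hH : n + m ≤ H) (ha0 : ∀ i, 0 ≤ a i)
    (hagents : s.mem 0 0 = n) (hitems : s.mem 0 1 = m) (h : Filling I a s)
    (hfound : Found (actOf (s.mem 30)) (fun i => I.cutQuery i (s.real 0)
      (I.need a (bagOf (s.mem 31) : Finset (Fin m)) i)) s.real (s.mem 33 0) n) :
    Ensures I X H serveCmd (fun σ => Filling I a σ ∧ (∀ k, Covered m k s → Covered m k σ) ∧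
      (StuckAt I a σ ∨ ¬ StuckAt I a s ∧
        (actOf (σ.mem 30) : Finset (Fin n)).card < (actOf (s.mem 30) : Finset (Fin n)).card)) s := by
  rcases hfound with ⟨hb, hcut⟩ | ⟨i, hi, -, hb, hreal, hcut1, hmin⟩
  · refine ensures_ite (fun h0 => ?_) (fun _ => ensures_skip ⟨h, fun _ hk => hk, Or.inl ?_⟩)
    · simp [hagents, hb] at h0
    · exact BagFilling.stuck_of_cut h fun i hi => hcut i hi i.2
  refine ensures_ite (fun _ => ?_) (fun h0 => ?_)
  swap
  · simp only [Expr.val_sub, Expr.val_get, Expr.val_zero, hagents, hb] at h0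
    have := i.2
    omega
  have hns : ¬ StuckAt I a s := fun hs => absurd hcut1
    (not_le.2 (Stuck.one_lt_cut (I := I) hs h.tiles.nonneg hi))
  set y := I.cutQuery i (s.real 0) (I.need a (bagOf (s.mem 31) : Finset (Fin m)) i) with hy
  have hserve := fun own' hown => BagFilling.serve_cut h ha0 hi hcut1 (fun j hj => hmin j hj j.2)
    (own' := own') hown
  simp only [← hy] at hserve hreal
  have hyy : I.cutQuery i y 0 = y := by
    have h1 := (hserve _ fun g => rfl)
    exact cutQuery_zero i h1.tiles.nonneg hcut1
  refine ensures_seq (ensures_give (ensures_seq (ensures_load (ensures_seq (ensures_cutQ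
    (ensures_seq (ensures_set (fun _ => by simp; omega) ?_)))))))
  simp only [Expr.val_add, Expr.val_get, Expr.val_zero, Expr.val_one, Expr.val_two,
    State.setReal_mem, State.setReal_real, State.emit_mem, State.emit_real, hb, Function.update_self,
    Nat.cast_zero, zero_div, Function.update_of_ne (show (i : ℕ) + 2 ≠ 1 by omega), hreal, hyy]
  set ν := State.setMem _ 30 _ 1 with hν
  have n0 : ν.real 0 = y := by simp [hν]
  have nout : ν.out = s.out ++ [((i : ℕ), s.real 0, y)] := by simp [hν]
  have n30 : ν.mem 30 = Function.update (s.mem 30) i 1 := by simp [hν]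
  have nne : ∀ b, b ≠ 30 → ν.mem b = s.mem b := fun b hb => by simp [hν, hb]
  clear_value ν
  refine ensures_for (fun t τ => ∀ g,
      (τ.mem 5 g = if g < t ∧ s.mem 31 g - 1 ≠ 0 then (i : ℕ) else s.mem 5 g) ∧
      (τ.mem 31 g = if g < t ∧ s.mem 31 g - 1 ≠ 0 then 1 else s.mem 31 g)) m
    (by omega) (by omega) (by simp [Cmd.writes]) (fun τ hτ => ?_)
    (fun t τ j hk => by
      intro g
      rw [State.setMem_mem_ne _ (by decide), State.setMem_mem_ne _ (by decide)]
      exact hk g)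
    (fun g => ?_) ?_ ?_
  · rw [Expr.val_get, Expr.val_one, hτ.1 0 (by simp [Cmd.writes]), nne 0 (by decide), hitems]
  · simp [nne]
  · intro t ht τ hτ h19 hinv
    have k33 : τ.mem 33 0 = i := by rw [hτ.1 33 (by simp [Cmd.writes]), nne 33 (by decide), hb]
    have h31t : τ.mem 31 t = s.mem 31 t := by rw [(hinv t).2, if_neg (fun h => lt_irrefl _ h.1)]
    refine ensures_ite (fun htest => ?_) (fun htest => ensures_skip fun g => ?_)
    · simp only [Expr.val_sub, Expr.val_get, Expr.val_zero, Expr.val_one, h19, h31t] at htest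
      refine ensures_seq (ensures_set (fun _ => ?_) (ensures_set (fun _ => ?_) fun g => ?_))
      · simp only [Expr.val_get, Expr.val_zero, k33]
        have := i.2
        omega
      · simp only [Expr.val_one]; omega
      · simp only [Expr.val_get, Expr.val_zero, Expr.val_one, h19, k33, State.setMem_mem_same,
          State.setMem_mem_ne _ (show 19 ≠ 5 by decide),
          State.setMem_mem_ne _ (show 31 ≠ 5 by decide),
          State.setMem_mem_ne _ (show 5 ≠ 31 by decide)]
        by_cases hg : g = t
        · subst hg
          simp [htest]
        · rw [Function.update_of_ne hg, Function.update_of_ne hg, (hinv g).1, (hinv g).2]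
          have : g < t + 1 ↔ g < t := by omega
          simp only [this, and_self]
    · simp only [Expr.val_sub, Expr.val_get, Expr.val_zero, Expr.val_one, h19, h31t] at htest
      have : (g < t + 1 ∧ s.mem 31 g - 1 ≠ 0) ↔ (g < t ∧ s.mem 31 g - 1 ≠ 0) := by
        refine and_congr_left fun hg => ⟨fun h => ?_, fun h => by omega⟩
        rcases Nat.lt_succ_iff_lt_or_eq.1 h with h | rfl
        · exact h
        · exact absurd htest hg
      simp only [this]
      exact hinv g
  intro τ hτ hinv
  obtain ⟨hr, ho⟩ := hτ.2 rfl
  have k30 : τ.mem 30 = Function.update (s.mem 30) i 1 := by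
    rw [hτ.1 30 (by simp [Cmd.writes]), n30]
  have hact : (actOf (τ.mem 30) : Finset (Fin n)) = (actOf (s.mem 30)).erase i := by
    rw [k30, actOf_update]
  have hbag : ∀ g : Fin m, g ∈ bagOf (s.mem 31) → τ.mem 31 g = 1 := fun g hg => by
    rw [(hinv g).2, if_pos ⟨g.2, mem_bagOf.1 hg⟩]
  have hbag' : ∀ g : Fin m, g ∉ bagOf (s.mem 31) → τ.mem 31 g = s.mem 31 g := fun g hg => by
    rw [(hinv g).2, if_neg fun h => hg (mem_bagOf.2 h.2)]
  have hpool : (poolOf (τ.mem 31) : Finset (Fin m)) = poolOf (s.mem 31) \ bagOf (s.mem 31) := by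
    ext g
    rw [Finset.mem_sdiff, mem_poolOf]
    by_cases hg : g ∈ bagOf (s.mem 31)
    · simp [hbag g hg, hg]
    · simp [hbag' g hg, hg, mem_poolOf]
  have hempty : (bagOf (τ.mem 31) : Finset (Fin m)) = ∅ := by
    refine Finset.eq_empty_of_forall_notMem fun g hg => ?_
    rw [mem_bagOf] at hg
    by_cases hg' : g ∈ bagOf (s.mem 31)
    · simp [hbag g hg'] at hg
    · rw [hbag' g hg'] at hg
      exact hg' (mem_bagOf.2 hg)
  refine ⟨?_, fun k hk g hg hgk => ?_, Or.inr ⟨hns, ?_⟩⟩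
  · rw [Filling, hact, hpool, hempty, hr, ho, n0, nout]
    refine hserve _ fun g => ?_
    rw [(hinv g).1]
    simp only [g.2, true_and, mem_bagOf]
  · rw [hpool, Finset.mem_sdiff] at hg
    exact absurd (hk g hg.1 hgk) hg.2
  · rw [hact]
    exact Finset.card_erase_lt_of_mem hi

/-- As each round serves an agent unless the bag is stuck, it is stuck after `n` rounds. -/
theorem ensures_roundsCmd {k : ℕ} (hnX : n + m + 1 ≤ X) (hH : n + m ≤ H) (hD : 0 < D)
    (hUX : ∀ i < n, ∑ g ∈ Finset.range m, U i g ≤ X)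
    (hU : ∀ (i : Fin n) (g : Fin m), (U i g : ℝ) = D * I.good i g)
    (henv : Env n m D U C s) (hA : ∀ i : Fin n, s.mem 23 i = A i)
    (h : Filling I (fun i => (A i : ℝ) / D) s) (hk : Covered m k s) :
    Ensures I X H roundsCmd (fun σ => Filling I (fun i => (A i : ℝ) / D) σ ∧ Covered m k σ ∧
      StuckAt I (fun i => (A i : ℝ) / D) σ) s := by
  refine ensures_for (fun t σ => Filling I (fun i => (A i : ℝ) / D) σ ∧ Covered m k σ ∧
      (StuckAt I (fun i => (A i : ℝ) / D) σ ∨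
        (actOf (σ.mem 30) : Finset (Fin n)).card + t ≤ n)) n
    (by omega) (by omega) (by simp [Cmd.writes, findCmd, serveCmd]) (fun σ hσ => ?_)
    (fun t σ j hk => ⟨hk.1.congr (by simp) (by simp) (by simp) rfl rfl, hk.2.1.congr (by simp),
      hk.2.2.imp (fun h => h.congr (by simp) (by simp) rfl) fun h => by simpa using h⟩)
    ⟨h, hk, Or.inr (by simpa using Finset.card_le_univ (actOf (s.mem 30) : Finset (Fin n)))⟩ ?_
    (fun σ _ hσ => ⟨hσ.1, hσ.2.1, hσ.2.2.elim id fun h0 i hi => ?_⟩)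
  · rw [Expr.val_get, Expr.val_zero, hσ.1 0 (by simp [Cmd.writes, findCmd, serveCmd]), henv.agents]
  · rintro t ht σ hσ - ⟨hfill, hcov, hor⟩
    have f : ∀ b, b ∉ [5, 14, 19, 30, 31, 32, 33, 34, 35] → σ.mem b = s.mem b := fun b hb =>
      hσ.1 b (by
        simp only [List.mem_cons, List.not_mem_nil, or_false, not_or] at hb
        simp [Cmd.writes, findCmd, serveCmd, hb])
    have henvσ : Env n m D U C σ := henv.congr (by
      intro b hb
      exact f b (by simp only [List.mem_cons, List.not_mem_nil, or_false] at hb ⊢; omega))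
    refine ensures_seq ((ensures_findCmd (A := A) hnX hH hD hUX hU henvσ
      (fun i => by rw [f 23 (by decide)]; exact hA i)).mono fun τ hτ hfound => ?_)
    obtain ⟨hr, ho, hfound⟩ := hfound
    have g : ∀ b, b ∉ [14, 19, 32, 33, 34] → τ.mem b = σ.mem b := fun b hb =>
      hτ.1 b (by
        simp only [List.mem_cons, List.not_mem_nil, or_false, not_or] at hb
        simp [Cmd.writes, findCmd, hb])
    have g30 := g 30 (by decide)
    have g31 := g 31 (by decide)
    rw [← g30, ← g31, ← hr] at hfound
    refine (ensures_serveCmd hnX hH (fun i => by positivity)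
      (by rw [g 0 (by decide), henvσ.agents]) (by rw [g 0 (by decide), henvσ.items])
      (hfill.congr (g 5 (by decide)) g30 g31 hr ho) hfound).mono fun ξ _ hξ => ?_
    refine ⟨hξ.1, hξ.2.1 k (hcov.congr g31), hξ.2.2.imp id fun ⟨h1, h2⟩ => ?_⟩
    rcases hor with hor | hor
    · exact absurd (hor.congr g30 g31 hr) h1
    · rw [g30] at h2
      omega
  · have := Finset.card_pos.2 ⟨i, hi⟩
    omega

/-- The program `allocateCmd` meets all targets. The cake left at the end goes to agent `0`. -/
theorem ensures_allocateCmd (hn : 0 < n) (hnX : n + m + 1 ≤ X) (hH : n + m ≤ H) (hD : 0 < D)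
    (hUX : ∀ i < n, ∑ g ∈ Finset.range m, U i g ≤ X)
    (hU : ∀ (i : Fin n) (g : Fin m), (U i g : ℝ) = D * I.good i g)
    (henv : Env n m D U C s) (hA : ∀ i : Fin n, s.mem 23 i = A i)
    (ha : ∀ i : Fin n, (A i : ℝ) / D ≤ I.mms i n)
    (hc : ∀ i : Fin n, ((n : ℝ) - 1) * (2 * ((A i : ℝ) / D) - I.mms i n) ≤ I.wholeCake i)
    (h5 : ∀ j, s.mem 5 j = 0) (h30 : ∀ j, s.mem 30 j = 0) (h31 : ∀ j, s.mem 31 j = 0)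
    (hout : s.out = []) :
    Ensures I X H allocateCmd (fun σ => ∃ P : Allocation n m, OutputsAllocation σ P ∧
      ∀ i : Fin n, (A i : ℝ) / D ≤ I.utility i P i) s := by
  have ha0 : ∀ i : Fin n, 0 ≤ (A i : ℝ) / D := fun i => by positivity
  have hstart : SinglesInv I (fun i => (A i : ℝ) / D) s := by
    refine ⟨?_, fun g => by simp [h31]⟩
    have e1 : (actOf (s.mem 30) : Finset (Fin n)) = Finset.univ := by
      ext; simp [mem_actOf, h30]
    have e2 : (poolOf (s.mem 31) : Finset (Fin m)) = Finset.univ := by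
      ext; simp [mem_poolOf, h31]
    rw [e1, e2]
    simp only [h5]
    exact I.singles_start _ hn
  refine ensures_seq ((ensures_singlesCmd hnX hH hD hU henv hA hstart).mono fun σ hσ hs => ?_)
  obtain ⟨hs, hsmall⟩ := hs
  obtain ⟨-, ho⟩ := hσ.2 rfl
  have f : ∀ b, b ∉ [5, 14, 19, 30, 31] → σ.mem b = s.mem b := fun b hb =>
    hσ.1 b (by
      simp only [List.mem_cons, List.not_mem_nil, or_false, not_or] at hb
      simp [Cmd.writes, singlesCmd, hb])
  have hempty : (bagOf (σ.mem 31) : Finset (Fin m)) = ∅ := by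
    refine Finset.eq_empty_of_forall_notMem fun g hg => ?_
    rw [mem_bagOf] at hg
    have := hs.bag g
    omega
  refine ensures_seq (ensures_load (ensures_seq ?_))
  simp only [Expr.val_zero, Expr.val_one, Nat.cast_zero, zero_div]
  have henv₁ : Env n m D U C (σ.setReal 0 0) := henv.congr (by
    intro b hb
    exact f b (by simp only [List.mem_cons, List.not_mem_nil, or_false] at hb ⊢; omega))
  have hfill : Filling I (fun i => (A i : ℝ) / D) (σ.setReal 0 0) := by
    have := hs.singles.bagFilling hsmall ha0 ha hc
    simpa [Filling, hempty, ho, hout] using this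
  have hA₁ : ∀ i : Fin n, (σ.setReal 0 0).mem 23 i = A i := fun i => by
    rw [State.setReal_mem, f 23 (by decide)]; exact hA i
  clear hsmall hs hempty ho
  generalize σ.setReal 0 0 = ν at henv₁ hfill hA₁
  refine (ensures_roundsCmd (k := 0) hnX hH hD hUX hU henv₁ hA₁ hfill
    (fun g _ h0 => absurd h0 (Nat.not_lt_zero _))).mono fun τ hτ hinv => ?_
  have f₁ : ∀ b, b ∉ [5, 14, 19, 30, 31, 32, 33, 34, 35] → τ.mem b = ν.mem b := fun b hb =>
    hτ.1 b (by
      simp only [List.mem_cons, List.not_mem_nil, or_false, not_or] at hb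
      simp [Cmd.writes, roundsCmd, findCmd, serveCmd, hb])
  have henv₂ : Env n m D U C τ := henv₁.congr (by
    intro b hb
    exact f₁ b (by simp only [List.mem_cons, List.not_mem_nil, or_false] at hb ⊢; omega))
  have hA₂ : ∀ i : Fin n, τ.mem 23 i = A i := fun i => by
    rw [f₁ 23 (by decide)]; exact hA₁ i
  clear f₁ hτ hfill hA₁ henv₁
  refine ensures_seq (ensures_for (fun k ξ => Filling I (fun i => (A i : ℝ) / D) ξ ∧
      Covered m k ξ ∧ StuckAt I (fun i => (A i : ℝ) / D) ξ) m
    (by omega) (by omega) (by simp [Cmd.writes, roundsCmd, findCmd, serveCmd]) (fun ξ hξ => ?_)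
    (fun t ξ j hk => ⟨hk.1.congr (by simp) (by simp) (by simp) rfl rfl, hk.2.1.congr (by simp),
      hk.2.2.congr (by simp) (by simp) rfl⟩)
    hinv ?_ ?_)
  · rw [Expr.val_get, Expr.val_one,
      hξ.1 0 (by simp [Cmd.writes, roundsCmd, findCmd, serveCmd]), henv₂.items]
  · rintro k hk ξ hξ h36 ⟨hfill, hcov, hst⟩
    have g : ∀ b, b ∉ [5, 14, 19, 30, 31, 32, 33, 34, 35, 36] → ξ.mem b = τ.mem b := fun b hb =>
      hξ.1 b (by
        simp only [List.mem_cons, List.not_mem_nil, or_false, not_or] at hb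
        simp [Cmd.writes, roundsCmd, findCmd, serveCmd, hb])
    have henv₃ : Env n m D U C ξ := henv₂.congr (by
      intro b hb
      exact g b (by simp only [List.mem_cons, List.not_mem_nil, or_false] at hb ⊢; omega))
    have hA₃ : ∀ i : Fin n, ξ.mem 23 i = A i := fun i => by
      rw [g 23 (by decide)]; exact hA₂ i
    refine ensures_seq (ensures_ite (fun htest => ensures_skip ?_) (fun htest =>
      ensures_set (fun _ => ?_) ?_))
    · simp only [Expr.val_get, Expr.val_zero, h36] at htest
      refine ensures_roundsCmd hnX hH hD hUX hU henv₃ hA₃ hfill fun g' hg hgk => ?_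
      rcases Nat.lt_succ_iff_lt_or_eq.1 hgk with hgk | hgk
      · exact hcov g' hg hgk
      · rw [mem_poolOf, hgk] at hg
        rw [mem_bagOf, hgk]
        omega
    · simp only [Expr.val_two]
      omega
    simp only [Expr.val_get, Expr.val_zero, Expr.val_two, h36] at htest ⊢
    have hpool : (poolOf (Function.update (ξ.mem 31) k 2) : Finset (Fin m)) =
        poolOf (ξ.mem 31) := by
      ext g'
      rw [mem_poolOf, mem_poolOf]
      by_cases hg' : (g' : ℕ) = k
      · simp [hg', htest]
      · rw [Function.update_of_ne hg']
    have hbag : (bagOf (Function.update (ξ.mem 31) k 2) : Finset (Fin m)) =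
        insert ⟨k, hk⟩ (bagOf (ξ.mem 31)) := by
      ext g'
      rw [Finset.mem_insert, mem_bagOf, mem_bagOf, Fin.ext_iff]
      by_cases hg' : (g' : ℕ) = k
      · simp [hg']
      · rw [Function.update_of_ne hg']
        simp [hg']
    refine ensures_roundsCmd hnX hH hD hUX hU (henv₃.congr ?_) (fun i => ?_) ?_ ?_
    · intro b hb
      exact State.setMem_mem_ne _ (by rintro rfl; simp at hb) _ _
    · rw [State.setMem_mem_ne _ (by decide)]; exact hA₃ i
    · have hadd := BagFilling.add (g := ⟨k, hk⟩) hfill hst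
        (mem_poolOf.2 (by simp [htest])) (fun hg => by rw [mem_bagOf] at hg; simp [htest] at hg)
      rw [← hbag, ← hpool] at hadd
      simpa [Filling] using hadd
    · intro g' hg hgk
      rw [State.setMem_mem_same] at hg ⊢
      rw [hpool] at hg
      rw [hbag, Finset.mem_insert]
      rcases Nat.lt_succ_iff_lt_or_eq.1 hgk with hgk | hgk
      · exact Or.inr (hcov g' hg hgk)
      · exact Or.inl (Fin.ext hgk)
  rintro ξ hξ ⟨hfill, hcov, hst⟩
  have hact := BagFilling.act_eq_empty hfill hst ha0 fun g hg => hcov g hg g.2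
  rw [Filling, hact] at hfill
  refine ensures_seq (ensures_load (ensures_give ?_))
  obtain ⟨P, h1, h2, h3⟩ := hfill.exists_allocation hn
  refine ⟨P, ⟨fun g => ?_, fun i => ?_⟩, h3⟩
  · simpa using h1 g
  · rw [h2 i]
    simp [pieceOf]

end

end MixedGoods

/-! ### Scaling of the input and the complete program -/

namespace MixedGoods

/-- Let variable `10` be `k` times the number of agents times the product of all denominators. -/
def scaleCmd (k : ℕ) : Cmd :=
  .seq (.set 10 0 (.agents * .lit k)) (.for 14 .agents (.seq
    (.for 19 .items (.set 10 0 (.var 10 * .get 2 (.var 14 * .items + .var 19))))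
    (.set 10 0 (.var 10 * .get 4 (.var 14)))))

/-- Compute the powers of the number of agents plus one. -/
def powersCmd (Q : ℕ) : Cmd :=
  .seq (.set 12 0 1) (.seq (.for 11 (.lit Q)
    (.set 12 (.var 11 + 1) (.get 12 (.var 11) * (.agents + 1))))
  (.set 13 0 (.get 12 (.lit Q) * (.agents + 1))))

/-- The approximation algorithm with relative error `5 / r`. -/
def mainCmd (r : ℕ) : Cmd :=
  .seq (scaleCmd ((r * r + r) * r)) (.seq (powersCmd (r * r))
    (.seq (targetsCmd (r * r) r) allocateCmd))

section

variable {n m : ℕ} {I : Instance n m} {X H : ℕ} {s : State}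

theorem ensures_scaleCmd {k F : ℕ} {d : ℕ → ℕ → ℕ} {e : ℕ → ℕ}
    (hn : s.mem 0 0 = n) (hm : s.mem 0 1 = m) (hnX : n + m ≤ X) (hH : n + m ≤ H)
    (hd : ∀ i < n, ∀ g < m, s.mem 2 (i * m + g) = d i g) (he : ∀ i < n, s.mem 4 i = e i)
    (hF : n * k * ∏ i ∈ Finset.range n, ((∏ g ∈ Finset.range m, d i g) * e i) = F)
    (hF0 : 0 < F) (hFX : F ≤ X) :
    Ensures I X H (scaleCmd k) (fun σ => σ.mem 10 0 = F) s := by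
  have hdvd : ∀ t < n, n * k * (∏ i ∈ Finset.range t, ((∏ g ∈ Finset.range m, d i g) * e i)) *
      ((∏ g ∈ Finset.range m, d t g) * e t) ∣ F := fun t ht => by
    rw [← hF, mul_assoc, ← Finset.prod_range_succ]
    exact mul_dvd_mul_left _ (Finset.prod_dvd_prod_of_subset _ _ _ (Finset.range_mono ht))
  have hle : ∀ {z : ℕ}, z ∣ F → z ≤ X := fun hz => (Nat.le_of_dvd hF0 hz).trans hFX
  refine ensures_seq (ensures_set (fun _ => ?_) ?_)
  · simp only [Expr.val_mul, Expr.val_get, Expr.val_zero, Expr.val_lit, hn]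
    exact hle (hF ▸ dvd_mul_right _ _)
  simp only [Expr.val_mul, Expr.val_get, Expr.val_zero, Expr.val_lit, hn]
  refine ensures_for (fun t σ => σ.mem 10 0 =
      n * k * ∏ i ∈ Finset.range t, ((∏ g ∈ Finset.range m, d i g) * e i)) n
    (by omega) (by omega) (by simp [Cmd.writes]) (fun σ hσ => ?_) (fun t σ j h => ?_) (by simp)
    ?_ (fun σ _ hσ => by rw [hσ, hF])
  · rw [Expr.val_get, Expr.val_zero, hσ.1 0 (by simp [Cmd.writes]),
      State.setMem_mem_ne _ (by decide), hn]
  · rw [State.setMem_mem_ne _ (by decide), h]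
  intro t ht σ hσ h14 hinv
  have f : ∀ b, b ∉ [10, 14, 19] → σ.mem b = s.mem b := fun b hb => by
    simp only [List.mem_cons, List.not_mem_nil, or_false, not_or] at hb
    rw [hσ.1 b (by simp [Cmd.writes, hb]), State.setMem_mem_ne _ hb.1]
  refine ensures_seq (ensures_for (fun l τ => τ.mem 10 0 =
      n * k * (∏ i ∈ Finset.range t, ((∏ g ∈ Finset.range m, d i g) * e i)) *
        ∏ g ∈ Finset.range l, d t g) m
    (by omega) (by omega) (by simp [Cmd.writes]) (fun τ hτ => ?_) (fun l τ j h => ?_)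
    (by simpa using hinv) ?_ ?_)
  · rw [Expr.val_get, Expr.val_one, hτ.1 0 (by simp [Cmd.writes]), f 0 (by decide), hm]
  · rw [State.setMem_mem_ne _ (by decide), h]
  · intro l hl τ hτ h19 hinv'
    have g : ∀ b, b ∉ [10, 19] → τ.mem b = σ.mem b := fun b hb => by
      simp only [List.mem_cons, List.not_mem_nil, or_false, not_or] at hb
      rw [hτ.1 b (by simp [Cmd.writes, hb])]
    have hval : (Expr.var 10 * .get 2 (.var 14 * .items + .var 19)).val τ = n * k *
        (∏ i ∈ Finset.range t, ((∏ g ∈ Finset.range m, d i g) * e i)) *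
        ∏ g ∈ Finset.range (l + 1), d t g := by
      simp only [Expr.val_mul, Expr.val_add, Expr.val_get, Expr.val_zero, Expr.val_one, h19,
        g 14 (by decide), h14, g 0 (by decide), f 0 (by decide), hm, g 2 (by decide),
        f 2 (by decide), hd t ht l hl, hinv', Finset.prod_range_succ, mul_assoc]
    refine ensures_set (fun _ => ?_) ?_
    · rw [hval]
      refine hle ((mul_dvd_mul_left _ ?_).trans (hdvd t ht))
      exact (Finset.prod_dvd_prod_of_subset _ _ _ (Finset.range_mono hl)).mul_right _
    · rw [hval, Expr.val_zero, State.setMem_mem_same, Function.update_self]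
  · intro τ hτ hinv'
    have g : ∀ b, b ∉ [10, 19] → τ.mem b = σ.mem b := fun b hb => by
      simp only [List.mem_cons, List.not_mem_nil, or_false, not_or] at hb
      rw [hτ.1 b (by simp [Cmd.writes, hb])]
    have hval : (Expr.var 10 * .get 4 (.var 14)).val τ = n * k *
        (∏ i ∈ Finset.range t, ((∏ g ∈ Finset.range m, d i g) * e i)) *
        ((∏ g ∈ Finset.range m, d t g) * e t) := by
      simp only [Expr.val_mul, Expr.val_get, Expr.val_zero, g 14 (by decide), h14,
        g 4 (by decide), f 4 (by decide), he t ht, hinv', mul_assoc]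
    refine ensures_set (fun _ => ?_) ?_
    · rw [hval]
      exact hle (hdvd t ht)
    · rw [hval, Expr.val_zero, State.setMem_mem_same, Function.update_self,
        Finset.prod_range_succ]
      ring

theorem ensures_powersCmd {Q : ℕ} (hn : s.mem 0 0 = n) (hX : (n + 1) ^ (Q + 1) + Q ≤ X)
    (hH : Q ≤ H) : Ensures I X H (powersCmd Q) (Powers n Q) s := by
  have hle : ∀ l ≤ Q + 1, (n + 1) ^ l ≤ X := fun l hl =>
    (Nat.pow_le_pow_right n.succ_pos hl).trans ((Nat.le_add_right _ _).trans hX)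
  refine ensures_seq (ensures_set (fun _ => by simpa using hle 0 (Nat.zero_le _)) ?_)
  simp only [Expr.val_zero, Expr.val_one]
  refine ensures_seq (ensures_for (fun t σ => ∀ l ≤ t, σ.mem 12 l = (n + 1) ^ l) Q
    (by omega) (by omega) (by simp [Cmd.writes]) (fun σ hσ => rfl) (fun t σ j h l hl => ?_)
    (fun l hl => ?_) ?_ ?_)
  · rw [State.setMem_mem_ne _ (by decide), h l hl]
  · obtain rfl := Nat.le_zero.1 hl
    simp
  · intro t ht σ hσ h11 hinv
    have h0 : σ.mem 0 = s.mem 0 := by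
      rw [hσ.1 0 (by simp [Cmd.writes]), State.setMem_mem_ne _ (by decide)]
    have hval : (Expr.get 12 (.var 11) * (.agents + 1)).val σ = (n + 1) ^ (t + 1) := by
      simp only [Expr.val_mul, Expr.val_add, Expr.val_get, Expr.val_zero, Expr.val_one, h11, h0, hn,
        hinv t le_rfl, pow_succ]
    refine ensures_set (fun _ => by rw [hval]; exact hle _ (by omega)) fun l hl => ?_
    rw [hval, State.setMem_mem_same]
    simp only [Expr.val_add, Expr.val_get, Expr.val_zero, Expr.val_one, h11]
    by_cases hlt : l = t + 1
    · rw [hlt, Function.update_self]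
    · rw [Function.update_of_ne hlt, hinv l (by omega)]
  · intro σ hσ hinv
    have h0 : σ.mem 0 = s.mem 0 := by
      rw [hσ.1 0 (by simp [Cmd.writes]), State.setMem_mem_ne _ (by decide)]
    have hval : (Expr.get 12 (.lit Q) * (.agents + 1)).val σ = (n + 1) ^ (Q + 1) := by
      simp only [Expr.val_mul, Expr.val_add, Expr.val_get, Expr.val_zero, Expr.val_one,
        Expr.val_lit, h0, hn, hinv Q le_rfl, pow_succ]
    refine ensures_set (fun _ => by rw [hval]; exact hle _ le_rfl) ⟨fun l hl => ?_, ?_⟩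
    · rw [State.setMem_mem_ne _ (by decide), hinv l hl]
    · rw [hval, Expr.val_zero, State.setMem_mem_same, Function.update_self]

end

theorem Cmd.timeBound_mono (H : ℕ) {Y Y' : ℕ} (h : Y ≤ Y') (c : Cmd) :
    c.timeBound H Y ≤ c.timeBound H Y' := by
  induction c with
  | skip => exact le_rfl
  | seq c₁ c₂ ih₁ ih₂ => simp only [timeBound]; gcongr
  | ite e c₁ c₂ ih₁ ih₂ => simp only [timeBound]; gcongr
  | loop e c ih => simp only [timeBound]; gcongr
  | _ => exact Nat.mul_le_mul_left _ h

theorem size_le_self (k : ℕ) : k.size ≤ k := Nat.size_le.2 k.lt_two_pow_self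

theorem size_mul_two_pow_le (k l : ℕ) : (k * 2 ^ l).size ≤ k + l + 1 := by
  have h1 := size_mul_le k (2 ^ l)
  have h2 := size_le_self k
  rw [Nat.size_pow] at h1
  omega

section

variable {n m : ℕ} (v : Fin n → Fin m → ℚ) (w : Fin n → ℚ)

theorem inputMem_good (i : Fin n) (g : Fin m) :
    inputMem v w 1 (i * m + g) = (v i g).num.natAbs ∧ inputMem v w 2 (i * m + g) = (v i g).den := by
  have hm : 0 < m := Fin.pos g
  have h1 : ((i : ℕ) * m + g) / m = i := by
    rw [mul_comm, Nat.mul_add_div hm, Nat.div_eq_of_lt g.2, add_zero]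
  have h2 : ((i : ℕ) * m + g) % m = g := by
    rw [mul_comm, Nat.mul_add_mod, Nat.mod_eq_of_lt g.2]
  simp [inputMem, h1, h2, hm]

theorem inputMem_cake (i : Fin n) :
    inputMem v w 3 i = (w i).num.natAbs ∧ inputMem v w 4 i = (w i).den := by
  simp [inputMem]

theorem ratBits_good_le (i : Fin n) (g : Fin m) : ratBits (v i g) ≤ inputBits v w := by
  have h1 := Finset.single_le_sum (f := fun g => ratBits (v i g)) (fun _ _ => Nat.zero_le _)
    (Finset.mem_univ g)
  have h2 := Finset.single_le_sum (f := fun i => ∑ g, ratBits (v i g)) (fun _ _ => Nat.zero_le _)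
    (Finset.mem_univ i)
  exact (h1.trans h2).trans (Nat.le_add_right _ _)

theorem ratBits_cake_le (i : Fin n) : ratBits (w i) ≤ inputBits v w := by
  have h1 := Finset.single_le_sum (f := fun i => ratBits (w i)) (fun _ _ => Nat.zero_le _)
    (Finset.mem_univ i)
  exact h1.trans (Nat.le_add_left _ _)

theorem natAbs_num_le {q : ℚ} {L : ℕ} (h : ratBits q ≤ L) : q.num.natAbs ≤ 2 ^ L :=
  (Nat.lt_size_self _).le.trans
    (Nat.pow_le_pow_right two_pos ((Nat.le_add_right _ _).trans h))

theorem den_le {q : ℚ} {L : ℕ} (h : ratBits q ≤ L) : q.den ≤ 2 ^ L :=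
  (Nat.lt_size_self _).le.trans
    (Nat.pow_le_pow_right two_pos ((Nat.le_add_left _ _).trans h))

theorem startState_bdd : (startState v w).Bdd (n + m + 2 ^ inputBits v w) := by
  intro a j
  have hgood := fun i g => natAbs_num_le (ratBits_good_le v w i g)
  have hgood' := fun i g => den_le (ratBits_good_le v w i g)
  have hcake := fun i => natAbs_num_le (ratBits_cake_le v w i)
  have hcake' := fun i => den_le (ratBits_cake_le v w i)
  simp only [startState, inputMem]
  split
  · generalize 2 ^ inputBits v w = z
    split_ifs <;> omega
  · split_ifs
    exacts [(hgood _ _).trans (Nat.le_add_left _ _), Nat.zero_le _]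
  · split_ifs
    exacts [(hgood' _ _).trans (Nat.le_add_left _ _), Nat.zero_le _]
  · split_ifs
    exacts [(hcake _).trans (Nat.le_add_left _ _), Nat.zero_le _]
  · split_ifs
    exacts [(hcake' _).trans (Nat.le_add_left _ _), Nat.zero_le _]
  · exact Nat.zero_le _

/-- The product of all denominators of the input. -/
def dens : ℕ := ∏ i, ((∏ g, (v i g).den) * (w i).den)

theorem dens_pos : 0 < dens v w :=
  Finset.prod_pos fun i _ => Nat.mul_pos (Finset.prod_pos fun g _ => (v i g).den_pos) (w i).den_pos

theorem dens_le : dens v w ≤ 2 ^ inputBits v w := by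
  rw [dens, inputBits, Finset.prod_mul_distrib, pow_add, ← Finset.prod_pow_eq_pow_sum,
    ← Finset.prod_pow_eq_pow_sum]
  refine Nat.mul_le_mul (Finset.prod_le_prod' fun i _ => ?_)
    (Finset.prod_le_prod' fun i _ => den_le le_rfl)
  rw [← Finset.prod_pow_eq_pow_sum]
  exact Finset.prod_le_prod' fun g _ => den_le le_rfl

theorem den_good_dvd (i : Fin n) (g : Fin m) : (v i g).den ∣ dens v w :=
  ((Finset.dvd_prod_of_mem (fun g => (v i g).den) (Finset.mem_univ g)).mul_right _).trans
    (Finset.dvd_prod_of_mem (fun i => (∏ g, (v i g).den) * (w i).den) (Finset.mem_univ i))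

theorem den_cake_dvd (i : Fin n) : (w i).den ∣ dens v w :=
  (dvd_mul_left _ _).trans
    (Finset.dvd_prod_of_mem (fun i => (∏ g, (v i g).den) * (w i).den) (Finset.mem_univ i))

end

theorem cast_natAbs_num_mul {q : ℚ} (hq : 0 ≤ (q : ℝ)) {D : ℕ} (h : q.den ∣ D) :
    ((q.num.natAbs * (D / q.den) : ℕ) : ℝ) = D * (q : ℝ) := by
  have hq' : 0 ≤ q := by exact_mod_cast hq
  have h0 : (q.den : ℝ) ≠ 0 := by exact_mod_cast q.den_ne_zero
  have h1 : (q : ℝ) = (q.num.natAbs : ℝ) / q.den := by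
    rw [Rat.cast_def, Nat.cast_natAbs, abs_of_nonneg (Rat.num_nonneg.2 hq')]
  rw [Nat.cast_mul, Nat.cast_div h h0, h1]
  ring

theorem eq_zero_or_inv_le {q : ℚ} (hq : 0 ≤ (q : ℝ)) {D : ℕ} (hD : 0 < D) (h : q.den ∣ D) :
    (q : ℝ) = 0 ∨ (1 : ℝ) / D ≤ q := by
  have h1 := cast_natAbs_num_mul hq h
  have hD' : (0 : ℝ) < D := Nat.cast_pos.2 hD
  rcases Nat.eq_zero_or_pos (q.num.natAbs * (D / q.den)) with h0 | h0
  · rw [h0, Nat.cast_zero, eq_comm, mul_eq_zero] at h1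
    exact Or.inl (h1.resolve_left hD'.ne')
  · right
    rw [div_le_iff₀ hD', mul_comm, ← h1]
    exact_mod_cast h0

section

variable {n m : ℕ} {I : Instance n m} {v : Fin n → Fin m → ℚ} {w : Fin n → ℚ}

/-- Total correctness of the algorithm. The factor `n * ((r * r + r) * r)` in the scale makes every
positive maximin share so large that rounding to integers does no harm. -/
theorem ensures_mainCmd {r X H T : ℕ} (hn : 0 < n) (hv : ∀ i g, I.good i g = (v i g : ℝ))
    (hw : ∀ i, I.wholeCake i = (w i : ℝ)) (hr : 5 ≤ r)
    (hX : (n + 1) ^ (r * r + 1) + n * (r * r) + r * r + n + m + 1 ≤ X)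
    (hXT : 2 * n * (r * r * T) + T ≤ X)
    (hT : (m + 1) * 2 ^ inputBits v w * (n * ((r * r + r) * r) * 2 ^ inputBits v w) ≤ T)
    (hH : (n + 1) ^ (r * r + 1) + r * r + n + m ≤ H) (hHT : r * T.size ≤ H) :
    Ensures I X H (mainCmd r) (fun σ => I.alpha ≤ (outputRatio σ : ℝ) ∧
      (outputRatio σ : ℝ) ≤ 1 ∧ ∃ A : Allocation n m, OutputsAllocation σ A ∧
        I.IsApproxMMS ((1 - 5 / (r : ℝ)) * (outputRatio σ : ℝ)) A) (startState v w) := by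
  set L := inputBits v w with hL
  set K := (r * r + r) * r with hK
  set D := n * K * dens v w with hD
  have hK0 : 0 < K := by positivity
  have hdens := dens_pos v w
  have hD0 : 0 < D := by positivity
  have hD' : (0 : ℝ) < D := Nat.cast_pos.2 hD0
  have hv0 : ∀ i g, 0 ≤ (v i g : ℝ) := fun i g => hv i g ▸ I.good_nonneg i g
  have hw0 : ∀ i, 0 ≤ (w i : ℝ) := fun i => hw i ▸ I.wholeCake_nonneg i
  have hDle : D ≤ n * K * 2 ^ L := Nat.mul_le_mul_left _ (dens_le v w)
  have hDT : (m + 1) * 2 ^ L * D ≤ T := (Nat.mul_le_mul_left _ hDle).trans hT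
  have hDT' : D ≤ T := le_trans (Nat.le_mul_of_pos_left _ (by positivity)) hDT
  set U : ℕ → ℕ → ℕ := fun i g => inputMem v w 1 (i * m + g) * (D / inputMem v w 2 (i * m + g))
    with hUdef
  set C : ℕ → ℕ := fun i => inputMem v w 3 i * (D / inputMem v w 4 i) with hCdef
  have hU : ∀ (i : Fin n) (g : Fin m), (U i g : ℝ) = D * I.good i g := fun i g => by
    simp only [hUdef]
    rw [(inputMem_good v w i g).1, (inputMem_good v w i g).2, hv,
      cast_natAbs_num_mul (hv0 i g) ((den_good_dvd v w i g).mul_left _)]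
  have hC : ∀ i : Fin n, (C i : ℝ) = D * I.wholeCake i := fun i => by
    simp only [hCdef]
    rw [(inputMem_cake v w i).1, (inputMem_cake v w i).2, hw,
      cast_natAbs_num_mul (hw0 i) ((den_cake_dvd v w i).mul_left _)]
  have hTsum : ∀ i < n, C i + ∑ g ∈ Finset.range m, U i g ≤ T := by
    intro i hi
    have h1 : C i ≤ 2 ^ L * D := by
      refine Nat.mul_le_mul ?_ (Nat.div_le_self _ _)
      have := natAbs_num_le (ratBits_cake_le v w ⟨i, hi⟩)
      rw [← (inputMem_cake v w ⟨i, hi⟩).1] at this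
      exact this
    have h2 : ∑ g ∈ Finset.range m, U i g ≤ m * (2 ^ L * D) := by
      have : ∀ g ∈ Finset.range m, U i g ≤ 2 ^ L * D := fun g hg => by
        refine Nat.mul_le_mul ?_ (Nat.div_le_self _ _)
        have := natAbs_num_le (ratBits_good_le v w ⟨i, hi⟩ ⟨g, Finset.mem_range.1 hg⟩)
        rw [← (inputMem_good v w ⟨i, hi⟩ ⟨g, Finset.mem_range.1 hg⟩).1] at this
        exact this
      simpa using Finset.sum_le_card_nsmul _ _ _ this
    refine le_trans ?_ hDT
    calc C i + ∑ g ∈ Finset.range m, U i g ≤ 2 ^ L * D + m * (2 ^ L * D) := Nat.add_le_add h1 h2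
      _ = (m + 1) * 2 ^ L * D := by ring
  have hM : ∀ i, 0 < I.mms i n → ((r * r : ℕ) + (r : ℝ)) * r ≤ D * I.mms i n := by
    intro i hi
    have hd' : (0 : ℝ) < dens v w := Nat.cast_pos.2 hdens
    have hn' : (0 : ℝ) < n := Nat.cast_pos.2 hn
    have h1 := I.div_le_mms_of_pos i (κ := 1 / (dens v w : ℝ)) (by positivity)
      (fun g => by rw [hv]; exact eq_zero_or_inv_le (hv0 i g) hdens (den_good_dvd v w i g))
      (by rw [hw]; exact eq_zero_or_inv_le (hw0 i) hdens (den_cake_dvd v w i)) hi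
    calc ((r * r : ℕ) + (r : ℝ)) * r = D * (1 / (dens v w : ℝ) / n) := by
          rw [hD, hK]; push_cast; field_simp
      _ ≤ D * I.mms i n := by gcongr
  refine ensures_seq ((ensures_scaleCmd (n := n) (m := m) (F := D)
    (d := fun i g => inputMem v w 2 (i * m + g)) (e := inputMem v w 4) rfl rfl (by omega) (by omega)
    (fun _ _ _ _ => rfl) (fun _ _ => rfl) ?_ hD0 (by omega)).mono fun s₁ f₁ h₁ => ?_)
  · rw [hD, dens, Finset.prod_range]
    refine congrArg _ (Finset.prod_congr rfl fun i _ => ?_)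
    rw [(inputMem_cake v w i).2, Finset.prod_range]
    exact congrArg (· * _) (Finset.prod_congr rfl fun g _ => (inputMem_good v w i g).2)
  have e₁ : ∀ b, b ∉ [10, 14, 19] → s₁.mem b = (startState v w).mem b := fun b hb => by
    simp only [List.mem_cons, List.not_mem_nil, or_false, not_or] at hb
    exact f₁.1 b (by simp [Cmd.writes, scaleCmd, hb])
  have o₁ : s₁.out = [] := (f₁.2 rfl).2
  refine ensures_seq ((ensures_powersCmd (n := n) (by rw [e₁ 0 (by decide)]; rfl) (by omega)
    (by omega)).mono fun s₂ f₂ h₂ => ?_)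
  have e₂ : ∀ b, b ∉ [10, 11, 12, 13, 14, 19] → s₂.mem b = (startState v w).mem b := fun b hb => by
    simp only [List.mem_cons, List.not_mem_nil, or_false, not_or] at hb
    rw [f₂.1 b (by simp [Cmd.writes, powersCmd, hb]), e₁ b (by simp [hb])]
  have o₂ : s₂.out = [] := by rw [(f₂.2 rfl).2, o₁]
  have henv : Env n m D U C s₂ := by
    constructor
    · rw [e₂ 0 (by decide)]; rfl
    · rw [e₂ 0 (by decide)]; rfl
    · rw [f₂.1 10 (by simp [Cmd.writes, powersCmd]), h₁]
    · intro i _ g _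
      rw [e₂ 1 (by decide), e₂ 2 (by decide)]; rfl
    · intro i _
      rw [e₂ 3 (by decide), e₂ 4 (by decide)]; rfl
  refine ensures_seq ((ensures_targetsCmd hr hX hXT hTsum hH hHT hD0 hU hC hM henv h₂).mono
    fun s₃ f₃ h₃ => ?_)
  obtain ⟨-, hα, hα1, htarget⟩ := h₃
  have e₃ : ∀ b, b ∉ [6, 14, 15, 16, 17, 18, 19, 20, 21, 22, 23, 24, 25] →
      s₃.mem b = s₂.mem b := fun b hb => by
    simp only [List.mem_cons, List.not_mem_nil, or_false, not_or] at hb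
    exact f₃.1 b (by
      simp [Cmd.writes, targetsCmd, searchCmd, decideCmd_writes, targetCmd, hb])
  have o₃ : s₃.out = [] := by rw [(f₃.2 rfl).2, o₂]
  have hUX : ∀ i < n, ∑ g ∈ Finset.range m, U i g ≤ X := fun i hi => by
    have := hTsum i hi
    omega
  refine (ensures_allocateCmd (A := s₃.mem 23) hn (by omega) (by omega) hD0 hUX hU
    (henv.congr ?_) (fun _ => rfl) (fun i => ?_) (fun i => ?_) (fun j => ?_) (fun j => ?_)
    (fun j => ?_) o₃).mono fun σ f₄ h₄ => ?_
  · intro b hb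
    exact e₃ b (by simp only [List.mem_cons, List.not_mem_nil, or_false] at hb ⊢; omega)
  · rw [div_le_iff₀ hD', mul_comm]
    exact (htarget i).le_mms
  · have h1 := (htarget i).le_cake
    have h2 : ((n : ℝ) - 1) * (2 * ((s₃.mem 23 i : ℝ) / D) - I.mms i n) =
        ((n : ℝ) - 1) * (2 * s₃.mem 23 i - D * I.mms i n) / D := by
      field_simp
    rw [h2, div_le_iff₀ hD', mul_comm (I.wholeCake i)]
    exact h1
  · rw [e₃ 5 (by decide), e₂ 5 (by decide)]; rfl
  · rw [e₃ 30 (by decide), e₂ 30 (by decide)]; rfl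
  · rw [e₃ 31 (by decide), e₂ 31 (by decide)]; rfl
  obtain ⟨P, hP, hP'⟩ := h₄
  have h6 : σ.mem 6 = s₃.mem 6 :=
    f₄.1 6 (by simp [Cmd.writes, allocateCmd, singlesCmd, roundsCmd, findCmd, serveCmd])
  have hβ : (outputRatio σ : ℝ) = (s₃.mem 6 0 : ℝ) / s₃.mem 6 1 := by
    rw [outputRatio, h6]; push_cast; rfl
  rw [hβ]
  refine ⟨hα, hα1, P, hP, fun i => le_trans ?_ (hP' i)⟩
  rw [le_div_iff₀ hD']
  refine le_trans (le_of_eq ?_) (htarget i).ratio_le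
  ring

end

/-- For a fixed precision `r`, the bounds on cells and loop turns in `ensures_mainCmd` can be chosen
such that the turns and the number of bits are polynomial in `n`, `m` and `L`. -/
theorem exists_polynomial_time (r : ℕ) (hr : 5 ≤ r) :
    ∃ p : MvPolynomial (Fin 3) ℕ, ∀ (n m : ℕ), 0 < n → ∀ (I : Instance n m)
      (v : Fin n → Fin m → ℚ) (w : Fin n → ℚ),
      (∀ i g, I.good i g = (v i g : ℝ)) → (∀ i, I.wholeCake i = (w i : ℝ)) →
      ∃ (s : State) (t : ℕ), Exec I (mainCmd r) (startState v w) s t ∧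
        t ≤ MvPolynomial.eval ![n, m, inputBits v w] p ∧
        I.alpha ≤ (outputRatio s : ℝ) ∧ (outputRatio s : ℝ) ≤ 1 ∧
        ∃ A : Allocation n m, OutputsAllocation s A ∧
          I.IsApproxMMS ((1 - 5 / (r : ℝ)) * (outputRatio s : ℝ)) A := by
  let N : MvPolynomial (Fin 3) ℕ := .X 0
  let M : MvPolynomial (Fin 3) ℕ := .X 1
  let L : MvPolynomial (Fin 3) ℕ := .X 2
  let R : MvPolynomial (Fin 3) ℕ := .C r
  -- `T * 2 ^ (2 * L)` bounds the scaled total utilities, and `W * 2 ^ (2 * L)` all memory cells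
  let T := (M + 1) * (N * ((R * R + R) * R))
  let W := (N + 1) ^ (r * r + 1) + N * (R * R) + R * R + N + M + 1 + (2 * N * (R * R * T) + T)
  obtain ⟨p, hp⟩ := exists_timeBound_poly (mainCmd r)
    ((N + 1) ^ (r * r + 1) + R * R + N + M + R * (T + 2 * L + 1)) (W + 2 * L + 2)
  refine ⟨p, fun n m hn I v w hv hw => ?_⟩
  have hp' := hp ![n, m, inputBits v w]
  simp only [N, M, L, R, T, W, map_add, map_mul, map_pow, map_one, map_ofNat, MvPolynomial.eval_X,
    MvPolynomial.eval_C, Matrix.cons_val_zero, Matrix.cons_val_one, Matrix.cons_val] at hp'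
  clear hp
  set l := inputBits v w
  set k := (m + 1) * (n * ((r * r + r) * r)) with hk
  set x := (n + 1) ^ (r * r + 1) + n * (r * r) + r * r + n + m + 1 + (2 * n * (r * r * k) + k)
    with hx
  set h := (n + 1) ^ (r * r + 1) + r * r + n + m + r * (k + 2 * l + 1) with hh
  have hpow : 1 ≤ 2 ^ (2 * l) := Nat.one_le_two_pow
  have hpow' : 2 ^ l ≤ 2 ^ (2 * l) := Nat.pow_le_pow_right two_pos (by omega)
  have hx1 : (n + 1) ^ (r * r + 1) + n * (r * r) + r * r + n + m + 1 ≤ x * 2 ^ (2 * l) :=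
    (Nat.le_add_right _ _).trans (Nat.le_mul_of_pos_right _ hpow)
  have hbdd : (startState v w).Bdd (x * 2 ^ (2 * l)) := fun a j => by
    have : n + m + 1 ≤ x := by omega
    calc (startState v w).mem a j ≤ n + m + 2 ^ l := startState_bdd v w a j
      _ ≤ (n + m) * 2 ^ (2 * l) + 1 * 2 ^ (2 * l) := by
          rw [one_mul]
          exact Nat.add_le_add (Nat.le_mul_of_pos_right _ hpow) hpow'
      _ = (n + m + 1) * 2 ^ (2 * l) := by ring
      _ ≤ x * 2 ^ (2 * l) := Nat.mul_le_mul_right _ this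
  have hmain := ensures_mainCmd (r := r) (X := x * 2 ^ (2 * l)) (H := h) (T := k * 2 ^ (2 * l)) hn
    hv hw hr hx1 ?_ ?_ (Nat.le_add_right _ _) ?_
  · obtain ⟨s, t, h1, h2, -, h3⟩ := hmain hbdd
    refine ⟨s, t, h1, h2.trans (le_trans (Cmd.timeBound_mono _ ?_ _) hp'.le), h3⟩
    have := size_mul_two_pow_le x (2 * l)
    omega
  · calc 2 * n * (r * r * (k * 2 ^ (2 * l))) + k * 2 ^ (2 * l)
        = (2 * n * (r * r * k) + k) * 2 ^ (2 * l) := by ring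
      _ ≤ x * 2 ^ (2 * l) := Nat.mul_le_mul_right _ (Nat.le_add_left _ _)
  · rw [hk, two_mul, pow_add]
    exact le_of_eq (by ring)
  · calc r * (k * 2 ^ (2 * l)).size ≤ r * (k + 2 * l + 1) :=
        Nat.mul_le_mul_left _ (size_mul_two_pow_le _ _)
      _ ≤ h := Nat.le_add_left _ _

theorem exists_polynomial_time_scheme (ε : ℝ) (hε : 0 < ε) :
    ∃ (c : Cmd) (p : MvPolynomial (Fin 3) ℕ), ∀ (n m : ℕ), 0 < n → ∀ (I : Instance n m)
      (v : Fin n → Fin m → ℚ) (w : Fin n → ℚ),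
      (∀ i g, I.good i g = (v i g : ℝ)) → (∀ i, I.wholeCake i = (w i : ℝ)) →
      ∃ (s : State) (t : ℕ), Exec I c (startState v w) s t ∧
        t ≤ MvPolynomial.eval ![n, m, inputBits v w] p ∧
        I.alpha ≤ (outputRatio s : ℝ) ∧ (outputRatio s : ℝ) ≤ 1 ∧
        ∃ A : Allocation n m, OutputsAllocation s A ∧
          I.IsApproxMMS ((1 - ε) * (outputRatio s : ℝ)) A := by
  set r := max 5 ⌈5 / ε⌉₊
  have hr : 5 ≤ r := le_max_left _ _
  have hrε : 5 / (r : ℝ) ≤ ε := by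
    have h1 : 5 / ε ≤ r := (Nat.le_ceil _).trans (Nat.cast_le.2 (le_max_right _ _))
    have h2 : (0 : ℝ) < r := by positivity
    rw [div_le_iff₀ hε] at h1
    rw [div_le_iff₀ h2]
    linarith
  obtain ⟨p, hp⟩ := exists_polynomial_time r hr
  refine ⟨mainCmd r, p, fun n m hn I v w hv hw => ?_⟩
  obtain ⟨s, t, h1, h2, h3, h4, A, h5, h6⟩ := hp n m hn I v w hv hw
  refine ⟨s, t, h1, h2, h3, h4, A, h5, fun i => le_trans ?_ (h6 i)⟩
  have h7 := I.mms_nonneg i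
  have h8 := I.alpha_nonneg.trans h3
  gcongr

end MixedGoods

theorem theorem3 :
    (∀ (n m : ℕ), 0 < n → ∀ I : MixedGoods.Instance n m,
      ∃ A : MixedGoods.Allocation n m, I.IsApproxMMS I.alpha A) ∧
    (∀ ε : ℝ, 0 < ε →
      ∃ (c : MixedGoods.Cmd) (p : MvPolynomial (Fin 3) ℕ),
        ∀ (n m : ℕ), 0 < n → ∀ (I : MixedGoods.Instance n m)
          (v : Fin n → Fin m → ℚ) (w : Fin n → ℚ),
          (∀ i g, I.good i g = (v i g : ℝ)) → (∀ i, I.wholeCake i = (w i : ℝ)) →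
          ∃ (s : MixedGoods.State) (t : ℕ),
            MixedGoods.Exec I c (MixedGoods.startState v w) s t ∧
            t ≤ MvPolynomial.eval ![n, m, MixedGoods.inputBits v w] p ∧
            I.alpha ≤ (MixedGoods.outputRatio s : ℝ) ∧
            (MixedGoods.outputRatio s : ℝ) ≤ 1 ∧
            ∃ A : MixedGoods.Allocation n m,
              MixedGoods.OutputsAllocation s A ∧
              I.IsApproxMMS ((1 - ε) * (MixedGoods.outputRatio s : ℝ)) A) :=
  ⟨fun _ _ hn I => I.exists_isApproxMMS_alpha hn, MixedGoods.exists_polynomial_time_scheme⟩
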